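/- Let $\Omega\subset\mathbb{R}^2$ be a bounded domain whose boundary $\Gamma$ is Lipschitz and polygonal, with finitely many edges (open line segments) joined at corner points, outer unit normal $n$ (equal to the constant $n_E$ on an edge $E$) and counterclockwise unit tangent $t=(-n_2,n_1)^T$. Each edge is of exactly one of three types: clamped, simply supported, or free. Correspondingly $\Gamma=\Gamma_c\cup\Gamma_s\cup\Gamma_f$; $\Gamma_f$ is taken with the end points of its edges. Two edges of the same type never meet at an angle of $\pi$, and at least one edge is clamped. Boundary values are understood in the sense of traces. Put $$W=\{v\in H^2(\Omega):\ v=0 \text{ and } \partial v/\partial n=0 \text{ on } \Gamma_c,\ v=0\text{ on }\Gamma_s\}.$$ For $\psi,\xi\in (H^1(\Omega))^2$ let $\partial\psi/\partial t=(\operatorname{Curl}\psi)\,n$ denote the weak normal trace of the matrix field $\operatorname{Curl}\psi$ with rows $(\partial_2\psi_i,-\partial_1\psi_i)$, $i=1,2$, that is, $$\langle \partial\psi/\partial t,\xi\rangle_\Gamma=\int_\Omega \operatorname{Curl}\psi:\nabla\xi\,dx,$$ and let $$\Psi_0=\{\psi\in (H^1(\Omega))^2:\ \langle \partial\psi/\partial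 t,\nabla v\rangle_\Gamma=0\ \text{ for all } v\in W\},\qquad RT_0=\{x\mapsto ax+b:\ a\in\mathbb{R},\ b\in\mathbb{R}^2\}.$$ Then $\Psi_0$ is equal to the set of all $\psi\in (H^1(\Omega))^2$ that satisfy the boundary conditions $$\psi\cdot n=c_E\ \text{ on each edge } E\subset\Gamma_s,\qquad \psi=r_C\ \text{ on each connected component } C \text{ of } \Gamma_f, \tag{1}$$ with some constants $c_E\in\mathbb{R}$, one for each edge $E\subset\Gamma_s$, and functions $r_C\in RT_0$, one for each connected component $C$ of $\Gamma_f$, satisfying the compatibility conditions $$c_E=r_C(x)\cdot n_E \tag{2}$$ for every edge $E\subset\Gamma_s$, every connected component $C$ of $\Gamma_f$, and every corner point $x$ shared by $C$ and $E$ (i.e. $x\in C$ is an end point of $E$). Moreover, for each choice of constants $c_E\in\mathbb{R}$ and functions $r_C\in RT_0$ that satisfies (2), there is a function $\psi\in (H^1(\Omega))^2$ for which (1) holds. -/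

import Mathlib

open MeasureTheory Filter Topology Set
open scoped ContDiff ENNReal

noncomputable section

namespace KirchhoffPlate

/-- The Euclidean plane. -/
abbrev Plane : Type := EuclideanSpace ℝ (Fin 2)

/-! ### Sobolev spaces on an open subset of the plane -/

/-- The classical partial derivative `∂φ/∂xᵢ`. -/
def classicalPartial (i : Fin 2) (φ : Plane → ℝ) (x : Plane) : ℝ :=
  fderiv ℝ φ x (EuclideanSpace.single i 1)

/-- `g ∈ L²(Ω)` is the `i`-th weak partial derivative of `u` on `Ω`. -/
def IsWeakPartial (Ω : Set Plane) (i : Fin 2) (u g : Plane → ℝ) : Prop :=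
  MemLp g 2 (volume.restrict Ω) ∧
    ∀ φ : Plane → ℝ, ContDiff ℝ ∞ φ → HasCompactSupport φ → tsupport φ ⊆ Ω →
      ∫ x in Ω, u x * classicalPartial i φ x = -∫ x in Ω, g x * φ x

/-- `u ∈ H¹(Ω)`. Functions are represented on the whole plane; only their values almost everywhere
on `Ω` matter. -/
def MemH1 (Ω : Set Plane) (u : Plane → ℝ) : Prop :=
  MemLp u 2 (volume.restrict Ω) ∧ ∀ i, ∃ g, IsWeakPartial Ω i u g

open Classical in
/-- The weak partial derivative (unique up to null sets; `0` if there is none in `L²(Ω)`). -/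
def weakPartial (Ω : Set Plane) (i : Fin 2) (u : Plane → ℝ) : Plane → ℝ :=
  if h : ∃ g, IsWeakPartial Ω i u g then h.choose else 0

/-- `ψ ∈ (H¹(Ω))²`. -/
def MemH1Vec (Ω : Set Plane) (ψ : Plane → Plane) : Prop :=
  ∀ i, MemH1 Ω (fun x => ψ x i)

/-- The weak gradient `∇v` of a scalar function. -/
def weakGrad (Ω : Set Plane) (v : Plane → ℝ) (x : Plane) : Plane :=
  WithLp.toLp 2 (fun i => weakPartial Ω i v x)

/-- `v ∈ H²(Ω)`. -/
def MemH2 (Ω : Set Plane) (v : Plane → ℝ) : Prop :=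
  MemH1 Ω v ∧ MemH1Vec Ω (weakGrad Ω v)

/-- The weak Jacobian `(∇ξ)ᵢⱼ = ∂ⱼ ξᵢ` of a vector field. -/
def weakJacobian (Ω : Set Plane) (ξ : Plane → Plane) (x : Plane) : Matrix (Fin 2) (Fin 2) ℝ :=
  Matrix.of (fun i j => weakPartial Ω j (fun y => ξ y i) x)

/-- The row-wise curl of a vector field: row `i` is `(∂₂ψᵢ, -∂₁ψᵢ)`. -/
def Curl (Ω : Set Plane) (ψ : Plane → Plane) (x : Plane) : Matrix (Fin 2) (Fin 2) ℝ :=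
  !![weakPartial Ω 1 (fun y => ψ y 0) x, -weakPartial Ω 0 (fun y => ψ y 0) x;
     weakPartial Ω 1 (fun y => ψ y 1) x, -weakPartial Ω 0 (fun y => ψ y 1) x]

/-- The Frobenius inner product `A : B`. -/
def frobenius (A B : Matrix (Fin 2) (Fin 2) ℝ) : ℝ := ∑ i, ∑ j, A i j * B i j

/-- The duality product `⟨∂ψ/∂t, ξ⟩_Γ`, for `ψ, ξ ∈ (H¹(Ω))²`, where `∂ψ/∂t = (Curl ψ) n` is the
weak normal trace of the divergence-free field `Curl ψ`; by the definition of the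
weak normal trace it equals `∫_Ω Curl ψ : ∇ξ`. -/
def tangentialPairing (Ω : Set Plane) (ψ ξ : Plane → Plane) : ℝ :=
  ∫ x in Ω, frobenius (Curl Ω ψ x) (weakJacobian Ω ξ x)

/-! ### Polygonal Lipschitz domains with mixed boundary conditions -/

/-- Near each boundary point, in suitable Cartesian coordinates, `Ω` is the region strictly below
the graph of a Lipschitz function. -/
def HasLipschitzBoundary (Ω : Set Plane) : Prop :=
  ∀ x ∈ frontier Ω, ∃ (e : Plane ≃ᵢ Plane) (L : NNReal) (g : ℝ → ℝ) (ρ : ℝ),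
    LipschitzWith L g ∧ 0 < ρ ∧ ∀ y ∈ Metric.ball x ρ, (y ∈ Ω ↔ (e y) 1 < g ((e y) 0))

/-- The types of boundary condition. -/
inductive BC where
  | clamped
  | simplySupported
  | free

/-- The unit vector pointing from `a` to `b`. -/
def unitTangent (a b : Plane) : Plane := ‖b - a‖⁻¹ • (b - a)

/-- The unit vector `n` obtained by rotating `t = unitTangent a b` clockwise by a right angle, so
that `t = (-n₂, n₁)`. -/
def unitNormal (a b : Plane) : Plane := !₂[unitTangent a b 1, -unitTangent a b 0]

/-- A bounded domain with polygonal Lipschitz boundary, whose edges carry boundary conditions.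
Edge `k` is the open segment from `p k` to `q k`, traversed with the domain on the left. -/
structure Plate where
  Ω : Set Plane
  isOpen : IsOpen Ω
  isConnected : IsConnected Ω
  isBounded : Bornology.IsBounded Ω
  lipschitz : HasLipschitzBoundary Ω
  /-- The number of edges. -/
  K : ℕ
  p : Fin K → Plane
  q : Fin K → Plane
  p_ne_q : ∀ k, p k ≠ q k
  frontier_eq : frontier Ω = ⋃ k, segment ℝ (p k) (q k)
  edges_disjoint : ∀ k l, k ≠ l → Disjoint (openSegment ℝ (p k) (q k)) (openSegment ℝ (p l) (q l))
  p_notMem_edge : ∀ k l, p k ∉ openSegment ℝ (p l) (q l)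
  q_notMem_edge : ∀ k l, q k ∉ openSegment ℝ (p l) (q l)
  /-- The vector `unitNormal (p k) (q k)` is the outer normal on edge `k`. -/
  outer : ∀ k, ∀ x ∈ openSegment ℝ (p k) (q k), ∃ ε > 0, ∀ s ∈ Ioo (0 : ℝ) ε,
    x - s • unitNormal (p k) (q k) ∈ Ω
  bc : Fin K → BC
  /-- Edges are maximal: two consecutive edges with the same boundary condition do not meet at an
  angle of `π`. -/
  maximal : ∀ k l, q k = p l → bc k = bc l →
    unitTangent (p k) (q k) ≠ unitTangent (p l) (q l)

namespace Plate

variable (P : Plate)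

/-- The outer unit normal on edge `k`. -/
def normal (k : Fin P.K) : Plane := unitNormal (P.p k) (P.q k)

/-- The arc length measure on edge `k`. -/
def edgeMeasure (k : Fin P.K) : Measure Plane :=
  ENNReal.ofReal ‖P.q k - P.p k‖ •
    Measure.map (fun s : ℝ => P.p k + s • (P.q k - P.p k)) (volume.restrict (Ioo 0 1))

/-- The arc length measure on the boundary `Γ`. -/
def boundaryMeasure : Measure Plane := ∑ k, P.edgeMeasure k

/-- `g ∈ L²(Γ)` is the trace of `u ∈ H¹(Ω)`: some functions from `C^∞(Ω̄)` converge to `u` in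
`H¹(Ω)` while their boundary values converge to `g` in `L²(Γ)`. -/
def HasTrace (u g : Plane → ℝ) : Prop :=
  MemH1 P.Ω u ∧ MemLp g 2 P.boundaryMeasure ∧
    ∃ φ : ℕ → Plane → ℝ, (∀ m, ContDiff ℝ ∞ (φ m)) ∧
      Tendsto (fun m => eLpNorm (φ m - u) 2 (volume.restrict P.Ω)) atTop (𝓝 0) ∧
      (∀ i, Tendsto
        (fun m => eLpNorm (classicalPartial i (φ m) - weakPartial P.Ω i u) 2
          (volume.restrict P.Ω)) atTop (𝓝 0)) ∧
      Tendsto (fun m => eLpNorm (φ m - g) 2 P.boundaryMeasure) atTop (𝓝 0)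

/-- The trace of a vector field, componentwise. -/
def HasTraceVec (ψ g : Plane → Plane) : Prop :=
  ∀ i, P.HasTrace (fun x => ψ x i) (fun x => g x i)

/-- The space `W` of all `v ∈ H²(Ω)` with `v = 0` on the clamped and simply supported edges and
`∂v/∂n = 0` on the clamped edges. -/
def W : Set (Plane → ℝ) :=
  {v | MemH2 P.Ω v ∧
    (∃ g, P.HasTrace v g ∧ ∀ k, P.bc k = BC.clamped ∨ P.bc k = BC.simplySupported →
      ∀ᵐ x ∂P.edgeMeasure k, g x = 0) ∧
    ∃ h, P.HasTraceVec (weakGrad P.Ω v) h ∧ ∀ k, P.bc k = BC.clamped →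
      ∀ᵐ x ∂P.edgeMeasure k, inner ℝ (h x) (P.normal k) = 0}

/-- The space `Ψ₀` of all `ψ ∈ (H¹(Ω))²` with `⟨∂ψ/∂t, ∇v⟩_Γ = 0` for all `v ∈ W`. -/
def Psi0 : Set (Plane → Plane) :=
  {ψ | MemH1Vec P.Ω ψ ∧ ∀ v ∈ P.W, tangentialPairing P.Ω ψ (weakGrad P.Ω v) = 0}

/-- The free boundary `Γ_f`, with the end points of its edges. -/
def freeBoundary : Set Plane :=
  ⋃ k, ⋃ _ : P.bc k = BC.free, segment ℝ (P.p k) (P.q k)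

/-- The connected components of the free boundary. -/
def freeComponents : Set (Set Plane) :=
  {C | ∃ x ∈ P.freeBoundary, C = connectedComponentIn P.freeBoundary x}

end Plate

/-- The lowest order Raviart–Thomas functions `x ↦ a x + b`, `a ∈ ℝ`, `b ∈ ℝ²`. -/
def RT0 : Set (Plane → Plane) := {r | ∃ (a : ℝ) (b : Plane), r = fun x => a • x + b}

namespace Plate

variable (P : Plate)

/-- Constants `c k`, one for each simply supported edge, and functions `r C ∈ RT₀`, one for each
connected component of the free boundary, that satisfy the compatibility conditions at the corners
shared by a simply supported edge and a component of the free boundary. (The values of `c` and `r`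
at other arguments are irrelevant.) -/
def IsCompatible (c : Fin P.K → ℝ) (r : Set Plane → Plane → Plane) : Prop :=
  (∀ C ∈ P.freeComponents, r C ∈ RT0) ∧
    ∀ k, P.bc k = BC.simplySupported → ∀ C ∈ P.freeComponents,
      ∀ x ∈ C, (x = P.p k ∨ x = P.q k) → c k = inner ℝ (r C x) (P.normal k)

/-- In the sense of traces, `ψ · n = c k` on each simply supported edge `k` and `ψ = r C` on each
connected component `C` of the free boundary. -/
def SatisfiesBC (ψ : Plane → Plane) (c : Fin P.K → ℝ) (r : Set Plane → Plane → Plane) : Prop :=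
  ∃ g, P.HasTraceVec ψ g ∧
    (∀ k, P.bc k = BC.simplySupported →
      ∀ᵐ x ∂P.edgeMeasure k, inner ℝ (g x) (P.normal k) = c k) ∧
    ∀ C ∈ P.freeComponents, ∀ᵐ x ∂P.boundaryMeasure.restrict C, g x = r C x

end Plate

end KirchhoffPlate

end

/-! For smooth `v` the pairing is, up to sign, the sum over the edges of the integrals of ∂(∇v)/∂t ·
g, where g is the trace of ψ (`HasTraceWith.jac_smooth`, `sum_edgePairing_eq_zero`). The tangential
derivative has moved from ψ to ∇v, so only the L² trace of ψ enters.

Necessity of (1) and (2) needs only smooth test functions. Those living near the interior of one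
edge, with gradient χ n or χ' t along it, show by the lemma of du Bois-Reymond that ψ·n is constant
on every edge that is not clamped and that ψ·t is affine in arc length on every free edge; together
this says ψ = ax + b on a free edge. The edge integrals then become exact and leave only values at
the end points (`edgePairing_free`, `edgePairing_simplySupported`). Test functions living near one
corner compare these values: at a corner of two free edges the value and the gradient of v are
arbitrary, so a and b pass from edge to edge and are constant on each component; at a corner x of a
simply supported and a free edge, v = (y - x)·n gives (2).

Existence: the values admissible at a boundary point form a convex set, so smooth local solutions
can be glued by a partition of unity (`exists_smooth_of_compatible`). Near a component C one takes
r_C. Elsewhere a constant works, because two simply supported edges that meet have linearly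
independent normals, the angle π being excluded.

Sufficiency has to treat all v in W, and no density of smooth functions in W is used. Instead ψ is
split as ψ₀ + (ψ - ψ₀), with ψ₀ a smooth extension of the same data. For ψ₀, on every edge ∂ψ₀/∂t ·
∇v equals η ∂v/∂t, where the smooth function η equals the slope a of r_C on C. Integration by parts
along Γ leaves ∂η/∂t v, which vanishes: η is constant on free edges and v is zero on the others
(`sum_jac_smooth_eq_zero`). For the difference, in the normal and in the tangential direction of
each edge, either the trace of ψ - ψ₀ or that of ∇v is zero. A cutoff away from the corners reduces
the claim to one edge and to the fact that the pairing vanishes when one of the two traces does.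
Corners are removable because points have zero capacity in the plane; this works directly for a
bounded first field, and truncating the values by a scalar factor, which respects the vanishing
directions, gives the general case (`sum_jac_eq_zero`).

The trace theory behind this is built on a cone condition drawn from the Lipschitz boundary: half
discs at edge points, Gauss-Green with removable corners, density of smooth functions by mollifiers
shifted along the cone, and a trace inequality from a transversal field. -/

noncomputable section

namespace KirchhoffPlate

/-! ### Convergence in `L²` -/

section TendstoL2

variable {α : Type*} [MeasurableSpace α] {μ : Measure α}

/-- Convergence in `L²(μ)` of a sequence of square integrable functions. -/
structure TendstoL2 (μ : Measure α) (a : ℕ → α → ℝ) (b : α → ℝ) : Prop where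
  memLp : ∀ m, MemLp (a m) 2 μ
  memLp_lim : MemLp b 2 μ
  tendsto : Tendsto (fun m => eLpNorm (a m - b) 2 μ) atTop (𝓝 0)

theorem tendstoL2_const {b : α → ℝ} (hb : MemLp b 2 μ) : TendstoL2 μ (fun _ => b) b :=
  ⟨fun _ => hb, hb, by simp⟩

theorem TendstoL2.add {a a' : ℕ → α → ℝ} {b b' : α → ℝ} (h : TendstoL2 μ a b)
    (h' : TendstoL2 μ a' b') :
    TendstoL2 μ (fun m x => a m x + a' m x) (fun x => b x + b' x) := by
  refine ⟨fun m => (h.memLp m).add (h'.memLp m), h.memLp_lim.add h'.memLp_lim, ?_⟩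
  have h0 : Tendsto (fun m => eLpNorm (a m - b) 2 μ + eLpNorm (a' m - b') 2 μ) atTop (𝓝 0) := by
    simpa using h.tendsto.add h'.tendsto
  refine tendsto_of_tendsto_of_tendsto_of_le_of_le tendsto_const_nhds h0 (fun _ => zero_le)
    fun m => ?_
  have : (fun x => a m x + a' m x) - (fun x => b x + b' x) = (a m - b) + (a' m - b') := by
    ext x; simp only [Pi.sub_apply, Pi.add_apply]; ring
  simp only [this]
  exact eLpNorm_add_le ((h.memLp m).sub h.memLp_lim).1 ((h'.memLp m).sub h'.memLp_lim).1 (by norm_num)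

theorem TendstoL2.congr {a : ℕ → α → ℝ} {b b' : α → ℝ} (h : TendstoL2 μ a b) (hb : b =ᵐ[μ] b') :
    TendstoL2 μ a b' := by
  refine ⟨h.memLp, (memLp_congr_ae hb).1 h.memLp_lim, ?_⟩
  refine h.tendsto.congr fun m => eLpNorm_congr_ae ?_
  filter_upwards [hb] with x hx
  simp [hx]

theorem TendstoL2.congr_left {a a' : ℕ → α → ℝ} {b : α → ℝ} (h : TendstoL2 μ a b)
    (ha : ∀ m, a m =ᵐ[μ] a' m) : TendstoL2 μ a' b := by
  refine ⟨fun m => (memLp_congr_ae (ha m)).1 (h.memLp m), h.memLp_lim, ?_⟩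
  refine h.tendsto.congr fun m => eLpNorm_congr_ae ?_
  filter_upwards [ha m] with x hx
  simp [hx]

theorem TendstoL2.comp {a : ℕ → α → ℝ} {b : α → ℝ} (h : TendstoL2 μ a b) {s : ℕ → ℕ}
    (hs : StrictMono s) : TendstoL2 μ (fun m => a (s m)) b :=
  ⟨fun m => h.memLp (s m), h.memLp_lim, h.tendsto.comp hs.tendsto_atTop⟩

theorem _root_.MeasureTheory.MemLp.integrable_fun_mul {f g : α → ℝ} (hf : MemLp f 2 μ)
    (hg : MemLp g 2 μ) : Integrable (fun x => f x * g x) μ :=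
  hf.integrable_mul hg

/-- A bounded multiplier. -/
theorem _root_.MeasureTheory.MemLp.bdd_mul_of_le {c f : α → ℝ} (hf : MemLp f 2 μ)
    (hc : AEStronglyMeasurable c μ) {C : ℝ} (hC : ∀ᵐ x ∂μ, |c x| ≤ C) :
    MemLp (fun x => c x * f x) 2 μ := by
  refine MemLp.of_le_mul (c := C) hf (hc.mul hf.1) ?_
  filter_upwards [hC] with x hx
  rw [norm_mul]
  exact mul_le_mul_of_nonneg_right hx (norm_nonneg _)

theorem eLpNorm_mul_le_of_bound {c f : α → ℝ} {C : ℝ} (hC : ∀ᵐ x ∂μ, |c x| ≤ C) :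
    eLpNorm (fun x => c x * f x) 2 μ ≤ ENNReal.ofReal C * eLpNorm f 2 μ := by
  refine eLpNorm_le_mul_eLpNorm_of_ae_le_mul ?_ 2
  filter_upwards [hC] with x hx
  rw [norm_mul]
  exact mul_le_mul_of_nonneg_right hx (norm_nonneg _)

theorem tendsto_ofReal_mul_zero {C : ℝ} {u : ℕ → ℝ≥0∞} (h : Tendsto u atTop (𝓝 0)) :
    Tendsto (fun m => ENNReal.ofReal C * u m) atTop (𝓝 0) := by
  simpa using ENNReal.Tendsto.const_mul h (Or.inr ENNReal.ofReal_ne_top)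

theorem TendstoL2.bdd_mul_seq {a : ℕ → α → ℝ} {b : α → ℝ} (h : TendstoL2 μ a b)
    {c : ℕ → α → ℝ} {C : ℝ} (hC : ∀ m, ∀ᵐ x ∂μ, |c m x| ≤ C) :
    Tendsto (fun m => eLpNorm (fun x => c m x * (a m x - b x)) 2 μ) atTop (𝓝 0) :=
  tendsto_of_tendsto_of_tendsto_of_le_of_le tendsto_const_nhds
    (tendsto_ofReal_mul_zero (C := C) h.tendsto) (fun _ => zero_le)
    fun m => eLpNorm_mul_le_of_bound (f := a m - b) (hC m)

theorem TendstoL2.bdd_mul {a : ℕ → α → ℝ} {b : α → ℝ} (h : TendstoL2 μ a b) {c : α → ℝ} {C : ℝ}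
    (hc : AEStronglyMeasurable c μ) (hC : ∀ᵐ x ∂μ, |c x| ≤ C) :
    TendstoL2 μ (fun m x => c x * a m x) (fun x => c x * b x) := by
  refine ⟨fun m => (h.memLp m).bdd_mul_of_le hc hC, h.memLp_lim.bdd_mul_of_le hc hC, ?_⟩
  refine (h.bdd_mul_seq fun _ => hC).congr fun m => ?_
  congr 1; ext x; simp only [Pi.sub_apply]; ring

theorem TendstoL2.integral_mul {a : ℕ → α → ℝ} {b c : α → ℝ} (h : TendstoL2 μ a b)
    (hc : MemLp c 2 μ) : Tendsto (fun m => ∫ x, a m x * c x ∂μ) atTop (𝓝 (∫ x, b x * c x ∂μ)) := by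
  have key : ∀ m, ‖∫ x, a m x * c x ∂μ - ∫ x, b x * c x ∂μ‖ₑ ≤
      eLpNorm (a m - b) 2 μ * eLpNorm c 2 μ := fun m => by
    rw [← integral_sub ((h.memLp m).integrable_fun_mul hc) (h.memLp_lim.integrable_fun_mul hc)]
    refine (enorm_integral_le_lintegral_enorm _).trans ?_
    have := eLpNorm_smul_le_mul_eLpNorm (p := 2) (q := 2) (r := 1) hc.1
      ((h.memLp m).sub h.memLp_lim).1
    rw [eLpNorm_one_eq_lintegral_enorm] at this
    refine le_trans (le_of_eq ?_) this
    refine lintegral_congr fun x => ?_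
    simp [sub_mul]
  rw [tendsto_iff_edist_tendsto_0]
  have h0 : Tendsto (fun m => eLpNorm (a m - b) 2 μ * eLpNorm c 2 μ) atTop (𝓝 0) := by
    simpa using ENNReal.Tendsto.mul_const h.tendsto (Or.inr hc.2.ne)
  refine tendsto_of_tendsto_of_tendsto_of_le_of_le tendsto_const_nhds h0 (fun _ => zero_le)
    fun m => ?_
  rw [edist_eq_enorm_sub]
  exact key m

theorem TendstoL2.mul_integral {a : ℕ → α → ℝ} {b c : α → ℝ} (h : TendstoL2 μ a b)
    (hc : MemLp c 2 μ) : Tendsto (fun m => ∫ x, c x * a m x ∂μ) atTop (𝓝 (∫ x, c x * b x ∂μ)) := by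
  simpa only [mul_comm] using h.integral_mul hc

theorem TendstoL2.exists_seq_tendsto_ae {a : ℕ → α → ℝ} {b : α → ℝ} (h : TendstoL2 μ a b) :
    ∃ s : ℕ → ℕ, StrictMono s ∧ ∀ᵐ x ∂μ, Tendsto (fun m => a (s m) x) atTop (𝓝 (b x)) :=
  (tendstoInMeasure_of_tendsto_eLpNorm (by norm_num) (fun m => (h.memLp m).1) h.memLp_lim.1
    h.tendsto).exists_seq_tendsto_ae

/-- Bounded pointwise convergent multipliers of a fixed square integrable function. -/
theorem tendstoL2_bdd_mul_of_tendsto_ae {c : ℕ → α → ℝ} {d f : α → ℝ} {C : ℝ} (hf : MemLp f 2 μ)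
    (hc : ∀ m, AEStronglyMeasurable (c m) μ) (hC : ∀ m, ∀ᵐ x ∂μ, |c m x| ≤ C)
    (hd : ∀ᵐ x ∂μ, Tendsto (fun m => c m x) atTop (𝓝 (d x))) :
    TendstoL2 μ (fun m x => c m x * f x) (fun x => d x * f x) := by
  have hdm : AEStronglyMeasurable d μ := aestronglyMeasurable_of_tendsto_ae atTop hc hd
  have hdC : ∀ᵐ x ∂μ, |d x| ≤ C := by
    filter_upwards [hd, ae_all_iff.2 hC] with x hx hxC
    exact le_of_tendsto hx.abs (.of_forall hxC)
  refine ⟨fun m => hf.bdd_mul_of_le (hc m) (hC m), hf.bdd_mul_of_le hdm hdC, ?_⟩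
  have hfin : ∫⁻ x, ‖f x‖ₑ ^ (2 : ℝ) ∂μ < ⊤ := by
    have := lintegral_rpow_enorm_lt_top_of_eLpNorm_lt_top (p := 2) (by norm_num) (by norm_num) hf.2
    simpa using this
  have h1 : Tendsto (fun m => ∫⁻ x, ‖c m x * f x - d x * f x‖ₑ ^ (2 : ℝ) ∂μ) atTop
      (𝓝 (∫⁻ _, 0 ∂μ)) := by
    refine tendsto_lintegral_of_dominated_convergence'
      (fun x => ENNReal.ofReal (2 * C) ^ (2 : ℝ) * ‖f x‖ₑ ^ (2 : ℝ)) (fun m => ?_) (fun m => ?_) ?_ ?_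
    · exact ((((hc m).mul hf.1).sub (hdm.mul hf.1)).enorm).pow_const _
    · filter_upwards [hC m, hdC] with x hx hx'
      rw [← ENNReal.mul_rpow_of_nonneg _ _ (by norm_num)]
      refine ENNReal.rpow_le_rpow ?_ (by norm_num)
      rw [← sub_mul, enorm_mul]
      gcongr
      rw [Real.enorm_eq_ofReal_abs]
      refine ENNReal.ofReal_le_ofReal ((abs_sub _ _).trans (by linarith))
    · have h2C : ENNReal.ofReal (2 * C) ^ (2 : ℝ) ≠ ⊤ :=
        ENNReal.rpow_ne_top_of_nonneg (by norm_num) ENNReal.ofReal_ne_top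
      rw [lintegral_const_mul' _ _ h2C]
      exact ENNReal.mul_ne_top h2C hfin.ne
    · filter_upwards [hd] with x hx
      have : Tendsto (fun m => c m x * f x - d x * f x) atTop (𝓝 0) := by
        simpa using (hx.mul_const (f x)).sub_const (d x * f x)
      have h2 := ((continuous_enorm.tendsto _).comp this)
      simp only [enorm_zero] at h2
      simpa [Function.comp_def] using ((ENNReal.continuous_rpow_const (y := 2)).tendsto 0).comp h2
  simp only [lintegral_zero] at h1
  have h3 := ((ENNReal.continuous_rpow_const (y := 1 / 2)).tendsto 0).comp h1
  simp only [one_div, ENNReal.zero_rpow_of_pos (show (0 : ℝ) < 2⁻¹ by norm_num)] at h3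
  refine h3.congr fun m => ?_
  rw [eLpNorm_eq_lintegral_rpow_enorm_toReal (by norm_num) (by norm_num)]
  simp

end TendstoL2
/-! ### Smooth functions on the plane -/

/-- The coordinate vectors. -/
abbrev basisVec (i : Fin 2) : Plane := EuclideanSpace.single i 1

theorem contDiff_fderiv_apply {f : Plane → ℝ} (hf : ContDiff ℝ ∞ f) (v : Plane) :
    ContDiff ℝ ∞ (fun x => fderiv ℝ f x v) :=
  (hf.fderiv_right (m := ∞) (by simp)).clm_apply contDiff_const

theorem contDiff_classicalPartial {f : Plane → ℝ} (hf : ContDiff ℝ ∞ f) (i : Fin 2) :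
    ContDiff ℝ ∞ (classicalPartial i f) :=
  contDiff_fderiv_apply hf _

theorem differentiable_of_smooth {f : Plane → ℝ} (hf : ContDiff ℝ ∞ f) : Differentiable ℝ f :=
  hf.differentiable (by simp)

theorem classicalPartial_mul {f g : Plane → ℝ} (hf : ContDiff ℝ ∞ f) (hg : ContDiff ℝ ∞ g)
    (i : Fin 2) (x : Plane) : classicalPartial i (fun y => f y * g y) x =
      f x * classicalPartial i g x + classicalPartial i f x * g x := by
  unfold classicalPartial
  rw [fderiv_fun_mul (differentiable_of_smooth hf x) (differentiable_of_smooth hg x)]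
  simp [mul_comm]

theorem classicalPartial_add {f g : Plane → ℝ} (hf : ContDiff ℝ ∞ f) (hg : ContDiff ℝ ∞ g)
    (i : Fin 2) (x : Plane) : classicalPartial i (fun y => f y + g y) x =
      classicalPartial i f x + classicalPartial i g x := by
  unfold classicalPartial
  rw [fderiv_fun_add (differentiable_of_smooth hf x) (differentiable_of_smooth hg x)]
  simp

theorem plane_eq_sum (v : Plane) : v = v 0 • basisVec 0 + v 1 • basisVec 1 := by
  ext i; fin_cases i <;> simp

theorem fderiv_apply_eq (f : Plane → ℝ) (x v : Plane) :
    fderiv ℝ f x v = v 0 * classicalPartial 0 f x + v 1 * classicalPartial 1 f x := by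
  conv_lhs => rw [plane_eq_sum v]
  simp [classicalPartial]

theorem classicalPartial_comm {f : Plane → ℝ} (hf : ContDiff ℝ ∞ f) (i j : Fin 2) (x : Plane) :
    classicalPartial i (classicalPartial j f) x = classicalPartial j (classicalPartial i f) x := by
  have hd : DifferentiableAt ℝ (fderiv ℝ f) x :=
    (hf.fderiv_right (m := ∞) (by simp)).differentiable (by simp) x
  have h : ∀ k l, classicalPartial k (classicalPartial l f) x =
      fderiv ℝ (fderiv ℝ f) x (basisVec k) (basisVec l) := fun k l => by
    unfold classicalPartial
    rw [fderiv_clm_apply hd (differentiableAt_const _)]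
    simp
  rw [h, h]
  have h2 : ContDiff ℝ 2 f := contDiff_infty.1 hf 2
  exact ((h2.contDiffAt (x := x)).isSymmSndFDerivAt (by simp)).eq _ _

theorem tsupport_fderiv_apply_subset (f : Plane → ℝ) (v : Plane) :
    tsupport (fun x => fderiv ℝ f x v) ⊆ tsupport f :=
  _root_.tsupport_fderiv_apply_subset ℝ v

/-- Induction on smooth functions with compact support by localization. -/
theorem smooth_localization {Q : (Plane → ℝ) → Prop} {U : Set Plane} (zero : Q fun _ => 0)
    (add : ∀ f g, ContDiff ℝ ∞ f → ContDiff ℝ ∞ g → HasCompactSupport f → HasCompactSupport g →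
      Q f → Q g → Q fun x => f x + g x)
    (loc : ∀ x ∈ U, ∃ V ∈ 𝓝 x, ∀ f, ContDiff ℝ ∞ f → HasCompactSupport f → tsupport f ⊆ V → Q f)
    (f : Plane → ℝ) (hf : ContDiff ℝ ∞ f) (hc : HasCompactSupport f) (hU : tsupport f ⊆ U) :
    Q f := by
  classical
  have hloc : ∀ x : tsupport f, ∃ V : Set Plane, IsOpen V ∧ x.1 ∈ V ∧
      ∀ f, ContDiff ℝ ∞ f → HasCompactSupport f → tsupport f ⊆ V → Q f := fun x => by
    obtain ⟨V, hV, h⟩ := loc x (hU x.2)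
    exact ⟨interior V, isOpen_interior, mem_interior_iff_mem_nhds.2 hV,
      fun g h1 h2 h3 => h g h1 h2 (h3.trans interior_subset)⟩
  choose V hVo hxV hV using hloc
  obtain ⟨ρ, hρ⟩ := SmoothPartitionOfUnity.exists_isSubordinate (I := modelWithCornersSelf ℝ Plane)
    (isClosed_tsupport f) V hVo
    (fun x hx => mem_iUnion.2 ⟨⟨x, hx⟩, hxV ⟨x, hx⟩⟩)
  have hfin := ρ.locallyFinite.finite_nonempty_inter_compact hc
  have hsm : ∀ i, ContDiff ℝ ∞ (fun x => ρ i x * f x) := fun i =>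
    ((ρ i).contMDiff.contDiff).mul hf
  have hcs : ∀ i, HasCompactSupport (fun x => ρ i x * f x) := fun i => hc.mul_left
  have hsum : f = fun x => ∑ i ∈ hfin.toFinset, ρ i x * f x := by
    ext x
    by_cases hx : x ∈ tsupport f
    · rw [← Finset.sum_mul]
      have h1 := ρ.sum_eq_one hx
      rw [finsum_eq_sum_of_support_subset (s := hfin.toFinset)] at h1
      · rw [h1, one_mul]
      · intro i hi
        simp only [Finite.coe_toFinset, mem_ofPred_eq]
        exact ⟨x, hi, hx⟩
    · simp [image_eq_zero_of_notMem_tsupport hx]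
  rw [hsum]
  generalize hfin.toFinset = s
  -- The smoothness and the compact support of the partial sums are carried through the induction
  -- because `add` asks for them.
  suffices h : ContDiff ℝ ∞ (fun x => ∑ i ∈ s, ρ i x * f x) ∧
      HasCompactSupport (fun x => ∑ i ∈ s, ρ i x * f x) ∧ Q (fun x => ∑ i ∈ s, ρ i x * f x) from
    h.2.2
  induction s using Finset.induction_on with
  | empty => simpa using ⟨contDiff_const, HasCompactSupport.zero, zero⟩
  | insert i s hi ih =>
    simp only [Finset.sum_insert hi]
    refine ⟨(hsm i).add ih.1, (hcs i).add ih.2.1, add _ _ (hsm i) ih.1 (hcs i) ih.2.1 ?_ ih.2.2⟩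
    refine hV i _ (hsm i) (hcs i) ((tsupport_mul_subset_left (f := ρ i)).trans (hρ i))

/-! ### Integration of smooth functions against finite measures of bounded support -/

/-- The measure is finite and carried by a compact set. -/
structure CompactlyCarried (μ : Measure Plane) : Prop where
  finite : IsFiniteMeasure μ
  carrier : ∃ K, IsCompact K ∧ ∀ᵐ x ∂μ, x ∈ K

theorem CompactlyCarried.exists_bound {μ : Measure Plane} (h : CompactlyCarried μ)
    {f : Plane → ℝ} (hf : Continuous f) : ∃ C, 0 ≤ C ∧ ∀ᵐ x ∂μ, |f x| ≤ C := by
  obtain ⟨K, hK, hμ⟩ := h.carrier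
  obtain ⟨C, hC⟩ := hK.exists_bound_of_continuousOn hf.continuousOn
  refine ⟨|C|, abs_nonneg _, ?_⟩
  filter_upwards [hμ] with x hx
  exact (hC x hx).trans (le_abs_self C)

theorem CompactlyCarried.memLp {μ : Measure Plane} (h : CompactlyCarried μ)
    {f : Plane → ℝ} (hf : Continuous f) {p : ℝ≥0∞} : MemLp f p μ := by
  have := h.finite
  obtain ⟨C, -, hC⟩ := h.exists_bound hf
  exact MemLp.of_bound hf.aestronglyMeasurable C hC

theorem CompactlyCarried.integrable {μ : Measure Plane} (h : CompactlyCarried μ)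
    {f : Plane → ℝ} (hf : Continuous f) : Integrable f μ :=
  memLp_one_iff_integrable.1 (h.memLp hf)

theorem compactlyCarried_restrict {Ω : Set Plane} (hb : Bornology.IsBounded Ω)
    (hm : MeasurableSet Ω) : CompactlyCarried (volume.restrict Ω) := by
  refine ⟨⟨?_⟩, closure Ω, hb.isCompact_closure, ?_⟩
  · rw [Measure.restrict_apply_univ]; exact hb.measure_lt_top
  · filter_upwards [ae_restrict_mem hm] with x hx using subset_closure hx

theorem TendstoL2.smooth_mul {μ : Measure Plane} (hμ : CompactlyCarried μ) {a : ℕ → Plane → ℝ}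
    {b c : Plane → ℝ} (h : TendstoL2 μ a b) (hc : Continuous c) :
    TendstoL2 μ (fun m x => c x * a m x) (fun x => c x * b x) := by
  obtain ⟨C, -, hC⟩ := hμ.exists_bound hc
  exact h.bdd_mul hc.aestronglyMeasurable hC

/-! ### Weak partial derivatives -/

theorem integral_mul_classicalPartial {f χ : Plane → ℝ} (hf : ContDiff ℝ ∞ f)
    (hχ : ContDiff ℝ ∞ χ) (hc : HasCompactSupport χ) (i : Fin 2) :
    ∫ x, f x * classicalPartial i χ x = -∫ x, classicalPartial i f x * χ x := by
  have hc' : HasCompactSupport (classicalPartial i χ) :=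
    hc.mono' ((subset_tsupport _).trans (tsupport_fderiv_apply_subset χ _))
  refine integral_mul_fderiv_eq_neg_fderiv_mul_of_integrable ?_ ?_ ?_
    (fun x _ => differentiable_of_smooth hf x) (fun x _ => differentiable_of_smooth hχ x)
  · exact ((contDiff_classicalPartial hf i).continuous.mul hχ.continuous).integrable_of_hasCompactSupport
      hc.mul_left
  · exact (hf.continuous.mul (contDiff_classicalPartial hχ i).continuous).integrable_of_hasCompactSupport
      hc'.mul_left
  · exact (hf.continuous.mul hχ.continuous).integrable_of_hasCompactSupport hc.mul_left

theorem setIntegral_eq_integral_of_tsupport {Ω : Set Plane} {f : Plane → ℝ}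
    (h : ∀ x, x ∉ Ω → f x = 0) : ∫ x in Ω, f x = ∫ x, f x :=
  setIntegral_eq_integral_of_forall_compl_eq_zero h

theorem isWeakPartial_of_smooth {Ω : Set Plane} (hb : Bornology.IsBounded Ω)
    (hm : MeasurableSet Ω) {f : Plane → ℝ} (hf : ContDiff ℝ ∞ f) (i : Fin 2) :
    IsWeakPartial Ω i f (classicalPartial i f) := by
  refine ⟨(compactlyCarried_restrict hb hm).memLp (contDiff_classicalPartial hf i).continuous,
    fun χ hχ hc hs => ?_⟩
  rw [setIntegral_eq_integral_of_tsupport, setIntegral_eq_integral_of_tsupport]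
  · exact integral_mul_classicalPartial hf hχ hc i
  · intro x hx
    rw [image_eq_zero_of_notMem_tsupport fun h => hx (hs h), mul_zero]
  · intro x hx
    have : x ∉ tsupport (classicalPartial i χ) :=
      fun h => hx (hs (tsupport_fderiv_apply_subset χ _ h))
    rw [image_eq_zero_of_notMem_tsupport this, mul_zero]

theorem IsWeakPartial.unique {Ω : Set Plane} (ho : IsOpen Ω) (hb : Bornology.IsBounded Ω)
    {i : Fin 2} {u g g' : Plane → ℝ} (h : IsWeakPartial Ω i u g) (h' : IsWeakPartial Ω i u g') :
    g =ᵐ[volume.restrict Ω] g' := by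
  have hμ := compactlyCarried_restrict hb ho.measurableSet
  have := hμ.finite
  have hi : ∀ {f : Plane → ℝ}, MemLp f 2 (volume.restrict Ω) → Integrable f (volume.restrict Ω) :=
    fun hf => hf.integrable (by norm_num)
  have key := ho.ae_eq_zero_of_integral_contDiff_smul_eq_zero (μ := volume)
    (f := fun x => g x - g' x)
    (IntegrableOn.locallyIntegrableOn (s := Ω) ((hi h.1).sub (hi h'.1))) ?_
  · filter_upwards [ae_restrict_of_ae key, ae_restrict_mem ho.measurableSet] with x hx hx'
    exact sub_eq_zero.1 (hx hx')
  · intro χ hχ hc hs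
    have hχ2 : MemLp χ 2 (volume.restrict Ω) := hμ.memLp hχ.continuous
    rw [← setIntegral_eq_integral_of_tsupport (Ω := Ω)]
    · have e : ∀ x, χ x • (g x - g' x) = g x * χ x - g' x * χ x := fun x => by
        simp only [smul_eq_mul]; ring
      simp only [e]
      rw [integral_sub (h.1.integrable_fun_mul hχ2) (h'.1.integrable_fun_mul hχ2)]
      have h1 := h.2 χ hχ hc hs
      have h2 := h'.2 χ hχ hc hs
      linarith
    · intro x hx
      rw [image_eq_zero_of_notMem_tsupport fun h => hx (hs h), zero_smul]

theorem MemH1.isWeakPartial {Ω : Set Plane} {u : Plane → ℝ} (h : MemH1 Ω u) (i : Fin 2) :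
    IsWeakPartial Ω i u (weakPartial Ω i u) := by
  have := h.2 i
  rw [weakPartial, dif_pos this]
  exact this.choose_spec

theorem IsWeakPartial.weakPartial_ae_eq {Ω : Set Plane} (ho : IsOpen Ω)
    (hb : Bornology.IsBounded Ω) {i : Fin 2} {u g : Plane → ℝ} (h : IsWeakPartial Ω i u g) :
    weakPartial Ω i u =ᵐ[volume.restrict Ω] g := by
  have hex : ∃ g, IsWeakPartial Ω i u g := ⟨g, h⟩
  rw [weakPartial, dif_pos hex]
  exact hex.choose_spec.unique ho hb h

theorem memH1_of_smooth {Ω : Set Plane} (hb : Bornology.IsBounded Ω)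
    (hm : MeasurableSet Ω) {f : Plane → ℝ} (hf : ContDiff ℝ ∞ f) : MemH1 Ω f :=
  ⟨(compactlyCarried_restrict hb hm).memLp hf.continuous,
    fun i => ⟨_, isWeakPartial_of_smooth hb hm hf i⟩⟩

theorem IsWeakPartial.congr {Ω : Set Plane} {i : Fin 2} {u u' g : Plane → ℝ}
    (h : IsWeakPartial Ω i u g) (hu : u =ᵐ[volume.restrict Ω] u') : IsWeakPartial Ω i u' g := by
  refine ⟨h.1, fun χ hχ hc hs => ?_⟩
  rw [← h.2 χ hχ hc hs]
  refine integral_congr_ae ?_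
  filter_upwards [hu] with x hx
  rw [hx]

theorem MemH1.congr {Ω : Set Plane} {u u' : Plane → ℝ}
    (h : MemH1 Ω u) (hu : u =ᵐ[volume.restrict Ω] u') : MemH1 Ω u' :=
  ⟨(memLp_congr_ae hu).1 h.1, fun i => (h.2 i).imp fun _ hg => hg.congr hu⟩

/-! ### Mollification -/

/-- A nonnegative smooth kernel of mass one with compact support. -/
structure IsMollifier (k : Plane → ℝ) : Prop where
  smooth : ContDiff ℝ ∞ k
  compact : HasCompactSupport k
  nonneg : ∀ x, 0 ≤ k x
  integral : ∫ x, k x = 1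

/-- The convolution `k * F`. -/
def mollify (k F : Plane → ℝ) : Plane → ℝ :=
  convolution k F (ContinuousLinearMap.mul ℝ ℝ) volume

theorem mollify_apply (k F : Plane → ℝ) (x : Plane) : mollify k F x = ∫ z, k z * F (x - z) := rfl

theorem mollify_apply' (k F : Plane → ℝ) (x : Plane) : mollify k F x = ∫ z, k (x - z) * F z := by
  rw [mollify_apply, ← integral_sub_left_eq_self _ volume x]
  simp

theorem IsMollifier.continuous_mollify {k F : Plane → ℝ} (hk : IsMollifier k)
    (hF : LocallyIntegrable F volume) : Continuous (mollify k F) :=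
  hk.compact.continuous_convolution_left _ hk.smooth.continuous hF

theorem IsMollifier.contDiff_mollify {k F : Plane → ℝ} (hk : IsMollifier k)
    (hF : LocallyIntegrable F volume) : ContDiff ℝ ∞ (mollify k F) :=
  hk.compact.contDiff_convolution_left _ hk.smooth hF

theorem IsMollifier.classicalPartial_mollify {k F : Plane → ℝ} (hk : IsMollifier k)
    (hF : LocallyIntegrable F volume) (i : Fin 2) (x : Plane) :
    classicalPartial i (mollify k F) x = ∫ z, classicalPartial i k (x - z) * F z := by
  have h := hk.compact.hasFDerivAt_convolution_left (ContinuousLinearMap.mul ℝ ℝ)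
    (contDiff_infty.1 hk.smooth 1) hF x
  rw [classicalPartial, mollify, h.fderiv]
  have hexi : ConvolutionExistsAt (fderiv ℝ k) F x
      ((ContinuousLinearMap.mul ℝ ℝ).precompL Plane) volume :=
    (hk.compact.fderiv ℝ).convolutionExists_left _
      (hk.smooth.continuous_fderiv (by simp)) hF x
  rw [convolution_def, ContinuousLinearMap.integral_apply hexi]
  rw [← integral_sub_left_eq_self _ volume x]
  simp [ContinuousLinearMap.precompL_apply, classicalPartial]

/-- The kernel is the density of a probability measure, so Jensen's inequality bounds the square of
the average by the average of the squares. Tonelli and translation invariance do the rest. -/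
theorem IsMollifier.eLpNorm_mollify_le {k F : Plane → ℝ} (hk : IsMollifier k)
    (hF : MemLp F 2 volume) : eLpNorm (mollify k F) 2 volume ≤ eLpNorm F 2 volume := by
  set ν : Measure Plane := volume.withDensity fun x => ENNReal.ofReal (k x) with hν
  have hki : Integrable k := hk.smooth.continuous.integrable_of_hasCompactSupport hk.compact
  have hkm : Measurable fun x => ENNReal.ofReal (k x) :=
    hk.smooth.continuous.measurable.ennreal_ofReal
  have hprob : IsProbabilityMeasure ν := ⟨by
    rw [hν, withDensity_apply _ MeasurableSet.univ, setLIntegral_univ,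
      ← ofReal_integral_eq_lintegral_ofReal hki (.of_forall hk.nonneg), hk.integral]
    simp⟩
  have hν_ac : ν ≪ volume := withDensity_absolutelyContinuous _ _
  have hpt : ∀ x, ‖mollify k F x‖ₑ ^ (2 : ℝ) ≤ ∫⁻ z, ENNReal.ofReal (k z) * ‖F (x - z)‖ₑ ^ (2 : ℝ) := by
    intro x
    have hFx : AEStronglyMeasurable (fun z => F (x - z)) volume :=
      hF.1.comp_measurePreserving (Measure.measurePreserving_sub_left volume x)
    have h1 : ‖mollify k F x‖ₑ ≤ eLpNorm (fun z => F (x - z)) 1 ν := by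
      rw [eLpNorm_one_eq_lintegral_enorm, hν, lintegral_withDensity_eq_lintegral_mul₀
        hkm.aemeasurable hFx.enorm, mollify_apply]
      refine (enorm_integral_le_lintegral_enorm _).trans (le_of_eq ?_)
      refine lintegral_congr fun z => ?_
      rw [enorm_mul, Real.enorm_of_nonneg (hk.nonneg z)]; rfl
    have h2 := h1.trans (eLpNorm_le_eLpNorm_of_exponent_le (p := 1) (q := 2) (by norm_num)
      (hFx.mono_ac hν_ac))
    calc ‖mollify k F x‖ₑ ^ (2 : ℝ) ≤ (eLpNorm (fun z => F (x - z)) 2 ν) ^ (2 : ℝ) := by gcongr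
      _ = ∫⁻ z, ‖F (x - z)‖ₑ ^ (2 : ℝ) ∂ν := by
        rw [eLpNorm_eq_lintegral_rpow_enorm_toReal (by norm_num) (by norm_num), ← ENNReal.rpow_mul]
        simp
      _ = _ := by
        rw [hν, lintegral_withDensity_eq_lintegral_mul₀ hkm.aemeasurable (hFx.enorm.pow_const _)]
        rfl
  rw [eLpNorm_eq_lintegral_rpow_enorm_toReal (by norm_num) (by norm_num),
    eLpNorm_eq_lintegral_rpow_enorm_toReal (by norm_num) (by norm_num)]
  refine ENNReal.rpow_le_rpow ?_ (by norm_num)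
  simp only [ENNReal.toReal_ofNat]
  calc ∫⁻ x, ‖mollify k F x‖ₑ ^ (2 : ℝ)
      ≤ ∫⁻ x, ∫⁻ z, ENNReal.ofReal (k z) * ‖F (x - z)‖ₑ ^ (2 : ℝ) := lintegral_mono hpt
    _ = ∫⁻ z, ∫⁻ x, ENNReal.ofReal (k z) * ‖F (x - z)‖ₑ ^ (2 : ℝ) := by
      refine lintegral_lintegral_swap ?_
      refine (hkm.comp measurable_snd).aemeasurable.mul ?_
      have : AEStronglyMeasurable (fun p : Plane × Plane => F (p.1 - p.2))
          (volume.prod volume) :=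
        hF.1.comp_quasiMeasurePreserving (quasiMeasurePreserving_sub volume volume)
      exact this.enorm.pow_const _
    _ = ∫⁻ z, ENNReal.ofReal (k z) * ∫⁻ x, ‖F x‖ₑ ^ (2 : ℝ) := by
      refine lintegral_congr fun z => ?_
      rw [lintegral_const_mul' _ _ ENNReal.ofReal_ne_top]
      congr 1
      exact lintegral_sub_right_eq_self (fun x => ‖F x‖ₑ ^ (2 : ℝ)) z
    _ = ∫⁻ x, ‖F x‖ₑ ^ (2 : ℝ) := by
      rw [lintegral_mul_const _ hkm, ← ofReal_integral_eq_lintegral_ofReal hki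
        (.of_forall hk.nonneg), hk.integral]
      simp

/-- Approximation by a continuous function with compact support, which is uniformly continuous, plus
the contraction property of mollification. The kernels need not be centred at the origin, only their
supports must shrink to it; the shifted kernels used later depend on this. -/
theorem tendsto_mollify {F : Plane → ℝ} (hF : MemLp F 2 volume) {k : ℕ → Plane → ℝ}
    (hk : ∀ m, IsMollifier (k m)) {r : ℕ → ℝ} (hr : Tendsto r atTop (𝓝 0))
    (hs : ∀ m x, k m x ≠ 0 → ‖x‖ < r m) : TendstoL2 volume (fun m => mollify (k m) F) F := by
  have hloc : ∀ {f : Plane → ℝ}, MemLp f 2 volume → LocallyIntegrable f volume := fun hf =>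
    hf.locallyIntegrable (by norm_num)
  have hmem : ∀ {f : Plane → ℝ}, MemLp f 2 volume → ∀ m, MemLp (mollify (k m) f) 2 volume :=
    fun hf m => ⟨((hk m).continuous_mollify (hloc hf)).aestronglyMeasurable,
      ((hk m).eLpNorm_mollify_le hf).trans_lt hf.2⟩
  refine ⟨hmem hF, hF, ?_⟩
  rw [ENNReal.tendsto_nhds_zero]
  intro ε hε
  obtain ⟨δ, hδ, hδε⟩ : ∃ δ : ℝ, 0 < δ ∧ ENNReal.ofReal δ + ENNReal.ofReal δ + ENNReal.ofReal δ ≤ ε := by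
    rcases eq_or_ne ε ⊤ with rfl | hε'
    · exact ⟨1, one_pos, le_top⟩
    · refine ⟨ε.toReal / 3, by have := ENNReal.toReal_pos hε.ne' hε'; positivity, ?_⟩
      have h0 : 0 ≤ ε.toReal / 3 := by positivity
      rw [← ENNReal.ofReal_add h0 h0, ← ENNReal.ofReal_add (by positivity) h0]
      refine ENNReal.ofReal_le_of_le_toReal (by linarith)
  obtain ⟨f, hfc, hfs, hf⟩ := hF.exist_eLpNorm_sub_le (by norm_num) (by norm_num) hδ
  have hf2 : MemLp f 2 volume := hfs.continuous.memLp_of_hasCompactSupport hfc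
  -- K contains the supports of f and of its mollifications as soon as the kernels live in the unit
  -- ball. Since K has finite measure, a uniform bound on the difference gives an L² bound.
  set K := Metric.cthickening 1 (tsupport f) with hK
  have hKc : IsCompact K := IsCompact.cthickening hfc
  have hKfin : volume K ≠ ⊤ := hKc.measure_lt_top.ne
  obtain ⟨η, hη, hηK⟩ : ∃ η : ℝ, 0 < η ∧
      ENNReal.ofReal η * volume K ^ (1 / (2 : ℝ≥0∞).toReal) ≤ ENNReal.ofReal δ := by
    set c := (volume K ^ (1 / (2 : ℝ≥0∞).toReal)).toReal
    have hc : volume K ^ (1 / (2 : ℝ≥0∞).toReal) = ENNReal.ofReal c :=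
      (ENNReal.ofReal_toReal (ENNReal.rpow_ne_top_of_nonneg (by simp) hKfin)).symm
    have hc0 : 0 ≤ c := ENNReal.toReal_nonneg
    refine ⟨δ / (c + 1), by positivity, ?_⟩
    rw [hc, ← ENNReal.ofReal_mul (by positivity)]
    refine ENNReal.ofReal_le_ofReal ?_
    rw [div_mul_eq_mul_div, div_le_iff₀ (by positivity)]
    nlinarith
  obtain ⟨σ, hσ, hfσ⟩ := Metric.uniformContinuous_iff.1
    (hfc.uniformContinuous_of_continuous hfs.continuous) η hη
  filter_upwards [hr.eventually (gt_mem_nhds hσ), hr.eventually (gt_mem_nhds one_pos)] with m hm hm1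
  have hsplit : mollify (k m) F - F = mollify (k m) (F - f) + (mollify (k m) f - f) + (f - F) := by
    have : mollify (k m) (F - f) = mollify (k m) F - mollify (k m) f := by
      ext x
      simp only [Pi.sub_apply, mollify_apply', mul_sub]
      have hi : ∀ {g : Plane → ℝ}, MemLp g 2 volume → Integrable (fun z => k m (x - z) * g z) := by
        intro g hg
        refine MemLp.integrable_fun_mul ?_ hg
        refine Continuous.memLp_of_hasCompactSupport
          ((hk m).smooth.continuous.comp (continuous_sub_left x)) ?_
        exact (hk m).compact.comp_homeomorph (Homeomorph.subLeft x)
      exact integral_sub (hi hF) (hi hf2)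
    rw [this]; ring
  have h2 : eLpNorm (mollify (k m) f - f) 2 volume ≤ ENNReal.ofReal δ := by
    refine le_trans (eLpNorm_sub_le_of_dist_bdd volume (by norm_num) hKc.measurableSet hη.le
      (fun x => ?_) ?_ ?_) hηK
    · rw [mollify_apply, Real.dist_eq]
      have hki : Integrable (k m) :=
        (hk m).smooth.continuous.integrable_of_hasCompactSupport (hk m).compact
      have hi : Integrable fun z => k m z * f (x - z) :=
        ((hk m).smooth.continuous.mul (hfs.continuous.comp
          (continuous_sub_left x))).integrable_of_hasCompactSupport (hk m).compact.mul_right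
      have e : ∫ z, k m z * f (x - z) - k m z * f x = (∫ z, k m z * f (x - z)) - f x := by
        rw [integral_sub hi (hki.mul_const _), integral_mul_const, (hk m).integral, one_mul]
      rw [← e]
      have hb : ∀ z, ‖k m z * f (x - z) - k m z * f x‖ ≤ k m z * η := fun z => by
        rw [← mul_sub, norm_mul, Real.norm_of_nonneg ((hk m).nonneg z)]
        by_cases hz : k m z = 0
        · simp [hz]
        · refine mul_le_mul_of_nonneg_left ?_ ((hk m).nonneg z)
          have := hfσ (a := x - z) (b := x) (by
            rw [dist_eq_norm]; simpa using (hs m z hz).trans hm)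
          exact (Real.dist_eq _ _ ▸ this).le
      have := norm_integral_le_of_norm_le (hki.mul_const η) (.of_forall hb)
      rwa [integral_mul_const, (hk m).integral, one_mul] at this
    · intro x hx
      rw [Function.mem_support, mollify_apply] at hx
      by_contra hxK
      refine hx (integral_eq_zero_of_ae (.of_forall fun z => ?_))
      by_cases hz : k m z = 0
      · simp [hz]
      · have : x - z ∉ tsupport f := fun h => hxK <| by
          refine Metric.mem_cthickening_of_dist_le x (x - z) _ _ h ?_
          rw [dist_eq_norm]; simpa using ((hs m z hz).trans hm1).le
        simp [image_eq_zero_of_notMem_tsupport this]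
    · exact (subset_tsupport f).trans (Metric.self_subset_cthickening _)
  rw [hsplit]
  have m1 : AEStronglyMeasurable (mollify (k m) (F - f)) volume := (hmem (hF.sub hf2) m).1
  have m2 : AEStronglyMeasurable (mollify (k m) f - f) volume := ((hmem hf2 m).sub hf2).1
  refine (eLpNorm_add_le (m1.add m2) (hf2.sub hF).1 (by norm_num)).trans (le_trans ?_ hδε)
  refine add_le_add ((eLpNorm_add_le m1 m2 (by norm_num)).trans (add_le_add ?_ h2)) ?_
  · exact ((hk m).eLpNorm_mollify_le (hF.sub hf2)).trans hf
  · rw [eLpNorm_sub_comm]; exact hf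

/-- Mollifiers supported in a small ball around a given point. -/
theorem exists_isMollifier (c : Plane) {r : ℝ} (hr : 0 < r) :
    ∃ k, IsMollifier k ∧ tsupport k ⊆ Metric.closedBall c r := by
  let φ : ContDiffBump c := ⟨r / 2, r, by positivity, by linarith⟩
  exact ⟨φ.normed volume, ⟨φ.contDiff_normed, φ.hasCompactSupport_normed, φ.nonneg_normed,
    φ.integral_normed⟩, φ.tsupport_normed_eq.subset⟩

/-! ### Geometry of polygonal Lipschitz domains -/

theorem inner_plane (x y : Plane) : inner ℝ x y = x 0 * y 0 + x 1 * y 1 := by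
  simp [PiLp.inner_apply, mul_comm]

theorem norm_sq_plane (x : Plane) : ‖x‖ ^ 2 = x 0 ^ 2 + x 1 ^ 2 := by
  rw [← real_inner_self_eq_norm_sq, inner_plane]; ring

theorem norm_unitTangent {a b : Plane} (h : a ≠ b) : ‖unitTangent a b‖ = 1 := by
  rw [unitTangent, norm_smul, norm_inv, norm_norm,
    inv_mul_cancel₀ (norm_ne_zero_iff.2 (sub_ne_zero.2 h.symm))]

theorem norm_smul_unitTangent {a b : Plane} (h : a ≠ b) : ‖b - a‖ • unitTangent a b = b - a := by
  rw [unitTangent, smul_smul, mul_inv_cancel₀ (norm_ne_zero_iff.2 (sub_ne_zero.2 h.symm)), one_smul]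

namespace Plate

variable (P : Plate)

/-- The unit tangent on edge `k`. -/
def tangent (k : Fin P.K) : Plane := unitTangent (P.p k) (P.q k)

/-- The length of edge `k`. -/
def len (k : Fin P.K) : ℝ := ‖P.q k - P.p k‖

/-- The closed edge `k`. -/
def seg (k : Fin P.K) : Set Plane := segment ℝ (P.p k) (P.q k)

/-- The open edge `k`. -/
def edge (k : Fin P.K) : Set Plane := openSegment ℝ (P.p k) (P.q k)

theorem normal_zero (k : Fin P.K) : P.normal k 0 = P.tangent k 1 := rfl

theorem normal_one (k : Fin P.K) : P.normal k 1 = -P.tangent k 0 := rfl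

theorem len_pos (k : Fin P.K) : 0 < P.len k :=
  norm_pos_iff.2 (sub_ne_zero.2 (P.p_ne_q k).symm)

theorem len_smul_tangent (k : Fin P.K) : P.len k • P.tangent k = P.q k - P.p k :=
  norm_smul_unitTangent (P.p_ne_q k)

theorem tangent_sq (k : Fin P.K) : P.tangent k 0 ^ 2 + P.tangent k 1 ^ 2 = 1 := by
  rw [← norm_sq_plane, tangent, norm_unitTangent (P.p_ne_q k), one_pow]

theorem inner_normal_normal (k : Fin P.K) : inner ℝ (P.normal k) (P.normal k) = 1 := by
  rw [inner_plane, normal_zero, normal_one]; linarith [P.tangent_sq k]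

theorem inner_tangent_tangent (k : Fin P.K) : inner ℝ (P.tangent k) (P.tangent k) = 1 := by
  rw [inner_plane]; linarith [P.tangent_sq k]

theorem inner_tangent_normal (k : Fin P.K) : inner ℝ (P.tangent k) (P.normal k) = 0 := by
  rw [inner_plane, normal_zero, normal_one]; ring

theorem norm_normal (k : Fin P.K) : ‖P.normal k‖ = 1 := by
  have h := P.inner_normal_normal k
  rw [real_inner_self_eq_norm_sq] at h
  nlinarith [norm_nonneg (P.normal k)]

theorem mem_edge_iff {k : Fin P.K} {x : Plane} :
    x ∈ P.edge k ↔ ∃ s ∈ Ioo 0 (P.len k), x = P.p k + s • P.tangent k := by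
  have hl := P.len_pos k
  rw [edge, openSegment_eq_image', mem_image]
  constructor
  · rintro ⟨θ, ⟨h0, h1⟩, rfl⟩
    refine ⟨θ * P.len k, ⟨by positivity, by nlinarith⟩, ?_⟩
    rw [mul_smul, len_smul_tangent]
  · rintro ⟨s, ⟨h0, h1⟩, rfl⟩
    refine ⟨s / P.len k, ⟨by positivity, by rwa [div_lt_one hl]⟩, ?_⟩
    rw [← len_smul_tangent, smul_smul, div_mul_cancel₀ _ hl.ne']

theorem mem_seg_iff {k : Fin P.K} {x : Plane} :
    x ∈ P.seg k ↔ ∃ s ∈ Icc 0 (P.len k), x = P.p k + s • P.tangent k := by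
  have hl := P.len_pos k
  rw [seg, segment_eq_image', mem_image]
  constructor
  · rintro ⟨θ, ⟨h0, h1⟩, rfl⟩
    refine ⟨θ * P.len k, ⟨by positivity, by nlinarith⟩, ?_⟩
    rw [mul_smul, len_smul_tangent]
  · rintro ⟨s, ⟨h0, h1⟩, rfl⟩
    refine ⟨s / P.len k, ⟨by positivity, by rwa [div_le_one hl]⟩, ?_⟩
    rw [← len_smul_tangent, smul_smul, div_mul_cancel₀ _ hl.ne']

theorem p_mem_seg (k : Fin P.K) : P.p k ∈ P.seg k := left_mem_segment _ _ _

theorem q_mem_seg (k : Fin P.K) : P.q k ∈ P.seg k := right_mem_segment _ _ _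

theorem edge_subset_seg (k : Fin P.K) : P.edge k ⊆ P.seg k := openSegment_subset_segment _ _ _

theorem seg_eq (k : Fin P.K) {x : Plane} (hx : x ∈ P.seg k) :
    x = P.p k ∨ x = P.q k ∨ x ∈ P.edge k := by
  rw [seg, ← insert_endpoints_openSegment] at hx
  simpa [eq_comm, edge] using hx

theorem isCompact_seg (k : Fin P.K) : IsCompact (P.seg k) := by
  rw [seg, segment_eq_image']
  exact isCompact_Icc.image (by fun_prop)

theorem seg_subset_frontier (k : Fin P.K) : P.seg k ⊆ frontier P.Ω := by
  rw [P.frontier_eq]; exact subset_iUnion (fun k => segment ℝ (P.p k) (P.q k)) k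

theorem mem_frontier_iff {x : Plane} : x ∈ frontier P.Ω ↔ ∃ k, x ∈ P.seg k := by
  rw [P.frontier_eq, mem_iUnion]; rfl

theorem notMem_of_mem_seg {k : Fin P.K} {x : Plane} (hx : x ∈ P.seg k) : x ∉ P.Ω := by
  have := P.seg_subset_frontier k hx
  rw [P.isOpen.frontier_eq] at this
  exact this.2

theorem inner_normal_of_mem_seg {k : Fin P.K} {x y : Plane} (hx : x ∈ P.seg k) (hy : y ∈ P.seg k) :
    inner ℝ (y - x) (P.normal k) = 0 := by
  obtain ⟨s, -, rfl⟩ := P.mem_seg_iff.1 hx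
  obtain ⟨t, -, rfl⟩ := P.mem_seg_iff.1 hy
  rw [add_sub_add_left_eq_sub, ← sub_smul, real_inner_smul_left, inner_tangent_normal, mul_zero]

/-- An edge meets the other closed edges at most in its end points. -/
theorem notMem_seg_of_mem_edge {k l : Fin P.K} (h : k ≠ l) {x : Plane} (hx : x ∈ P.edge k) :
    x ∉ P.seg l := by
  intro hl
  rcases P.seg_eq l hl with rfl | rfl | h'
  · exact P.p_notMem_edge l k hx
  · exact P.q_notMem_edge l k hx
  · exact disjoint_left.1 (P.edges_disjoint k l h) hx h'

theorem exists_ball_disjoint_segs (x : Plane) :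
    ∃ ρ > 0, ∀ l, x ∉ P.seg l → ∀ y ∈ Metric.ball x ρ, y ∉ P.seg l := by
  have h : ∀ᶠ y in 𝓝 x, ∀ l, x ∉ P.seg l → y ∉ P.seg l := by
    rw [eventually_all]
    intro l
    by_cases hl : x ∈ P.seg l
    · exact .of_forall fun y h => absurd hl h
    · filter_upwards [(P.isCompact_seg l).isClosed.isOpen_compl.mem_nhds hl] with y hy _ using hy
  obtain ⟨ρ, hρ, h⟩ := Metric.eventually_nhds_iff_ball.1 h
  exact ⟨ρ, hρ, fun l hl y hy => h y hy l hl⟩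

/-- The cone property with direction `d`, opening `δ` and radius `ρ` at `x`. -/
structure IsCone (x d : Plane) (δ ρ : ℝ) : Prop where
  δ_pos : 0 < δ
  ρ_pos : 0 < ρ
  mem : ∀ y ∈ Metric.ball x ρ, ∀ w : Plane, ‖w‖ < δ → ∀ s : ℝ, 0 ≤ s →
    y - s • (d + w) ∈ Metric.ball x ρ → y ∈ P.Ω → y - s • (d + w) ∈ P.Ω

/-- At a boundary point, d is the direction that the local isometry turns into the vertical. Moving
down along d + w stays below an L-Lipschitz graph as long as |w₁| + L|w₀| ≤ 1, which ‖w‖ < 1/(1 + L)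
ensures. At other points a small disc lies inside Ω or outside its closure and nothing is needed of
d. -/
theorem exists_isCone (x : Plane) : ∃ d δ ρ, P.IsCone x d δ ρ := by
  by_cases hx : x ∈ P.Ω
  · obtain ⟨ρ, hρ, h⟩ := Metric.isOpen_iff.1 P.isOpen x hx
    exact ⟨0, 1, ρ, one_pos, hρ, fun y _ w _ s _ hs _ => h hs⟩
  by_cases hx' : x ∈ closure P.Ω
  · obtain ⟨e, L, g, ρ, hg, hρ, h⟩ := P.lipschitz x ⟨hx', by rwa [P.isOpen.interior_eq]⟩
    let A := e.toRealAffineIsometryEquiv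
    have hA : ∀ z, A z = e z := fun z => by simp [A]
    obtain ⟨d, hd⟩ := A.linearIsometryEquiv.surjective (basisVec 1)
    refine ⟨d, 1 / (1 + L), ρ, by positivity, hρ, fun y hy w hw s hs hy' hyΩ => ?_⟩
    rw [h _ hy']
    have h1 := (h y hy).1 hyΩ
    have he : e (y - s • (d + w)) = e y - s • (basisVec 1 + A.linearIsometryEquiv w) := by
      rw [← hA, ← hA, sub_eq_add_neg, add_comm y, ← vadd_eq_add, AffineIsometryEquiv.map_vadd]
      simp only [map_neg, map_smul, map_add, hd, vadd_eq_add]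
      rw [add_comm, sub_eq_add_neg]
    set w' := A.linearIsometryEquiv w with hw'
    have hwn : ‖w'‖ < 1 / (1 + L) := by rwa [hw', LinearIsometryEquiv.norm_map]
    have hw0 : |w' 0| ≤ ‖w'‖ := PiLp.norm_apply_le w' 0
    have hw1 : |w' 1| ≤ ‖w'‖ := PiLp.norm_apply_le w' 1
    rw [he]
    simp only [PiLp.sub_apply, PiLp.smul_apply, PiLp.add_apply, smul_eq_mul]
    simp only [basisVec, PiLp.single_apply]
    simp only [Fin.isValue, zero_ne_one, if_false, if_true, zero_add]
    have h2 := hg.dist_le_mul (e y 0) (e y 0 - s * w' 0)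
    rw [Real.dist_eq, Real.dist_eq] at h2
    have h3 : |e y 0 - (e y 0 - s * w' 0)| = s * |w' 0| := by
      rw [sub_sub_cancel, abs_mul, abs_of_nonneg hs]
    rw [h3] at h2
    have h4 := (abs_le.1 h2).2
    have h5 : ‖w'‖ * (1 + L) ≤ 1 := ((lt_div_iff₀ (by positivity)).1 hwn).le
    have h6 : -|w' 1| ≤ w' 1 := neg_abs_le _
    have hL : (0 : ℝ) ≤ L := L.2
    have h7 : |w' 1| + L * |w' 0| ≤ 1 := by
      nlinarith [mul_le_mul_of_nonneg_left hw0 hL]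
    nlinarith [mul_le_mul_of_nonneg_left h7 hs, mul_le_mul_of_nonneg_left h6 hs]
  · obtain ⟨ρ, hρ, h⟩ := Metric.isOpen_iff.1 isClosed_closure.isOpen_compl x hx'
    exact ⟨0, 1, ρ, one_pos, hρ, fun y hy w _ s _ _ hyΩ => absurd (subset_closure hyΩ) (h hy)⟩

variable {P}

theorem IsCone.notMem {x d : Plane} {δ ρ : ℝ} (h : P.IsCone x d δ ρ) {y : Plane}
    (hy : y ∈ Metric.ball x ρ) {w : Plane} (hw : ‖w‖ < δ) {s : ℝ} (hs : 0 ≤ s)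
    (hy' : y + s • (d + w) ∈ Metric.ball x ρ) (hyΩ : y ∉ P.Ω) : y + s • (d + w) ∉ P.Ω := by
  intro h'
  have := h.mem _ hy' w hw s hs
  rw [add_sub_cancel_right] at this
  exact hyΩ (this hy h')

theorem eventually_add_smul_mem_ball {x y : Plane} {ρ : ℝ} (hy : y ∈ Metric.ball x ρ) (v : Plane) :
    ∀ᶠ s in 𝓝[>] (0 : ℝ), y + s • v ∈ Metric.ball x ρ := by
  have : Tendsto (fun s : ℝ => y + s • v) (𝓝 0) (𝓝 y) := by
    have hc : Continuous fun s : ℝ => y + s • v := by fun_prop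
    simpa using hc.tendsto 0
  exact (this.eventually (Metric.isOpen_ball.mem_nhds hy)).filter_mono nhdsWithin_le_nhds

variable (P)

/-- Near an edge point, `Ω` is a half disc. -/
theorem exists_halfBall {k : Fin P.K} {x : Plane} (hx : x ∈ P.edge k) : ∃ ρ > 0,
    (∀ y ∈ Metric.ball x ρ, (y ∈ P.Ω ↔ inner ℝ (y - x) (P.normal k) < 0)) ∧
    (∀ l, l ≠ k → ∀ y ∈ Metric.ball x ρ, y ∉ P.seg l) ∧
    ∀ s : ℝ, x + s • P.tangent k ∈ Metric.ball x ρ → x + s • P.tangent k ∈ P.edge k := by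
  obtain ⟨ρ₁, hρ₁, h₁⟩ := P.exists_ball_disjoint_segs x
  obtain ⟨s₀, ⟨hs0, hs1⟩, hxs⟩ := P.mem_edge_iff.1 hx
  obtain ⟨d, δ, ρ₃, hcone⟩ := P.exists_isCone x
  set ρ := min (min ρ₁ (min s₀ (P.len k - s₀))) ρ₃ with hρdef
  have hρ : 0 < ρ := lt_min (lt_min hρ₁ (lt_min hs0 (by linarith))) hcone.ρ_pos
  have hρ1 : ρ ≤ ρ₁ := (min_le_left _ _).trans (min_le_left _ _)
  have hρ3 : ρ ≤ ρ₃ := min_le_right _ _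
  have hseg : ∀ l, l ≠ k → ∀ y ∈ Metric.ball x ρ, y ∉ P.seg l := fun l hl y hy =>
    h₁ l (P.notMem_seg_of_mem_edge hl.symm hx) y (Metric.ball_subset_ball hρ1 hy)
  have hline : ∀ s : ℝ, x + s • P.tangent k ∈ Metric.ball x ρ → x + s • P.tangent k ∈ P.edge k := by
    intro s hs
    have hs' : |s| < ρ := by
      rw [mem_ball_iff_norm, add_sub_cancel_left, norm_smul, tangent,
        norm_unitTangent (P.p_ne_q k), mul_one] at hs
      exact hs
    have h2 : ρ ≤ s₀ := (min_le_left _ _).trans ((min_le_right _ _).trans (min_le_left _ _))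
    have h3 : ρ ≤ P.len k - s₀ := (min_le_left _ _).trans ((min_le_right _ _).trans (min_le_right _ _))
    refine P.mem_edge_iff.2 ⟨s₀ + s, ⟨?_, ?_⟩, ?_⟩
    · linarith [(abs_lt.1 hs').1]
    · linarith [(abs_lt.1 hs').2]
    · rw [hxs, add_smul, add_assoc]
  have hxseg := P.edge_subset_seg k hx
  -- points of the boundary in the disc lie on the line
  have hfront : ∀ y ∈ Metric.ball x ρ, y ∈ frontier P.Ω → inner ℝ (y - x) (P.normal k) = 0 := by
    intro y hy hyf
    obtain ⟨l, hl⟩ := P.mem_frontier_iff.1 hyf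
    rcases eq_or_ne l k with rfl | hlk
    · exact P.inner_normal_of_mem_seg hxseg hl
    · exact absurd hl (hseg l hlk y hy)
  -- The sign of σ selects one of the two open half discs.
  have hconv : ∀ σ : ℝ, IsPreconnected
      (Metric.ball x ρ ∩ {y | 0 < σ * inner ℝ (y - x) (P.normal k)}) := by
    intro σ
    refine ((convex_ball x ρ).inter ?_).isPreconnected
    have e : {y : Plane | 0 < σ * inner ℝ (y - x) (P.normal k)} =
        {y : Plane | σ * inner ℝ x (P.normal k) < σ * inner ℝ y (P.normal k)} := by
      ext y
      simp only [mem_ofPred_eq, inner_sub_left, mul_sub, sub_pos]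
    rw [e]
    refine convex_halfSpace_gt ⟨fun a b => ?_, fun c a => ?_⟩ _
    · rw [inner_add_left, mul_add]
    · rw [real_inner_smul_left, smul_eq_mul]; ring
  -- A half disc that meets Ω lies in Ω: otherwise, being connected, it would contain a boundary
  -- point, but inside the disc all boundary points lie on the line through the edge.
  have hdich : ∀ σ : ℝ, ∀ z ∈ Metric.ball x ρ ∩ {y | 0 < σ * inner ℝ (y - x) (P.normal k)}, z ∈ P.Ω →
      Metric.ball x ρ ∩ {y | 0 < σ * inner ℝ (y - x) (P.normal k)} ⊆ P.Ω := by
    intro σ z hz hzΩ y hy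
    by_contra hyΩ
    obtain ⟨y', hy', hyf⟩ : ((Metric.ball x ρ ∩
        {y | 0 < σ * inner ℝ (y - x) (P.normal k)}) ∩ frontier P.Ω).Nonempty := by
      by_contra hemp
      rw [not_nonempty_iff_eq_empty] at hemp
      have hout : ∀ y ∈ Metric.ball x ρ ∩ {y | 0 < σ * inner ℝ (y - x) (P.normal k)},
          y ∉ P.Ω → y ∈ (closure P.Ω)ᶜ := fun y hy h1 h2 =>
        (hemp ▸ (⟨hy, h2, by rwa [P.isOpen.interior_eq]⟩ : y ∈ _ ∩ frontier P.Ω) : y ∈ (∅ : Set Plane))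
      obtain ⟨u, -, hu1, hu2⟩ := hconv σ P.Ω (closure P.Ω)ᶜ P.isOpen isClosed_closure.isOpen_compl
        (fun y hy => or_iff_not_imp_left.2 (hout y hy)) ⟨z, hz, hzΩ⟩ ⟨y, hy, hout y hy hyΩ⟩
      exact hu2 (subset_closure hu1)
    have := hfront y' hy'.1 hyf
    have h2 := hy'.2
    rw [mem_ofPred_eq, this, mul_zero] at h2
    exact lt_irrefl _ h2
  have hneg : ∀ y ∈ Metric.ball x ρ, inner ℝ (y - x) (P.normal k) < 0 → y ∈ P.Ω := by
    intro y hy hyn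
    obtain ⟨ε, hε, hout⟩ := P.outer k x hx
    have ev := (eventually_add_smul_mem_ball (Metric.mem_ball_self (x := x) hρ) (-P.normal k)).and
      (Ioo_mem_nhdsGT hε)
    obtain ⟨s, hs, hs'⟩ := ev.exists
    have hzΩ := hout s hs'
    refine hdich (-1) (x + s • -P.normal k) ⟨hs, ?_⟩ ?_ ⟨hy, ?_⟩
    · rw [mem_ofPred_eq, add_sub_cancel_left, real_inner_smul_left, inner_neg_left,
        inner_normal_normal]
      linarith [hs'.1]
    · rw [smul_neg, ← sub_eq_add_neg]; exact hzΩ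
    · rw [mem_ofPred_eq]; linarith
  -- This excludes a slit, with Ω on both sides of the edge. In that case, leaving x in any
  -- direction d + w of the cone would lead into Ω unless the direction is tangential, and an open
  -- set of directions cannot consist of tangential ones.
  have hpos : ∀ y ∈ Metric.ball x ρ, 0 < inner ℝ (y - x) (P.normal k) → y ∉ P.Ω := by
    intro z hz hzn hzΩ
    have hsub := hdich 1 z ⟨hz, by simpa using hzn⟩ hzΩ
    have key : ∀ w : Plane, ‖w‖ < δ → inner ℝ (d + w) (P.normal k) = 0 := by
      intro w hw
      obtain ⟨s, hs, hs0⟩ := ((eventually_add_smul_mem_ball (Metric.mem_ball_self (x := x) hρ) (d + w)).and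
        self_mem_nhdsWithin).exists
      have hs0 : 0 < s := hs0
      have h4 := hcone.notMem (Metric.mem_ball_self (x := x) hcone.ρ_pos) hw hs0.le
        (Metric.ball_subset_ball hρ3 hs) (P.notMem_of_mem_seg hxseg)
      by_contra hne
      rcases lt_or_gt_of_ne hne with hlt | hgt
      · refine h4 (hneg _ hs ?_)
        rw [add_sub_cancel_left, real_inner_smul_left]
        exact mul_neg_of_pos_of_neg hs0 hlt
      · refine h4 (hsub ⟨hs, ?_⟩)
        rw [mem_ofPred_eq, add_sub_cancel_left, real_inner_smul_left]
        positivity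
    have k1 := key 0 (by simpa using hcone.δ_pos)
    have k2 := key ((δ / 2) • P.normal k) (by
      rw [norm_smul, norm_normal, Real.norm_of_nonneg (by linarith [hcone.δ_pos])]
      linarith [hcone.δ_pos])
    rw [add_zero] at k1
    rw [inner_add_left, k1, real_inner_smul_left, inner_normal_normal] at k2
    linarith [hcone.δ_pos]
  refine ⟨ρ, hρ, fun y hy => ⟨fun hyΩ => ?_, hneg y hy⟩, hseg, hline⟩
  rcases lt_trichotomy (inner ℝ (y - x) (P.normal k)) 0 with h | h | h
  · exact h
  · exfalso
    have hy2 : y = x + (inner ℝ (y - x) (P.tangent k) : ℝ) • P.tangent k := by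
      have ht := P.tangent_sq k
      rw [inner_plane, normal_zero, normal_one, PiLp.sub_apply, PiLp.sub_apply] at h
      ext i
      rw [inner_plane]
      fin_cases i
      · simp; linear_combination P.tangent k 1 * h + (x 0 - y 0) * ht
      · simp; linear_combination -P.tangent k 0 * h + (x 1 - y 1) * ht
    have := hline _ (hy2 ▸ hy)
    rw [← hy2] at this
    exact P.notMem_of_mem_seg (P.edge_subset_seg k this) hyΩ
  · exact absurd hyΩ (hpos y hy h)

variable {P}

/-- From an edge point y close to x, a short move along d + w stays outside Ω, so the half disc at y
gives ⟨d + w, n⟩ ≥ 0. The choice w = -(δ/2) n makes the inequality for d strict. The direction d is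
thus transversal to all edges through x at once. -/
theorem IsCone.inner_normal_pos {x d : Plane} {δ ρ : ℝ} (h : P.IsCone x d δ ρ) {k : Fin P.K}
    (hx : x ∈ P.seg k) : 0 < inner ℝ d (P.normal k) := by
  obtain ⟨y, hyb, hy⟩ : ∃ y ∈ Metric.ball x ρ, y ∈ P.edge k := by
    have : x ∈ closure (P.edge k) := by
      rw [edge, closure_openSegment]; exact hx
    obtain ⟨y, hy, hd⟩ := Metric.mem_closure_iff.1 this ρ h.ρ_pos
    exact ⟨y, by rwa [Metric.mem_ball, dist_comm], hy⟩
  obtain ⟨r, hr, hball, -, -⟩ := P.exists_halfBall hy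
  set w : Plane := -(δ / 2) • P.normal k with hw
  have hδ := h.δ_pos
  have hwn : ‖w‖ < δ := by
    rw [hw, norm_smul, norm_normal, norm_neg, Real.norm_of_nonneg (by linarith)]; linarith
  obtain ⟨s, ⟨hs1, hs2⟩, hs0⟩ := (((eventually_add_smul_mem_ball hyb (d + w)).and
    (eventually_add_smul_mem_ball (Metric.mem_ball_self (x := y) hr) (d + w))).and
    self_mem_nhdsWithin).exists
  have hs0 : 0 < s := hs0
  have h1 := h.notMem hyb hwn hs0.le hs1 (P.notMem_of_mem_seg (P.edge_subset_seg k hy))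
  rw [hball _ hs2, not_lt, add_sub_cancel_left, real_inner_smul_left, inner_add_left, hw,
    real_inner_smul_left, inner_normal_normal] at h1
  have := nonneg_of_mul_nonneg_right h1 hs0
  linarith

/-- Only one boundary ray can leave x on each side of the line spanned by d. Two such rays, scaled
to the same component along J, differ by a multiple of d. Unless that multiple is zero, the points
of one ray are interior to the outward cones at points of the other, hence have a neighbourhood free
of Ω and cannot be boundary points. -/
theorem IsCone.direction_unique {x d : Plane} {δ ρ : ℝ} (h : P.IsCone x d δ ρ) {J u v : Plane}
    (hJ : inner ℝ J d = 0) (hd : d ≠ 0) (hu : 0 < inner ℝ J u) (hv : 0 < inner ℝ J v)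
    (hfu : ∀ᶠ s in 𝓝[>] (0 : ℝ), x + s • u ∈ frontier P.Ω)
    (hfv : ∀ᶠ s in 𝓝[>] (0 : ℝ), x + s • v ∈ frontier P.Ω) :
    (inner ℝ J v : ℝ) • u = (inner ℝ J u : ℝ) • v := by
  have scale : ∀ {c : ℝ} {z : Plane}, 0 < c → (∀ᶠ s in 𝓝[>] (0 : ℝ), x + s • z ∈ frontier P.Ω) →
      ∀ᶠ s in 𝓝[>] (0 : ℝ), x + s • (c • z) ∈ frontier P.Ω := by
    intro c z hc hz
    have : Tendsto (fun s : ℝ => s * c) (𝓝[>] 0) (𝓝[>] 0) := by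
      refine tendsto_nhdsWithin_iff.2 ⟨?_, ?_⟩
      · have hcont : Continuous fun s : ℝ => s * c := by fun_prop
        exact (by simpa using hcont.tendsto 0 : Tendsto (fun s : ℝ => s * c) (𝓝 0) (𝓝 0)).mono_left
          nhdsWithin_le_nhds
      · filter_upwards [self_mem_nhdsWithin] with s hs
        exact mul_pos hs hc
    filter_upwards [this.eventually hz] with s hs
    rwa [smul_smul]
  have key : ∀ a b : Plane, ∀ c : ℝ, 0 < c → a = b + c • d →
      (∀ᶠ s in 𝓝[>] (0 : ℝ), x + s • a ∈ frontier P.Ω) →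
      (∀ᶠ s in 𝓝[>] (0 : ℝ), x + s • b ∈ frontier P.Ω) → False := by
    intro a b c hc hab ha hb
    obtain ⟨s, ⟨⟨⟨h1, h2⟩, h3⟩, h4⟩, hs⟩ := ((((ha.and hb).and
      (eventually_add_smul_mem_ball (Metric.mem_ball_self (x := x) h.ρ_pos) a)).and
      (eventually_add_smul_mem_ball (Metric.mem_ball_self (x := x) h.ρ_pos) b)).and
      self_mem_nhdsWithin).exists
    have hs : 0 < s := hs
    have hδ := h.δ_pos
    have hnb : ∀ᶠ w in 𝓝 (0 : Plane), x + s • a + (s * c) • w ∉ P.Ω := by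
      have hc1 : Continuous fun w : Plane => x + s • a + (s * c) • w := by fun_prop
      have t1 : ∀ᶠ w in 𝓝 (0 : Plane), x + s • a + (s * c) • w ∈ Metric.ball x ρ :=
        (hc1.tendsto 0).eventually (Metric.isOpen_ball.mem_nhds (by simpa using h3))
      filter_upwards [t1, Metric.ball_mem_nhds (0 : Plane) hδ] with w hw hwδ
      have hbΩ : x + s • b ∉ P.Ω := by
        rw [P.isOpen.frontier_eq] at h2; exact h2.2
      have e : x + s • a + (s * c) • w = x + s • b + (s * c) • (d + w) := by
        rw [hab]; module
      rw [e] at hw ⊢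
      exact h.notMem h4 (by simpa using hwδ) (by positivity) hw hbΩ
    have hcl : x + s • a ∈ closure P.Ω := h1.1
    rw [mem_closure_iff_nhds] at hcl
    have hnhds : {z | z ∉ P.Ω} ∈ 𝓝 (x + s • a) := by
      have hc2 : Continuous fun z : Plane => (s * c)⁻¹ • (z - (x + s • a)) := by fun_prop
      have t2 : Tendsto (fun z : Plane => (s * c)⁻¹ • (z - (x + s • a))) (𝓝 (x + s • a)) (𝓝 0) := by
        simpa using hc2.tendsto (x + s • a)
      filter_upwards [t2.eventually hnb] with z hz
      rwa [smul_smul, mul_inv_cancel₀ (by positivity), one_smul, add_sub_cancel] at hz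
    obtain ⟨z, hz, hz'⟩ := hcl _ hnhds
    exact hz hz'
  set a := (inner ℝ J v : ℝ) • u with ha
  set b := (inner ℝ J u : ℝ) • v with hb
  have hab : inner ℝ J (a - b) = 0 := by
    rw [inner_sub_right, ha, hb, real_inner_smul_right, real_inner_smul_right]; ring
  have hJ0 : J ≠ 0 := by rintro rfl; simp at hu
  obtain ⟨c, hc⟩ : ∃ c : ℝ, a - b = c • d := by
    have hdd : d 0 ^ 2 + d 1 ^ 2 ≠ 0 := by
      rw [← norm_sq_plane]; exact pow_ne_zero 2 (norm_ne_zero_iff.2 hd)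
    have hJJ : J 0 ^ 2 + J 1 ^ 2 ≠ 0 := by
      rw [← norm_sq_plane]; exact pow_ne_zero 2 (norm_ne_zero_iff.2 hJ0)
    rw [inner_plane] at hab hJ
    generalize a - b = z at hab
    have hcross : z 0 * d 1 - z 1 * d 0 = 0 := by
      have h0 : (J 0 ^ 2 + J 1 ^ 2) * (z 0 * d 1 - z 1 * d 0) = 0 := by
        linear_combination (J 0 * d 1 - J 1 * d 0) * hab + (J 1 * z 0 - J 0 * z 1) * hJ
      exact (mul_eq_zero.1 h0).resolve_left hJJ
    refine ⟨(z 0 * d 0 + z 1 * d 1) / (d 0 ^ 2 + d 1 ^ 2), ?_⟩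
    ext i
    fin_cases i
    · simp; field_simp; linear_combination d 1 * hcross
    · simp; field_simp; linear_combination -d 0 * hcross
  rcases lt_trichotomy c 0 with hc0 | hc0 | hc0
  · refine (key b a (-c) (by linarith) ?_ (scale hu hfv) (scale hv hfu)).elim
    rw [neg_smul, ← hc]; abel
  · rw [hc0, zero_smul] at hc; exact sub_eq_zero.1 hc
  · refine (key a b c hc0 ?_ (scale hv hfu) (scale hu hfv)).elim
    rw [← hc]; abel

theorem _root_.eq_of_smul_eq_smul_of_norm_one {u v : Plane} {a b : ℝ} (ha : 0 < a) (hb : 0 < b)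
    (hu : ‖u‖ = 1) (hv : ‖v‖ = 1) (h : a • u = b • v) : u = v := by
  have h1 : a = b := by
    have := congrArg norm h
    rwa [norm_smul, norm_smul, hu, hv, mul_one, mul_one, Real.norm_of_nonneg ha.le,
      Real.norm_of_nonneg hb.le] at this
  subst h1
  exact smul_right_injective _ ha.ne' h

theorem norm_tangent (k : Fin P.K) : ‖P.tangent k‖ = 1 := norm_unitTangent (P.p_ne_q k)

theorem IsCone.ne_zero {x d : Plane} {δ ρ : ℝ} (h : P.IsCone x d δ ρ) {k : Fin P.K}
    (hx : x ∈ P.seg k) : d ≠ 0 := by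
  rintro rfl
  simpa using h.inner_normal_pos hx

/-- At most one edge starts at a given point. -/
theorem p_injective : Function.Injective P.p := by
  intro k l hkl
  by_contra hne
  obtain ⟨d, δ, ρ, h⟩ := P.exists_isCone (P.p k)
  have hk := h.inner_normal_pos (P.p_mem_seg k)
  have hl := h.inner_normal_pos (hkl ▸ P.p_mem_seg l)
  -- J is d turned by a right angle, so its product with the tangent equals that of d with the
  -- normal, which is positive for every edge through the point. All edges starting there lie on one
  -- side of the line spanned by d.
  set J : Plane := !₂[-d 1, d 0]
  have hJ : ∀ j, inner ℝ J (P.tangent j) = inner ℝ d (P.normal j) := fun j => by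
    rw [inner_plane, inner_plane, normal_zero, normal_one]; simp [J]; ring
  have hev : ∀ j, P.p j = P.p k →
      ∀ᶠ s in 𝓝[>] (0 : ℝ), P.p k + s • P.tangent j ∈ P.edge j := fun j hj => by
    filter_upwards [Ioo_mem_nhdsGT (P.len_pos j)] with s hs
    exact P.mem_edge_iff.2 ⟨s, hs, by rw [hj]⟩
  have hfr : ∀ j, P.p j = P.p k →
      ∀ᶠ s in 𝓝[>] (0 : ℝ), P.p k + s • P.tangent j ∈ frontier P.Ω := fun j hj =>
    (hev j hj).mono fun s hs => P.seg_subset_frontier j (P.edge_subset_seg j hs)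
  have := h.direction_unique (J := J) (by rw [inner_plane]; simp [J]; ring)
    (h.ne_zero (P.p_mem_seg k)) (by rwa [hJ]) (by rwa [hJ]) (hfr k rfl) (hfr l hkl.symm)
  rw [hJ, hJ] at this
  have huv := eq_of_smul_eq_smul_of_norm_one hl hk (norm_tangent k) (norm_tangent l) this
  obtain ⟨s, h1, h2⟩ := ((hev k rfl).and (hev l hkl.symm)).exists
  rw [← huv] at h2
  exact disjoint_left.1 (P.edges_disjoint k l hne) h1 h2

/-- At most one edge ends at a given point. -/
theorem q_injective : Function.Injective P.q := by
  intro k l hkl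
  by_contra hne
  obtain ⟨d, δ, ρ, h⟩ := P.exists_isCone (P.q k)
  have hk := h.inner_normal_pos (P.q_mem_seg k)
  have hl := h.inner_normal_pos (hkl ▸ P.q_mem_seg l)
  -- An edge ending at the point leaves it in the direction of minus the tangent, so d is turned the
  -- other way.
  set J : Plane := !₂[d 1, -d 0]
  have hJ : ∀ j, inner ℝ J (-P.tangent j) = inner ℝ d (P.normal j) := fun j => by
    rw [inner_plane, inner_plane, normal_zero, normal_one]; simp [J]; ring
  have hev : ∀ j, P.q j = P.q k →
      ∀ᶠ s in 𝓝[>] (0 : ℝ), P.q k + s • (-P.tangent j) ∈ P.edge j := fun j hj => by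
    filter_upwards [Ioo_mem_nhdsGT (P.len_pos j)] with s hs
    refine P.mem_edge_iff.2 ⟨P.len j - s, ⟨by linarith [hs.2], by linarith [hs.1]⟩, ?_⟩
    rw [sub_smul, len_smul_tangent, ← hj]; module
  have hfr : ∀ j, P.q j = P.q k →
      ∀ᶠ s in 𝓝[>] (0 : ℝ), P.q k + s • (-P.tangent j) ∈ frontier P.Ω := fun j hj =>
    (hev j hj).mono fun s hs => P.seg_subset_frontier j (P.edge_subset_seg j hs)
  have := h.direction_unique (J := J) (by rw [inner_plane]; simp [J]; ring)
    (h.ne_zero (P.q_mem_seg k)) (by rwa [hJ]) (by rwa [hJ]) (hfr k rfl) (hfr l hkl.symm)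
  rw [hJ, hJ] at this
  have huv := eq_of_smul_eq_smul_of_norm_one hl hk (by rw [norm_neg]; exact norm_tangent k)
    (by rw [norm_neg]; exact norm_tangent l) this
  obtain ⟨s, h1, h2⟩ := ((hev k rfl).and (hev l hkl.symm)).exists
  rw [← huv] at h2
  exact disjoint_left.1 (P.edges_disjoint k l hne) h1 h2

end Plate
/-! ### Cutoff functions at isolated points -/

/-- The bump function `κ((j + 1) (y - x))`. -/
def pointCutoff (x : Plane) (j : ℕ) (y : Plane) : ℝ :=
  (⟨1, 2, one_pos, one_lt_two⟩ : ContDiffBump (0 : Plane)) (((j : ℝ) + 1) • (y - x))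

theorem contDiff_pointCutoff (x : Plane) (j : ℕ) : ContDiff ℝ ∞ (pointCutoff x j) :=
  (ContDiffBump.contDiff _).comp (g := fun z => _) (f := fun y : Plane => ((j : ℝ) + 1) • (y - x))
    (by fun_prop)

theorem pointCutoff_eq_one {x y : Plane} {j : ℕ} (h : ((j : ℝ) + 1) * ‖y - x‖ ≤ 1) :
    pointCutoff x j y = 1 := by
  refine ContDiffBump.one_of_mem_closedBall _ ?_
  rw [mem_closedBall_zero_iff, norm_smul, Real.norm_of_nonneg (by positivity)]
  exact h

theorem pointCutoff_eq_zero {x y : Plane} {j : ℕ} (h : 2 ≤ ((j : ℝ) + 1) * ‖y - x‖) :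
    pointCutoff x j y = 0 := by
  refine ContDiffBump.zero_of_le_dist _ ?_
  rw [dist_zero_right, norm_smul, Real.norm_of_nonneg (by positivity)]
  exact h

theorem abs_pointCutoff_le (x : Plane) (j : ℕ) (y : Plane) : |pointCutoff x j y| ≤ 1 := by
  rw [pointCutoff, abs_of_nonneg (ContDiffBump.nonneg _)]
  exact ContDiffBump.le_one _

theorem tendsto_pointCutoff {x y : Plane} (h : y ≠ x) :
    Tendsto (fun j => pointCutoff x j y) atTop (𝓝 0) := by
  have hpos : 0 < ‖y - x‖ := norm_pos_iff.2 (sub_ne_zero.2 h)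
  obtain ⟨N, hN⟩ := exists_nat_gt (2 / ‖y - x‖)
  refine tendsto_const_nhds.congr' ?_
  filter_upwards [eventually_ge_atTop N] with j hj
  refine (pointCutoff_eq_zero ?_).symm
  rw [div_lt_iff₀ hpos] at hN
  have : (N : ℝ) ≤ j := by exact_mod_cast hj
  nlinarith

/-- The growth of the gradient and the shrinking of its support balance in the L² norm in two
dimensions. The radius is 3/(j + 1), not 2/(j + 1), so that outside the ball the cutoff vanishes in
a whole neighbourhood and its derivative is zero. -/
theorem exists_bound_classicalPartial_pointCutoff : ∃ C : ℝ, 0 ≤ C ∧ ∀ (x : Plane) (j : ℕ) (i : Fin 2)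
    (y : Plane), |classicalPartial i (pointCutoff x j) y| ≤
      (Metric.ball x (3 / ((j : ℝ) + 1))).indicator (fun _ => C * ((j : ℝ) + 1)) y := by
  set κ : ContDiffBump (0 : Plane) := ⟨1, 2, one_pos, one_lt_two⟩
  have hκ : ContDiff ℝ ∞ κ := κ.contDiff
  obtain ⟨C, hC⟩ := (κ.hasCompactSupport.fderiv ℝ).exists_bound_of_continuous
    (hκ.continuous_fderiv (by simp))
  have hC0 : 0 ≤ C := (norm_nonneg _).trans (hC 0)
  refine ⟨C, hC0, fun x j i y => ?_⟩
  have hj : (0 : ℝ) < (j : ℝ) + 1 := by positivity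
  by_cases hy : y ∈ Metric.ball x (3 / ((j : ℝ) + 1))
  · rw [indicator_of_mem hy]
    have hd : HasFDerivAt (fun y : Plane => ((j : ℝ) + 1) • (y - x))
        (((j : ℝ) + 1) • ContinuousLinearMap.id ℝ Plane) y :=
      ((hasFDerivAt_id y).sub_const x).fun_const_smul _
    have h := ((hκ.differentiable (by simp) _).hasFDerivAt.comp y hd).fderiv
    have h' : fderiv ℝ (pointCutoff x j) y = _ := h
    rw [classicalPartial, h']
    simp only [ContinuousLinearMap.comp_apply, smul_apply,
      ContinuousLinearMap.id_apply, map_smul, smul_eq_mul]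
    rw [abs_mul, abs_of_pos hj, mul_comm C]
    refine mul_le_mul_of_nonneg_left ?_ hj.le
    refine ((fderiv ℝ κ (((j : ℝ) + 1) • (y - x))).le_opNorm (basisVec i)).trans ?_
    rw [PiLp.norm_single, norm_one, mul_one]
    exact hC _
  · rw [indicator_of_notMem hy]
    have : pointCutoff x j =ᶠ[𝓝 y] fun _ => 0 := by
      have hc : Continuous fun z : Plane => ((j : ℝ) + 1) * ‖z - x‖ := by fun_prop
      have h2 : 2 < ((j : ℝ) + 1) * ‖y - x‖ := by
        rw [mem_ball_iff_norm, not_lt, div_le_iff₀ hj] at hy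
        linarith
      filter_upwards [hc.continuousAt.eventually (lt_mem_nhds h2)] with z hz
      exact pointCutoff_eq_zero (le_of_lt hz)
    rw [classicalPartial, this.fderiv_eq]
    simp

/-- The tool for ignoring corners. Near an exceptional point x, a function is split into its product
with the cutoff at x, whose contribution tends to zero, and a remainder that vanishes near x, to
which the local hypothesis applies. -/
theorem smooth_removable {L : (Plane → ℝ) → ℝ} {S : Set Plane} (hS : S.Finite)
    (add : ∀ f g, ContDiff ℝ ∞ f → ContDiff ℝ ∞ g → HasCompactSupport f → HasCompactSupport g →
      L (fun x => f x + g x) = L f + L g)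
    (loc : ∀ x ∉ S, ∃ V ∈ 𝓝 x, ∀ f, ContDiff ℝ ∞ f → HasCompactSupport f → tsupport f ⊆ V → L f = 0)
    (rem : ∀ x ∈ S, ∀ f, ContDiff ℝ ∞ f → HasCompactSupport f →
      Tendsto (fun j => L fun y => pointCutoff x j y * f y) atTop (𝓝 0))
    (f : Plane → ℝ) (hf : ContDiff ℝ ∞ f) (hc : HasCompactSupport f) : L f = 0 := by
  have zero : L (fun _ => 0) = 0 := by
    have := add (fun _ => 0) (fun _ => 0) contDiff_const contDiff_const HasCompactSupport.zero
      HasCompactSupport.zero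
    simp only [add_zero] at this
    linarith
  have add' : ∀ f g, ContDiff ℝ ∞ f → ContDiff ℝ ∞ g → HasCompactSupport f → HasCompactSupport g →
      L f = 0 → L g = 0 → L (fun x => f x + g x) = 0 := fun f g h1 h2 h3 h4 h5 h6 => by
    rw [add f g h1 h2 h3 h4, h5, h6, add_zero]
  refine smooth_localization (Q := fun f => L f = 0) (U := univ) zero add' (fun x _ => ?_) f hf hc
    (subset_univ _)
  by_cases hx : x ∈ S
  swap
  · exact loc x hx
  refine ⟨(S \ {x})ᶜ, (hS.sdiff).isClosed.isOpen_compl.mem_nhds (by simp), fun f hf hc hs => ?_⟩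
  refine tendsto_nhds_unique (tendsto_const_nhds.congr fun j => ?_) (rem x hx f hf hc)
  have hκ := contDiff_pointCutoff x j
  have hsm : ContDiff ℝ ∞ fun y => (1 - pointCutoff x j y) * f y := (contDiff_const.sub hκ).mul hf
  have hcs : HasCompactSupport fun y => (1 - pointCutoff x j y) * f y := hc.mul_left
  -- The support of f contains no exceptional point except possibly x, and the factor vanishes near
  -- x.
  have h0 : L (fun y => (1 - pointCutoff x j y) * f y) = 0 := by
    refine smooth_localization (Q := fun f => L f = 0) (U := Sᶜ) zero add' loc _ hsm hcs ?_
    intro y hy hyS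
    have hyf : y ∈ tsupport f := tsupport_mul_subset_right hy
    have hyx : y = x := by
      by_contra hne
      exact hs hyf ⟨hyS, hne⟩
    refine notMem_tsupport_iff_eventuallyEq.2 ?_ hy
    have hc : Continuous fun z : Plane => ((j : ℝ) + 1) * ‖z - x‖ := by fun_prop
    have h2 : ((j : ℝ) + 1) * ‖y - x‖ < 1 := by simp [hyx]
    filter_upwards [hc.continuousAt.eventually (gt_mem_nhds h2)] with z hz
    rw [pointCutoff_eq_one (le_of_lt hz)]
    simp
  have := add _ _ (hκ.mul hf) hsm hc.mul_left hcs
  rw [h0, add_zero] at this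
  rw [← this]
  congr 1
  ext y; ring

namespace Plate

variable (P : Plate)

/-! ### The boundary measure -/

/-- The parametrization of edge `k` by arc length. -/
def arc (k : Fin P.K) (s : ℝ) : Plane := P.p k + s • P.tangent k

theorem isometry_arc (k : Fin P.K) : Isometry (P.arc k) := by
  refine Isometry.of_dist_eq fun s t => ?_
  rw [arc, arc, dist_add_left, dist_eq_norm, ← sub_smul, norm_smul, norm_tangent, mul_one,
    Real.dist_eq, Real.norm_eq_abs]

theorem measurableEmbedding_arc (k : Fin P.K) : MeasurableEmbedding (P.arc k) :=
  (P.isometry_arc k).isClosedEmbedding.measurableEmbedding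

theorem hasDerivAt_arc (k : Fin P.K) (s : ℝ) : HasDerivAt (P.arc k) (P.tangent k) s := by
  exact (((hasDerivAt_id' s).smul_const (P.tangent k)).const_add (P.p k)).congr_deriv (one_smul _ _)

theorem edgeMeasure_eq (k : Fin P.K) :
    P.edgeMeasure k = Measure.map (P.arc k) (volume.restrict (Ioo 0 (P.len k))) := by
  have hl := P.len_pos k
  have h1 : volume.restrict (Ioo 0 (P.len k)) = ENNReal.ofReal (P.len k) •
      Measure.map (fun s => P.len k * s) (volume.restrict (Ioo (0 : ℝ) 1)) := by
    have e : MeasurableEmbedding (fun s : ℝ => P.len k * s) :=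
      (Homeomorph.mulLeft₀ _ hl.ne').measurableEmbedding
    have hpre : Ioo (0 : ℝ) 1 = (fun s => P.len k * s) ⁻¹' Ioo 0 (P.len k) := by
      ext s
      simp only [mem_preimage, mem_Ioo]
      constructor
      · rintro ⟨h0, h1⟩; exact ⟨by positivity, by nlinarith⟩
      · rintro ⟨h0, h1⟩; exact ⟨pos_of_mul_pos_right h0 hl.le, by nlinarith⟩
    rw [hpre, ← e.restrict_map, Real.map_volume_mul_left hl.ne', Measure.restrict_smul, smul_smul,
      ← ENNReal.ofReal_mul hl.le, abs_of_pos (by positivity), mul_inv_cancel₀ hl.ne']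
    simp
  rw [h1, Measure.map_smul, Measure.map_map (P.isometry_arc k).continuous.measurable (by fun_prop)]
  rw [edgeMeasure]
  congr 2
  ext1 s
  rw [Function.comp_apply, arc, mul_comm, mul_smul, len_smul_tangent]

theorem integral_edge (k : Fin P.K) (f : Plane → ℝ) :
    ∫ x, f x ∂P.edgeMeasure k = ∫ s in Ioo 0 (P.len k), f (P.arc k s) := by
  rw [edgeMeasure_eq, (P.measurableEmbedding_arc k).integral_map]

theorem ae_edge_iff (k : Fin P.K) {Q : Plane → Prop} :
    (∀ᵐ x ∂P.edgeMeasure k, Q x) ↔ ∀ᵐ s ∂volume.restrict (Ioo 0 (P.len k)), Q (P.arc k s) := by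
  rw [edgeMeasure_eq, (P.measurableEmbedding_arc k).ae_map_iff]

theorem ae_edge_mem (k : Fin P.K) : ∀ᵐ x ∂P.edgeMeasure k, x ∈ P.edge k := by
  rw [ae_edge_iff]
  filter_upwards [ae_restrict_mem measurableSet_Ioo] with s hs
  exact P.mem_edge_iff.2 ⟨s, hs, rfl⟩

theorem compactlyCarried_edge (k : Fin P.K) : CompactlyCarried (P.edgeMeasure k) := by
  refine ⟨?_, P.seg k, P.isCompact_seg k, (P.ae_edge_mem k).mono fun x hx => P.edge_subset_seg k hx⟩
  rw [edgeMeasure_eq]; infer_instance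

instance (k : Fin P.K) : IsFiniteMeasure (P.edgeMeasure k) := (P.compactlyCarried_edge k).finite

theorem ae_boundary_iff {Q : Plane → Prop} :
    (∀ᵐ x ∂P.boundaryMeasure, Q x) ↔ ∀ k, ∀ᵐ x ∂P.edgeMeasure k, Q x := by
  rw [boundaryMeasure, ← Measure.sum_fintype, Measure.ae_sum_iff]

theorem edgeMeasure_le (k : Fin P.K) : P.edgeMeasure k ≤ P.boundaryMeasure := by
  rw [boundaryMeasure, ← Measure.sum_fintype]; exact Measure.le_sum _ k

theorem ae_boundary_mem : ∀ᵐ x ∂P.boundaryMeasure, x ∈ frontier P.Ω :=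
  P.ae_boundary_iff.2 fun k => (P.ae_edge_mem k).mono fun _ hx =>
    P.seg_subset_frontier k (P.edge_subset_seg k hx)

theorem compactlyCarried_boundary : CompactlyCarried P.boundaryMeasure := by
  refine ⟨?_, closure P.Ω, P.isBounded.isCompact_closure,
    P.ae_boundary_mem.mono fun x hx => frontier_subset_closure hx⟩
  rw [boundaryMeasure]; infer_instance

theorem compactlyCarried_volume : CompactlyCarried (volume.restrict P.Ω) :=
  compactlyCarried_restrict P.isBounded P.isOpen.measurableSet

theorem memLp_edge {f : Plane → ℝ} (h : MemLp f 2 P.boundaryMeasure) (k : Fin P.K) :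
    MemLp f 2 (P.edgeMeasure k) := h.mono_measure (P.edgeMeasure_le k)

theorem tendstoL2_edge {a : ℕ → Plane → ℝ} {b : Plane → ℝ} (h : TendstoL2 P.boundaryMeasure a b)
    (k : Fin P.K) : TendstoL2 (P.edgeMeasure k) a b :=
  ⟨fun m => P.memLp_edge (h.memLp m) k, P.memLp_edge h.memLp_lim k,
    tendsto_of_tendsto_of_tendsto_of_le_of_le tendsto_const_nhds h.tendsto (fun _ => zero_le)
      fun _ => eLpNorm_mono_measure _ (P.edgeMeasure_le k)⟩

/-! ### The Gauss-Green formula -/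

/-- In orthonormal coordinates along and across the edge, the tangential derivative integrates to
zero over each line parallel to the edge, and the normal derivative integrates to the value on the
edge line. -/
theorem integral_fderiv_halfPlane (k : Fin P.K) (x v : Plane) {f : Plane → ℝ} (hf : ContDiff ℝ ∞ f)
    (hc : HasCompactSupport f) :
    ∫ y in {y | inner ℝ (y - x) (P.normal k) < 0}, fderiv ℝ f y v =
      inner ℝ v (P.normal k) * ∫ s : ℝ, f (x + s • P.tangent k) := by
  obtain ⟨b, hb⟩ := Orthonormal.exists_orthonormalBasis_extension_of_card_eq (𝕜 := ℝ) (E := Plane)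
    (ι := Fin 2) (by simp) (v := ![P.tangent k, P.normal k]) (s := univ) (by
      rw [orthonormal_iff_ite]
      rintro ⟨i, -⟩ ⟨j, -⟩
      fin_cases i <;> fin_cases j <;>
        simp [inner_tangent_normal, norm_tangent, norm_normal, real_inner_comm (P.tangent k)])
  have hb0 : b 0 = P.tangent k := hb 0 trivial
  have hb1 : b 1 = P.normal k := hb 1 trivial
  -- orthonormal coordinates
  let Φ : ℝ × ℝ → Plane := fun z => x + (z.1 • P.tangent k + z.2 • P.normal k)
  let e : ℝ × ℝ ≃ᵐ Plane := MeasurableEquiv.finTwoArrow.symm.trans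
    ((MeasurableEquiv.toLp 2 (Fin 2 → ℝ)).trans
      (b.repr.symm.toHomeomorph.toMeasurableEquiv.trans (Homeomorph.addLeft x).toMeasurableEquiv))
  have he : ⇑e = Φ := by
    ext1 z
    change x + b.repr.symm (WithLp.toLp 2 ![z.1, z.2]) = _
    rw [← b.sum_repr_symm, Fin.sum_univ_two, hb0, hb1]
    rfl
  have hmp : MeasurePreserving Φ volume volume := by
    rw [← he]
    exact ((measurePreserving_add_left volume x).comp (b.measurePreserving_repr_symm.comp
      ((EuclideanSpace.volume_preserving_symm_measurableEquiv_toLp (Fin 2)).symm.comp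
        (volume_preserving_finTwoArrow ℝ).symm)))
  have hemb : MeasurableEmbedding Φ := he ▸ e.measurableEmbedding
  have hpre : Φ ⁻¹' {y | inner ℝ (y - x) (P.normal k) < 0} = (univ : Set ℝ) ×ˢ Iio (0 : ℝ) := by
    ext z
    simp only [Φ, mem_preimage, mem_ofPred_eq, add_sub_cancel_left, inner_add_left,
      real_inner_smul_left, inner_tangent_normal, inner_normal_normal, mem_prod, mem_univ, true_and,
      mem_Iio]
    simp
  have hΦ : ContDiff ℝ ∞ Φ := by fun_prop
  have hv : v = (inner ℝ v (P.tangent k) : ℝ) • P.tangent k + (inner ℝ v (P.normal k) : ℝ) • P.normal k := by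
    have ht := P.tangent_sq k
    ext i
    rw [inner_plane, inner_plane, normal_zero, normal_one]
    fin_cases i
    · simp [normal_zero]; linear_combination (-v 0) * ht
    · simp [normal_one]; linear_combination (-v 1) * ht
  set F : ℝ × ℝ → ℝ := fun z => f (Φ z) with hF
  have hcΦ : IsCompact (Φ ⁻¹' tsupport f) := by
    have hce : IsClosedEmbedding Φ := by
      have : Φ = (Homeomorph.addLeft x) ∘ b.repr.symm ∘ (WithLp.toLp 2) ∘
          (Homeomorph.finTwoArrow (X := ℝ)).symm := by
        rw [← he]; rfl
      rw [this]
      exact (Homeomorph.isClosedEmbedding _).comp ((b.repr.symm.toHomeomorph.isClosedEmbedding).comp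
        ((PiLp.homeomorph 2 (fun _ : Fin 2 => ℝ)).symm.isClosedEmbedding.comp
          (Homeomorph.isClosedEmbedding _)))
    exact hce.isCompact_preimage hc
  have hD : ∀ w : Plane, HasCompactSupport fun z => fderiv ℝ f (Φ z) w := fun w =>
    HasCompactSupport.intro hcΦ fun z hz => by
      have : Φ z ∉ tsupport fun x => fderiv ℝ f x w := fun h =>
        hz (KirchhoffPlate.tsupport_fderiv_apply_subset f w h)
      exact image_eq_zero_of_notMem_tsupport (f := fun x => fderiv ℝ f x w) this
  have hDc : ∀ w : Plane, Continuous fun z => fderiv ℝ f (Φ z) w := fun w =>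
    (contDiff_fderiv_apply hf w).continuous.comp hΦ.continuous
  have hint : ∀ w : Plane, Integrable (fun z => fderiv ℝ f (Φ z) w) (volume : Measure (ℝ × ℝ)) :=
    fun w => (hDc w).integrable_of_hasCompactSupport (hD w)
  have hslice1 : ∀ t : ℝ, ∫ s : ℝ, fderiv ℝ f (Φ (s, t)) (P.tangent k) = 0 := by
    intro t
    have hsm : ContDiff ℝ 1 fun s : ℝ => F (s, t) :=
      contDiff_infty.1 ((hf.comp hΦ).comp (contDiff_id.prodMk contDiff_const)) 1
    have hder : ∀ s, deriv (fun s : ℝ => F (s, t)) s = fderiv ℝ f (Φ (s, t)) (P.tangent k) := by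
      intro s
      have h1 : HasDerivAt (fun s : ℝ => Φ (s, t)) (P.tangent k) s := by
        exact ((((hasDerivAt_id' s).smul_const (P.tangent k)).add_const
          (t • P.normal k)).const_add x).congr_deriv (one_smul _ _)
      exact ((differentiable_of_smooth hf _).hasFDerivAt.comp_hasDerivAt s h1).deriv
    have hcs : HasCompactSupport fun s : ℝ => F (s, t) := by
      refine HasCompactSupport.intro (hcΦ.image continuous_fst) fun s hs => ?_
      exact image_eq_zero_of_notMem_tsupport (f := f) fun h => hs ⟨(s, t), h, rfl⟩
    simp only [← hder]
    exact integral_eq_zero_of_hasDerivAt_of_integrable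
      (fun s => (hsm.differentiable one_ne_zero s).hasDerivAt)
      ((hsm.continuous_deriv le_rfl).integrable_of_hasCompactSupport hcs.deriv)
      (hsm.continuous.integrable_of_hasCompactSupport hcs)
  have hslice2 : ∀ s : ℝ, ∫ t in Iio 0, fderiv ℝ f (Φ (s, t)) (P.normal k) = F (s, 0) := by
    intro s
    have hsm : ContDiff ℝ 1 fun t : ℝ => F (s, t) :=
      contDiff_infty.1 ((hf.comp hΦ).comp (contDiff_const.prodMk contDiff_id)) 1
    have hder : ∀ t, deriv (fun t : ℝ => F (s, t)) t = fderiv ℝ f (Φ (s, t)) (P.normal k) := by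
      intro t
      have h1 : HasDerivAt (fun t : ℝ => Φ (s, t)) (P.normal k) t := by
        exact ((((hasDerivAt_id' t).smul_const (P.normal k)).const_add
          (s • P.tangent k)).const_add x).congr_deriv (one_smul _ _)
      exact ((differentiable_of_smooth hf _).hasFDerivAt.comp_hasDerivAt t h1).deriv
    have hcs : HasCompactSupport fun t : ℝ => F (s, t) := by
      refine HasCompactSupport.intro (hcΦ.image continuous_snd) fun t ht => ?_
      exact image_eq_zero_of_notMem_tsupport (f := f) fun h => ht ⟨(s, t), h, rfl⟩
    simp only [← hder]
    rw [← integral_Iic_eq_integral_Iio]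
    exact HasCompactSupport.integral_Iic_deriv_eq hsm hcs 0
  rw [← hmp.setIntegral_preimage_emb hemb, hpre]
  have hsplit : ∀ z, fderiv ℝ f (Φ z) v = inner ℝ v (P.tangent k) * fderiv ℝ f (Φ z) (P.tangent k) +
      inner ℝ v (P.normal k) * fderiv ℝ f (Φ z) (P.normal k) := fun z => by
    conv_lhs => rw [hv]
    simp
  simp only [hsplit]
  rw [integral_add ((hint _).const_mul _).integrableOn ((hint _).const_mul _).integrableOn,
    integral_const_mul, integral_const_mul]
  have e1 : ∫ z in (univ : Set ℝ) ×ˢ Iio (0 : ℝ), fderiv ℝ f (Φ z) (P.tangent k) = 0 := by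
    have := setIntegral_prod_swap (μ := (volume : Measure ℝ)) (ν := (volume : Measure ℝ)) univ
      (Iio (0 : ℝ)) (fun z => fderiv ℝ f (Φ z) (P.tangent k))
    rw [Measure.volume_eq_prod, ← this, setIntegral_prod]
    · simp only [Prod.swap_prod_mk, Measure.restrict_univ, hslice1, integral_zero]
    · exact ((hint (P.tangent k)).swap).integrableOn
  have e2 : ∫ z in (univ : Set ℝ) ×ˢ Iio (0 : ℝ), fderiv ℝ f (Φ z) (P.normal k) =
      ∫ s : ℝ, f (x + s • P.tangent k) := by
    rw [Measure.volume_eq_prod, setIntegral_prod _ (hint (P.normal k)).integrableOn]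
    simp only [hslice2, Measure.restrict_univ]
    simp [hF, Φ]
  rw [e1, e2, mul_zero, zero_add]

end Plate
-- Points have zero capacity in the plane.
theorem aestronglyMeasurable_pointCutoff {μ : Measure Plane} (x : Plane) (j : ℕ) :
    AEStronglyMeasurable (pointCutoff x j) μ :=
  (contDiff_pointCutoff x j).continuous.aestronglyMeasurable

theorem tendsto_integral_pointCutoff_mul {μ : Measure Plane} {x : Plane} (hx : ∀ᵐ y ∂μ, y ≠ x)
    {u : Plane → ℝ} (hu : Integrable u μ) :
    Tendsto (fun j => ∫ y, pointCutoff x j y * u y ∂μ) atTop (𝓝 0) := by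
  have := tendsto_integral_of_dominated_convergence (μ := μ)
    (F := fun j y => pointCutoff x j y * u y) (f := fun _ => 0) (fun y => ‖u y‖)
    (fun j => (aestronglyMeasurable_pointCutoff x j).mul hu.1) hu.norm
    (fun j => .of_forall fun y => ?_) ?_
  · simpa using this
  · rw [norm_mul]
    exact mul_le_of_le_one_left (norm_nonneg _) (abs_pointCutoff_le x j y)
  · filter_upwards [hx] with y hy
    simpa using (tendsto_pointCutoff hy).mul_const (u y)

/-- The Dirichlet norm is scale invariant in the plane: C(j + 1) times the square root of the area
of a disc of radius 3/(j + 1) does not depend on j. -/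
theorem exists_eLpNorm_classicalPartial_pointCutoff_le (x : Plane) (i : Fin 2) :
    ∃ B : ℝ≥0∞, B ≠ ⊤ ∧ ∀ j, eLpNorm (classicalPartial i (pointCutoff x j)) 2 volume ≤ B := by
  obtain ⟨C, hC0, hC⟩ := exists_bound_classicalPartial_pointCutoff
  refine ⟨ENNReal.ofReal (3 * C) * volume (Metric.ball (0 : Plane) 1) ^ (1 / (2 : ℝ)),
    ENNReal.mul_ne_top ENNReal.ofReal_ne_top
      (ENNReal.rpow_ne_top_of_nonneg (by norm_num) measure_ball_lt_top.ne), fun j => ?_⟩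
  have hj : (0 : ℝ) < (j : ℝ) + 1 := by positivity
  refine (eLpNorm_mono_real (g := (Metric.ball x (3 / ((j : ℝ) + 1))).indicator
    fun _ => C * ((j : ℝ) + 1)) (hC x j i)).trans ?_
  rw [eLpNorm_indicator_const Metric.isOpen_ball.measurableSet (by norm_num) (by norm_num),
    Measure.addHaar_ball _ _ (by positivity)]
  simp only [ENNReal.toReal_ofNat, finrank_euclideanSpace, Fintype.card_fin]
  rw [ENNReal.mul_rpow_of_nonneg _ _ (by norm_num), ← mul_assoc,
    ENNReal.ofReal_rpow_of_nonneg (by positivity) (by norm_num), ← Real.sqrt_eq_rpow,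
    Real.sqrt_sq (by positivity), Real.enorm_of_nonneg (by positivity),
    ← ENNReal.ofReal_mul (by positivity)]
  refine mul_le_mul_left (ENNReal.ofReal_le_ofReal (le_of_eq ?_)) _
  field_simp

/-- The derivatives of the cutoffs stay bounded in L² but live on discs shrinking to x, on which the
L² norm of u tends to zero. The Cauchy-Schwarz inequality concludes. -/
theorem tendsto_integral_classicalPartial_pointCutoff_mul {Ω : Set Plane}
    (x : Plane) (i : Fin 2) {u : Plane → ℝ} (hu : MemLp u 2 (volume.restrict Ω)) :
    Tendsto (fun j => ∫ y in Ω, classicalPartial i (pointCutoff x j) y * u y) atTop (𝓝 0) := by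
  obtain ⟨C, hC0, hC⟩ := exists_bound_classicalPartial_pointCutoff
  obtain ⟨B, hB, hBj⟩ := exists_eLpNorm_classicalPartial_pointCutoff_le x i
  have hae : ∀ᵐ y ∂volume.restrict Ω, y ≠ x := ae_restrict_of_ae (Measure.ae_ne volume x)
  set c : ℕ → Plane → ℝ := fun j => (Metric.ball x (3 / ((j : ℝ) + 1))).indicator fun _ => 1
  have hc := tendstoL2_bdd_mul_of_tendsto_ae (c := c) (d := fun _ => 0) (C := 1) hu
    (fun j => aestronglyMeasurable_const.indicator Metric.isOpen_ball.measurableSet)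
    (fun j => .of_forall fun y => by
      by_cases hy : y ∈ Metric.ball x (3 / ((j : ℝ) + 1)) <;> simp [c, hy])
    (by
      filter_upwards [hae] with y hy
      have hpos : 0 < ‖y - x‖ := norm_pos_iff.2 (sub_ne_zero.2 hy)
      obtain ⟨N, hN⟩ := exists_nat_gt (3 / ‖y - x‖)
      refine tendsto_const_nhds.congr' ?_
      filter_upwards [eventually_ge_atTop N] with j hj
      refine (indicator_of_notMem ?_ _).symm
      rw [div_lt_iff₀ hpos] at hN
      have : (N : ℝ) ≤ j := by exact_mod_cast hj
      rw [mem_ball_iff_norm, not_lt, div_le_iff₀ (by positivity)]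
      nlinarith)
  have h0 : Tendsto (fun j => B * eLpNorm (fun y => c j y * u y) 2 (volume.restrict Ω)) atTop (𝓝 0) := by
    have h1 := hc.tendsto
    have e : ∀ j, (fun y => c j y * u y) - (fun y => 0 * u y) = fun y => c j y * u y := fun j => by
      ext y; simp
    simp only [e] at h1
    simpa using ENNReal.Tendsto.const_mul h1 (Or.inr hB)
  rw [tendsto_iff_edist_tendsto_0]
  refine tendsto_of_tendsto_of_tendsto_of_le_of_le tendsto_const_nhds h0 (fun _ => zero_le)
    fun j => ?_
  rw [edist_zero_right]
  have hker : ∀ y, classicalPartial i (pointCutoff x j) y * u y =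
      classicalPartial i (pointCutoff x j) y * (c j y * u y) := fun y => by
    by_cases hy : y ∈ Metric.ball x (3 / ((j : ℝ) + 1))
    · simp [c, hy]
    · have h2 := hC x j i y
      rw [indicator_of_notMem hy] at h2
      rw [abs_eq_zero.1 (le_antisymm h2 (abs_nonneg _))]; simp
  simp only [hker]
  refine (enorm_integral_le_lintegral_enorm _).trans ?_
  have hsm := (contDiff_classicalPartial (contDiff_pointCutoff x j) i).continuous
  have := eLpNorm_smul_le_mul_eLpNorm (p := 2) (q := 2) (r := 1) (hc.memLp j).1
    (hsm.aestronglyMeasurable (μ := volume.restrict Ω))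
  rw [eLpNorm_one_eq_lintegral_enorm] at this
  refine le_trans this (mul_le_mul_left ?_ _)
  exact (eLpNorm_restrict_le _ _ _ _).trans (hBj j)

namespace Plate

variable (P : Plate)

theorem ae_edge_ne (k : Fin P.K) (x : Plane) : ∀ᵐ y ∂P.edgeMeasure k, y ≠ x := by
  rw [ae_edge_iff]
  refine ae_restrict_of_ae ?_
  by_cases h : ∃ s, P.arc k s = x
  · obtain ⟨s, rfl⟩ := h
    filter_upwards [Measure.ae_ne volume s] with t ht
    exact fun h => ht ((P.isometry_arc k).injective h)
  · exact .of_forall fun s hs => h ⟨s, hs⟩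

/-- The set of corner points. -/
def corners : Set Plane := range P.p ∪ range P.q

theorem finite_corners : P.corners.Finite := (finite_range _).union (finite_range _)

theorem integral_fderiv_of_tsupport_subset {f : Plane → ℝ} (hf : ContDiff ℝ ∞ f)
    (hc : HasCompactSupport f) (hs : tsupport f ⊆ P.Ω) (v : Plane) :
    ∫ y in P.Ω, fderiv ℝ f y v = 0 := by
  rw [setIntegral_eq_integral_of_tsupport fun x hx => image_eq_zero_of_notMem_tsupport
    (f := fun y => fderiv ℝ f y v)
    fun h => hx (hs (KirchhoffPlate.tsupport_fderiv_apply_subset f v h))]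
  have h := integral_mul_fderiv_eq_neg_fderiv_mul_of_integrable (μ := (volume : Measure Plane))
    (f := fun _ => (1 : ℝ)) (g := f) (v := v) (by simp) ?_ ?_
    (fun x _ => differentiableAt_const _) (fun x _ => differentiable_of_smooth hf x)
  · simpa using h
  · simp only [one_mul]
    refine (contDiff_fderiv_apply hf v).continuous.integrable_of_hasCompactSupport ?_
    exact hc.mono' ((subset_tsupport _).trans (KirchhoffPlate.tsupport_fderiv_apply_subset f v))
  · simpa using hf.continuous.integrable_of_hasCompactSupport hc

/-- Both sides are additive in f, so the identity is local. Near points off Γ both sides vanish,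
near a point of an open edge Ω is a half disc and the half-plane formula applies, and the finitely
many corners are removable. -/
theorem gauss_green_of_hasCompactSupport {f : Plane → ℝ} (hf : ContDiff ℝ ∞ f)
    (hc : HasCompactSupport f) (v : Plane) :
    ∫ y in P.Ω, fderiv ℝ f y v = ∑ k, inner ℝ v (P.normal k) * ∫ y, f y ∂P.edgeMeasure k := by
  have hi : ∀ {f : Plane → ℝ}, ContDiff ℝ ∞ f →
      Integrable (fun y => fderiv ℝ f y v) (volume.restrict P.Ω) := fun hf =>
    P.compactlyCarried_volume.integrable (contDiff_fderiv_apply hf v).continuous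
  have hie : ∀ {f : Plane → ℝ}, Continuous f → ∀ k, Integrable f (P.edgeMeasure k) := fun hf k =>
    (P.compactlyCarried_edge k).integrable hf
  have hz : ∀ {f : Plane → ℝ} {k : Fin P.K}, (∀ x ∈ P.edge k, f x = 0) →
      ∫ y, f y ∂P.edgeMeasure k = 0 := fun {f k} h =>
    integral_eq_zero_of_ae ((P.ae_edge_mem k).mono h)
  rw [← sub_eq_zero]
  refine smooth_removable (L := fun f => (∫ y in P.Ω, fderiv ℝ f y v) -
    ∑ k, inner ℝ v (P.normal k) * ∫ y, f y ∂P.edgeMeasure k) P.finite_corners ?_ ?_ ?_ f hf hc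
  · intro f g hf hg _ _
    have e : ∀ y, fderiv ℝ (fun x => f x + g x) y v = fderiv ℝ f y v + fderiv ℝ g y v := fun y => by
      rw [fderiv_fun_add (differentiable_of_smooth hf y) (differentiable_of_smooth hg y)]; simp
    simp only [e]
    rw [integral_add (hi hf) (hi hg)]
    simp only [fun k => integral_add (hie hf.continuous k) (hie hg.continuous k), mul_add,
      Finset.sum_add_distrib]
    ring
  · intro x hx
    by_cases hxΩ : x ∈ P.Ω
    · refine ⟨P.Ω, P.isOpen.mem_nhds hxΩ, fun f hf hc hs => ?_⟩
      rw [P.integral_fderiv_of_tsupport_subset hf hc hs, zero_sub, neg_eq_zero]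
      refine Finset.sum_eq_zero fun k _ => ?_
      rw [hz, mul_zero]
      intro y hy
      exact image_eq_zero_of_notMem_tsupport fun h =>
        P.notMem_of_mem_seg (P.edge_subset_seg k hy) (hs h)
    by_cases hxc : x ∈ closure P.Ω
    · obtain ⟨k, hk⟩ := P.mem_frontier_iff.1 (⟨hxc, by rwa [P.isOpen.interior_eq]⟩ :
        x ∈ frontier P.Ω)
      have hxe : x ∈ P.edge k := by
        rcases P.seg_eq k hk with h | h | h
        · exact absurd (Or.inl ⟨k, h.symm⟩) hx
        · exact absurd (Or.inr ⟨k, h.symm⟩) hx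
        · exact h
      obtain ⟨ρ, hρ, hball, hseg, hline⟩ := P.exists_halfBall hxe
      refine ⟨Metric.ball x ρ, Metric.ball_mem_nhds x hρ, fun f hf hc hs => ?_⟩
      have h1 : ∫ y in P.Ω, fderiv ℝ f y v =
          ∫ y in {y | inner ℝ (y - x) (P.normal k) < 0}, fderiv ℝ f y v := by
        have hm : MeasurableSet {y : Plane | inner ℝ (y - x) (P.normal k) < 0} :=
          (isOpen_lt (by fun_prop) continuous_const).measurableSet
        rw [← integral_indicator P.isOpen.measurableSet, ← integral_indicator hm]
        congr 1
        ext y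
        by_cases hy : y ∈ Metric.ball x ρ
        · have := hball y hy
          by_cases hyΩ : y ∈ P.Ω
          · simp [indicator, hyΩ, this.1 hyΩ]
          · simp [indicator, hyΩ, mt this.2 hyΩ]
        · have h0 : fderiv ℝ f y v = 0 := image_eq_zero_of_notMem_tsupport
            (f := fun y => fderiv ℝ f y v)
            fun h => hy (hs (KirchhoffPlate.tsupport_fderiv_apply_subset f v h))
          simp [indicator, h0]
      rw [h1, P.integral_fderiv_halfPlane k x v hf hc, Finset.sum_eq_single k, sub_eq_zero]
      · obtain ⟨s₀, -, hxs⟩ := P.mem_edge_iff.1 hxe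
        rw [integral_edge]
        congr 1
        have e : ∀ s : ℝ, f (x + s • P.tangent k) = f (P.arc k (s₀ + s)) := fun s => by
          rw [arc, hxs, add_smul, add_assoc]
        simp only [e]
        rw [integral_add_left_eq_self (fun s => f (P.arc k s)) s₀]
        -- The support of f lies in the disc, and inside the disc the whole line belongs to the open
        -- edge.
        refine (setIntegral_eq_integral_of_forall_compl_eq_zero fun s hs' => ?_).symm
        by_contra hne
        have hb : P.arc k s ∈ Metric.ball x ρ := hs (subset_tsupport f hne)
        have e2 : P.arc k s = x + (s - s₀) • P.tangent k := by
          rw [arc, hxs, sub_smul]; abel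
        rw [e2] at hb
        have := hline _ hb
        rw [← e2] at this
        obtain ⟨t, ht, h⟩ := P.mem_edge_iff.1 this
        rw [(P.isometry_arc k).injective h] at hs'
        exact hs' ht
      · intro l _ hl
        rw [hz, mul_zero]
        intro y hy
        exact image_eq_zero_of_notMem_tsupport fun h =>
          hseg l hl y (hs h) (P.edge_subset_seg l hy)
      · simp
    · refine ⟨(closure P.Ω)ᶜ, isClosed_closure.isOpen_compl.mem_nhds hxc, fun f hf hc hs => ?_⟩
      have h1 : ∫ y in P.Ω, fderiv ℝ f y v = 0 := by
        refine integral_eq_zero_of_ae ((ae_restrict_mem P.isOpen.measurableSet).mono fun y hy => ?_)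
        exact image_eq_zero_of_notMem_tsupport (f := fun y => fderiv ℝ f y v) fun h =>
          hs (KirchhoffPlate.tsupport_fderiv_apply_subset f v h) (subset_closure hy)
      rw [h1, zero_sub, neg_eq_zero]
      refine Finset.sum_eq_zero fun k _ => ?_
      rw [hz, mul_zero]
      intro y hy
      exact image_eq_zero_of_notMem_tsupport fun h =>
        hs h (frontier_subset_closure (P.seg_subset_frontier k (P.edge_subset_seg k hy)))
  · intro x _ f hf hc
    have e : ∀ j y, fderiv ℝ (fun y => pointCutoff x j y * f y) y v =
        pointCutoff x j y * fderiv ℝ f y v +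
        (classicalPartial 0 (pointCutoff x j) y * (v 0 * f y) +
          classicalPartial 1 (pointCutoff x j) y * (v 1 * f y)) := fun j y => by
      rw [fderiv_fun_mul (differentiable_of_smooth (contDiff_pointCutoff x j) y)
        (differentiable_of_smooth hf y)]
      simp only [add_apply, smul_apply, smul_eq_mul]
      rw [fderiv_apply_eq (pointCutoff x j)]
      ring
    have hm : ∀ i : Fin 2, MemLp (fun y => v i * f y) 2 (volume.restrict P.Ω) := fun i =>
      P.compactlyCarried_volume.memLp (continuous_const.mul hf.continuous)
    have hcp : ∀ i j, MemLp (classicalPartial i (pointCutoff x j)) 2 (volume.restrict P.Ω) :=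
      fun i j => P.compactlyCarried_volume.memLp
        (contDiff_classicalPartial (contDiff_pointCutoff x j) i).continuous
    have t1 := tendsto_integral_pointCutoff_mul (x := x)
      (ae_restrict_of_ae (Measure.ae_ne volume x)) (hi hf)
    have t2 := fun i => tendsto_integral_classicalPartial_pointCutoff_mul x i (hm i)
    have t3 : Tendsto (fun j => ∑ k, inner ℝ v (P.normal k) *
        ∫ y, pointCutoff x j y * f y ∂P.edgeMeasure k) atTop
        (𝓝 (∑ k, inner ℝ v (P.normal k) * 0)) :=
      tendsto_finsetSum _ fun k _ =>
        (tendsto_integral_pointCutoff_mul (P.ae_edge_ne k x) (hie hf.continuous k)).const_mul _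
    have t4 := (t1.add ((t2 0).add (t2 1))).sub t3
    simp only [mul_zero, Finset.sum_const_zero, add_zero, sub_zero] at t4
    refine t4.congr fun j => ?_
    simp only [e]
    have i1 : Integrable (fun y => pointCutoff x j y * fderiv ℝ f y v) (volume.restrict P.Ω) :=
      P.compactlyCarried_volume.integrable
        ((contDiff_pointCutoff x j).continuous.mul (contDiff_fderiv_apply hf v).continuous)
    have i2 := fun i => (hcp i j).integrable_fun_mul (hm i)
    have i3 : Integrable (fun y => classicalPartial 0 (pointCutoff x j) y * (v 0 * f y) +
        classicalPartial 1 (pointCutoff x j) y * (v 1 * f y)) (volume.restrict P.Ω) :=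
      (i2 0).add (i2 1)
    rw [integral_add i1 i3, integral_add (i2 0) (i2 1)]

/-- A smooth function with compact support that is one near the closure of the domain. -/
theorem exists_cutoff : ∃ η : Plane → ℝ, ContDiff ℝ ∞ η ∧ HasCompactSupport η ∧
    ∀ x ∈ closure P.Ω, η =ᶠ[𝓝 x] fun _ => 1 := by
  obtain ⟨R, hR0, hR⟩ := P.isBounded.isCompact_closure.isBounded.subset_ball_lt 0 0
  let φ : ContDiffBump (0 : Plane) := ⟨R, R + 1, hR0, by linarith⟩
  refine ⟨φ, φ.contDiff, φ.hasCompactSupport, fun x hx => ?_⟩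
  exact φ.eventuallyEq_one_of_mem_ball (hR hx)

/-- **Gauss-Green formula** on a polygonal domain. -/
theorem gauss_green {f : Plane → ℝ} (hf : ContDiff ℝ ∞ f) (v : Plane) :
    ∫ y in P.Ω, fderiv ℝ f y v = ∑ k, inner ℝ v (P.normal k) * ∫ y, f y ∂P.edgeMeasure k := by
  obtain ⟨η, hη, hηc, hη1⟩ := P.exists_cutoff
  have h := P.gauss_green_of_hasCompactSupport (f := fun x => η x * f x) (hη.mul hf)
    hηc.mul_right v
  have heq : ∀ x ∈ closure P.Ω, (fun x => η x * f x) =ᶠ[𝓝 x] f := fun x hx => by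
    filter_upwards [hη1 x hx] with y hy
    rw [hy, one_mul]
  have e1 : ∫ y in P.Ω, fderiv ℝ (fun x => η x * f x) y v = ∫ y in P.Ω, fderiv ℝ f y v := by
    refine setIntegral_congr_fun P.isOpen.measurableSet fun y hy => ?_
    simp only [(heq y (subset_closure hy)).fderiv_eq]
  rw [← e1, h]
  refine Finset.sum_congr rfl fun k _ => ?_
  congr 1
  refine integral_congr_ae ((P.ae_edge_mem k).mono fun y hy => ?_)
  exact (heq y (frontier_subset_closure (P.seg_subset_frontier k
    (P.edge_subset_seg k hy)))).eq_of_nhds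

/-- Integration by parts for smooth functions. -/
theorem integral_by_parts {f g : Plane → ℝ} (hf : ContDiff ℝ ∞ f) (hg : ContDiff ℝ ∞ g) (i : Fin 2) :
    ∫ y in P.Ω, (f y * classicalPartial i g y + classicalPartial i f y * g y) =
      ∑ k, P.normal k i * ∫ y, f y * g y ∂P.edgeMeasure k := by
  have h := P.gauss_green (hf.mul hg) (basisVec i)
  have e : ∀ y, fderiv ℝ (fun x => f x * g x) y (basisVec i) =
      f y * classicalPartial i g y + classicalPartial i f y * g y := fun y =>
    classicalPartial_mul hf hg i y
  simp only [e] at h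
  rw [h]
  refine Finset.sum_congr rfl fun k _ => ?_
  rw [EuclideanSpace.inner_single_left]
  simp

end Plate
-- Mollification of a function extended by zero.
theorem TendstoL2.restrict {a : ℕ → Plane → ℝ} {b : Plane → ℝ} (h : TendstoL2 volume a b)
    (Ω : Set Plane) : TendstoL2 (volume.restrict Ω) a b :=
  ⟨fun m => (h.memLp m).restrict Ω, h.memLp_lim.restrict Ω,
    tendsto_of_tendsto_of_tendsto_of_le_of_le tendsto_const_nhds h.tendsto (fun _ => zero_le)
      fun _ => eLpNorm_restrict_le _ _ _ _⟩

theorem eLpNorm_two_eq_sqrt {α : Type*} [MeasurableSpace α] {μ : Measure α} {f : α → ℝ}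
    (hf : MemLp f 2 μ) : eLpNorm f 2 μ = ENNReal.ofReal (√(∫ x, f x ^ 2 ∂μ)) := by
  rw [hf.eLpNorm_eq_integral_rpow_norm (by norm_num) (by norm_num)]
  simp [Real.sqrt_eq_rpow]

/-- The extension by zero need not have weak derivatives across Γ, but at the point y only z ↦ k(y -
z) f(z) matters. The condition on y makes this a test function in Ω, for which the weak derivative
may be used. -/
theorem IsMollifier.classicalPartial_mollify_indicator {Ω : Set Plane} (hΩ : MeasurableSet Ω)
    {k : Plane → ℝ}
    (hk : IsMollifier k) {u g f : Plane → ℝ} {i : Fin 2} (hu : MemLp u 2 (volume.restrict Ω))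
    (hg : IsWeakPartial Ω i u g) (hf : ContDiff ℝ ∞ f) (hc : HasCompactSupport f)
    (hF : LocallyIntegrable (Ω.indicator fun z => f z * u z) volume)
    {y : Plane} (hy : ∀ z ∈ tsupport f, y - z ∈ tsupport k → z ∈ Ω) :
    classicalPartial i (mollify k (Ω.indicator fun z => f z * u z)) y =
      mollify k (Ω.indicator fun z => f z * g z + classicalPartial i f z * u z) y := by
  rw [hk.classicalPartial_mollify hF, mollify_apply']
  have hind : ∀ a b : Plane → ℝ, ∫ z, a z * Ω.indicator b z = ∫ z in Ω, a z * b z := fun a b => by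
    rw [← integral_indicator hΩ]
    congr 1
    ext z
    by_cases hz : z ∈ Ω <;> simp [hz]
  rw [hind, hind]
  have hky : ContDiff ℝ ∞ fun z => k (y - z) := hk.smooth.comp (contDiff_const.sub contDiff_id)
  set ζ : Plane → ℝ := fun z => k (y - z) * f z with hζ
  have hζs : ContDiff ℝ ∞ ζ := hky.mul hf
  have hts : tsupport ζ ⊆ Ω := by
    intro z hz
    refine hy z (tsupport_mul_subset_right hz) ?_
    have h1 : z ∈ tsupport fun z => k (y - z) := tsupport_mul_subset_left hz
    exact tsupport_comp_subset_preimage k (continuous_sub_left y) h1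
  have hd : ∀ z, classicalPartial i ζ z =
      k (y - z) * classicalPartial i f z - classicalPartial i k (y - z) * f z := by
    intro z
    rw [hζ, classicalPartial_mul hky hf]
    have h1 : HasFDerivAt (fun z => k (y - z)) (fderiv ℝ k (y - z) ∘L (-ContinuousLinearMap.id ℝ Plane)) z :=
      (differentiable_of_smooth hk.smooth (y - z)).hasFDerivAt.comp z
        ((hasFDerivAt_id z).const_sub y)
    have : classicalPartial i (fun z => k (y - z)) z = -classicalPartial i k (y - z) := by
      rw [classicalPartial, h1.fderiv]; simp [classicalPartial]
    rw [this]; ring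
  have hw := hg.2 ζ hζs hc.mul_left hts
  have hcc : ∀ {a : Plane → ℝ}, Continuous a → HasCompactSupport a → MemLp a 2 (volume.restrict Ω) :=
    fun h1 h2 => (h1.memLp_of_hasCompactSupport h2).restrict Ω
  have hdf := contDiff_classicalPartial hf i
  have hdfc : HasCompactSupport (classicalPartial i f) :=
    hc.mono' ((subset_tsupport _).trans (tsupport_fderiv_apply_subset f _))
  have m1 : MemLp (fun z => k (y - z) * classicalPartial i f z) 2 (volume.restrict Ω) :=
    hcc (hky.continuous.mul hdf.continuous) hdfc.mul_left
  have m2 : MemLp (fun z => classicalPartial i k (y - z) * f z) 2 (volume.restrict Ω) :=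
    hcc (((contDiff_classicalPartial hk.smooth i).continuous.comp (continuous_sub_left y)).mul
      hf.continuous) hc.mul_left
  have m3 : MemLp ζ 2 (volume.restrict Ω) := hcc hζs.continuous hc.mul_left
  have e1 : ∫ z in Ω, u z * classicalPartial i ζ z =
      (∫ z in Ω, k (y - z) * classicalPartial i f z * u z) -
        ∫ z in Ω, classicalPartial i k (y - z) * f z * u z := by
    rw [← integral_sub (m1.integrable_fun_mul hu) (m2.integrable_fun_mul hu)]
    congr 1; ext z; rw [hd]; ring
  have e2 : ∫ z in Ω, k (y - z) * (f z * g z + classicalPartial i f z * u z) =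
      (∫ z in Ω, g z * ζ z) + ∫ z in Ω, k (y - z) * classicalPartial i f z * u z := by
    rw [← integral_add (hg.1.integrable_fun_mul m3) (m1.integrable_fun_mul hu)]
    congr 1; ext z; rw [hζ]; ring
  rw [e1] at hw
  rw [e2]
  have e3 : ∫ z in Ω, classicalPartial i k (y - z) * (f z * u z) =
      ∫ z in Ω, classicalPartial i k (y - z) * f z * u z := by
    congr 1; ext z; ring
  rw [e3]; linarith

namespace Plate

variable (P : Plate)

/-! ### Density of smooth functions -/

/-- The kernels are centred at s d, not at the origin. The mollification at y in Ω then only sees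
points y - s(d + w), which lie in Ω by the cone property, so smoothing and weak differentiation
commute up to the boundary. -/
theorem exists_smooth_approx_local (x : Plane) {u : Plane → ℝ} {du : Fin 2 → Plane → ℝ}
    (hu : MemLp u 2 (volume.restrict P.Ω)) (hdu : ∀ i, IsWeakPartial P.Ω i u (du i)) :
    ∃ V ∈ 𝓝 x, ∀ f, ContDiff ℝ ∞ f → HasCompactSupport f → tsupport f ⊆ V →
      ∃ φ : ℕ → Plane → ℝ, (∀ m, ContDiff ℝ ∞ (φ m)) ∧
        TendstoL2 (volume.restrict P.Ω) φ (fun y => f y * u y) ∧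
        ∀ i, TendstoL2 (volume.restrict P.Ω) (fun m => classicalPartial i (φ m))
          (fun y => f y * du i y + classicalPartial i f y * u y) := by
  obtain ⟨d, δ, ρ, hcone⟩ := P.exists_isCone x
  have hδ := hcone.δ_pos
  have hρ := hcone.ρ_pos
  have hΩ := P.isOpen.measurableSet
  refine ⟨Metric.ball x (ρ / 2), Metric.ball_mem_nhds x (by positivity), fun f hf hc hs => ?_⟩
  -- The shift tends to zero, and the factor in front keeps the supports of the kernels within ρ/2
  -- of the origin. Since f is supported within ρ/2 of x, all relevant points stay in the disc where
  -- the cone property holds.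
  set s : ℕ → ℝ := fun m => ρ / (2 * (‖d‖ + δ)) * (1 / ((m : ℝ) + 1)) with hs_def
  have hs0 : ∀ m, 0 < s m := fun m => by positivity
  choose k hk hks using fun m => exists_isMollifier (s m • d) (r := s m * (δ / 2))
    (by have := hs0 m; positivity)
  have hform : ∀ m, ∀ z ∈ tsupport (k m), ∃ w : Plane, ‖w‖ < δ ∧ z = s m • (d + w) := by
    intro m z hz
    have h1 := hks m hz
    rw [mem_closedBall_iff_norm] at h1
    refine ⟨(s m)⁻¹ • (z - s m • d), ?_, ?_⟩
    · rw [norm_smul, norm_inv, Real.norm_of_nonneg (hs0 m).le, inv_mul_lt_iff₀ (hs0 m)]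
      have := mul_pos (hs0 m) hδ
      linarith
    · rw [smul_add, smul_smul, mul_inv_cancel₀ (hs0 m).ne', one_smul]; abel
  have hnorm : ∀ m, ∀ z ∈ tsupport (k m), ‖z‖ < s m * (‖d‖ + δ) := by
    intro m z hz
    obtain ⟨w, hw, rfl⟩ := hform m z hz
    rw [norm_smul, Real.norm_of_nonneg (hs0 m).le]
    exact mul_lt_mul_of_pos_left ((norm_add_le _ _).trans_lt (by linarith)) (hs0 m)
  have hsle : ∀ m, s m * (‖d‖ + δ) ≤ ρ / 2 := by
    intro m
    have h2 : 1 / ((m : ℝ) + 1) ≤ 1 := by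
      rw [div_le_one (by positivity)]; linarith [(Nat.cast_nonneg m : (0 : ℝ) ≤ m)]
    calc s m * (‖d‖ + δ) = ρ / 2 * (1 / ((m : ℝ) + 1)) := by rw [hs_def]; field_simp
      _ ≤ ρ / 2 * 1 := by gcongr
      _ = ρ / 2 := mul_one _
  have hr : Tendsto (fun m => s m * (‖d‖ + δ)) atTop (𝓝 0) := by
    have := (tendsto_one_div_add_atTop_nhds_zero_nat (𝕜 := ℝ)).const_mul (ρ / (2 * (‖d‖ + δ)))
    simpa [hs_def] using this.mul_const (‖d‖ + δ)
  have hks' : ∀ m z, k m z ≠ 0 → ‖z‖ < s m * (‖d‖ + δ) := fun m z hz =>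
    hnorm m z (subset_tsupport _ hz)
  have hmul : ∀ {a b : Plane → ℝ}, Continuous a → MemLp b 2 (volume.restrict P.Ω) →
      MemLp (fun z => a z * b z) 2 (volume.restrict P.Ω) := fun {a b} ha hb => by
    obtain ⟨C, -, hC⟩ := P.compactlyCarried_volume.exists_bound ha
    exact hb.bdd_mul_of_le ha.aestronglyMeasurable hC
  have hF : MemLp (P.Ω.indicator fun z => f z * u z) 2 volume :=
    (memLp_indicator_iff_restrict hΩ).2 (hmul hf.continuous hu)
  have hG : ∀ i, MemLp (P.Ω.indicator fun z => f z * du i z + classicalPartial i f z * u z) 2 volume :=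
    fun i => (memLp_indicator_iff_restrict hΩ).2 ((hmul hf.continuous (hdu i).1).add
      (hmul (contDiff_classicalPartial hf i).continuous hu))
  have hFl := hF.locallyIntegrable (by norm_num)
  refine ⟨fun m => mollify (k m) (P.Ω.indicator fun z => f z * u z),
    fun m => (hk m).contDiff_mollify hFl, ?_, fun i => ?_⟩
  · refine ((tendsto_mollify hF hk hr hks').restrict P.Ω).congr ?_
    filter_upwards [ae_restrict_mem hΩ] with y hy
    rw [indicator_of_mem hy]
  · refine (((tendsto_mollify (hG i) hk hr hks').restrict P.Ω).congr ?_).congr_left fun m => ?_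
    · filter_upwards [ae_restrict_mem hΩ] with y hy
      rw [indicator_of_mem hy]
    · filter_upwards [ae_restrict_mem hΩ] with y hy
      refine ((hk m).classicalPartial_mollify_indicator hΩ hu (hdu i) hf hc hFl ?_).symm
      intro z hz hyz
      have hzx := hs hz
      obtain ⟨w, hw, hzw⟩ := hform m _ hyz
      have hn := hnorm m _ hyz
      have e : z = y - s m • (d + w) := by rw [← hzw]; abel
      have hzρ : z ∈ Metric.ball x ρ := Metric.ball_subset_ball (by linarith) hzx
      have hyρ : y ∈ Metric.ball x ρ := by
        rw [mem_ball_iff_norm] at hzx ⊢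
        calc ‖y - x‖ = ‖(y - z) + (z - x)‖ := by congr 1; abel
          _ ≤ ‖y - z‖ + ‖z - x‖ := norm_add_le _ _
          _ < ρ := by linarith [hsle m]
      rw [e] at hzρ ⊢
      exact hcone.mem y hyρ w hw _ (hs0 m).le hzρ hy

theorem exists_smooth_approx {u : Plane → ℝ} (hu : MemH1 P.Ω u) :
    ∃ φ : ℕ → Plane → ℝ, (∀ m, ContDiff ℝ ∞ (φ m)) ∧ TendstoL2 (volume.restrict P.Ω) φ u ∧
      ∀ i, TendstoL2 (volume.restrict P.Ω) (fun m => classicalPartial i (φ m))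
        (weakPartial P.Ω i u) := by
  have hdu := hu.isWeakPartial
  obtain ⟨η, hη, hηc, hη1⟩ := P.exists_cutoff
  have key := smooth_localization (U := univ) (Q := fun f => ∃ φ : ℕ → Plane → ℝ,
    (∀ m, ContDiff ℝ ∞ (φ m)) ∧ TendstoL2 (volume.restrict P.Ω) φ (fun y => f y * u y) ∧
      ∀ i, TendstoL2 (volume.restrict P.Ω) (fun m => classicalPartial i (φ m))
        (fun y => f y * weakPartial P.Ω i u y + classicalPartial i f y * u y)) ?_ ?_
    (fun x _ => P.exists_smooth_approx_local x hu.1 hdu) η hη hηc (subset_univ _)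
  · obtain ⟨φ, h1, h2, h3⟩ := key
    refine ⟨φ, h1, h2.congr ?_, fun i => (h3 i).congr ?_⟩
    · filter_upwards [ae_restrict_mem P.isOpen.measurableSet] with y hy
      rw [(hη1 y (subset_closure hy)).eq_of_nhds, one_mul]
    · filter_upwards [ae_restrict_mem P.isOpen.measurableSet] with y hy
      have h0 : classicalPartial i η y = 0 := by
        rw [classicalPartial, (hη1 y (subset_closure hy)).fderiv_eq]; simp
      rw [(hη1 y (subset_closure hy)).eq_of_nhds, h0]; ring
  · refine ⟨fun _ _ => 0, fun _ => contDiff_const, ?_, fun i => ?_⟩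
    · simpa using tendstoL2_const (MemLp.zero' (μ := volume.restrict P.Ω) (p := 2) (ε := ℝ))
    · have : classicalPartial i (fun _ : Plane => (0 : ℝ)) = fun _ => 0 := by
        ext y; simp [classicalPartial]
      simp only [this]
      simpa using tendstoL2_const (MemLp.zero' (μ := volume.restrict P.Ω) (p := 2) (ε := ℝ))
  · rintro f g hf hg - - ⟨φ, h1, h2, h3⟩ ⟨φ', h1', h2', h3'⟩
    refine ⟨fun m y => φ m y + φ' m y, fun m => (h1 m).add (h1' m), (h2.add h2').congr ?_,
      fun i => (((h3 i).add (h3' i)).congr ?_).congr_left fun m => ?_⟩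
    · exact .of_forall fun y => by ring
    · exact .of_forall fun y => by
        simp only [classicalPartial_add hf hg]; ring
    · exact .of_forall fun y => (classicalPartial_add (h1 m) (h1' m) i y).symm

/-! ### The trace inequality -/

/-- Near each point a large multiple of the cone direction works for all edges through that point.
The requirement is convex in the value of the field, so a partition of unity glues these constants.
-/
theorem exists_transversal : ∃ X : Fin 2 → Plane → ℝ, (∀ i, ContDiff ℝ ∞ (X i)) ∧
    ∀ k, ∀ x ∈ P.seg k, 1 ≤ P.normal k 0 * X 0 x + P.normal k 1 * X 1 x := by
  set t : Plane → Set Plane := fun y => {v | ∀ k, y ∈ P.seg k → 1 ≤ inner ℝ v (P.normal k)}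
  have ht : ∀ y, Convex ℝ (t y) := by
    intro y v hv w hw a b ha hb hab k hk
    have h1 := hv k hk
    have h2 := hw k hk
    rw [inner_add_left, real_inner_smul_left, real_inner_smul_left]
    nlinarith
  have hloc : ∀ x, ∃ c : Plane, ∀ᶠ y in 𝓝 x, c ∈ t y := by
    intro x
    obtain ⟨d, δ, ρ, hcone⟩ := P.exists_isCone x
    obtain ⟨ρ', hρ', hdis⟩ := P.exists_ball_disjoint_segs x
    -- The sum dominates each of the inverses of ⟨d, n_k⟩ for edges through x; the other terms are
    -- nonnegative and harmless.
    refine ⟨(∑ k, |(inner ℝ d (P.normal k))⁻¹|) • d, ?_⟩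
    filter_upwards [Metric.ball_mem_nhds x hρ'] with y hy k hk
    have hxk : x ∈ P.seg k := by
      by_contra h
      exact hdis k h y hy hk
    have hpos := hcone.inner_normal_pos hxk
    rw [real_inner_smul_left]
    have h1 : |(inner ℝ d (P.normal k))⁻¹| ≤ ∑ k, |(inner ℝ d (P.normal k))⁻¹| :=
      Finset.single_le_sum (f := fun k => |(inner ℝ d (P.normal k))⁻¹|)
        (fun _ _ => abs_nonneg _) (Finset.mem_univ k)
    rw [abs_of_pos (inv_pos.2 hpos)] at h1
    calc (1 : ℝ) = (inner ℝ d (P.normal k))⁻¹ * inner ℝ d (P.normal k) :=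
          (inv_mul_cancel₀ hpos.ne').symm
      _ ≤ _ := mul_le_mul_of_nonneg_right h1 hpos.le
  obtain ⟨g, hg⟩ := exists_contMDiffMap_forall_mem_convex_of_local_const (n := ⊤)
    (modelWithCornersSelf ℝ Plane) ht hloc
  have hgs : ContDiff ℝ ∞ g := g.contMDiff.contDiff
  refine ⟨fun i x => g x i, fun i => (contDiff_euclidean.1 hgs) i, fun k x hx => ?_⟩
  have := hg x k hx
  rw [inner_plane] at this
  linarith

theorem integral_boundary {f : Plane → ℝ} (hf : ∀ k, Integrable f (P.edgeMeasure k)) :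
    ∫ y, f y ∂P.boundaryMeasure = ∑ k, ∫ y, f y ∂P.edgeMeasure k := by
  rw [boundaryMeasure, integral_finsetSum_measure fun k _ => hf k]

/-- Gauss-Green for φ² X, with X transversal to Γ: the boundary integral dominates that of φ², and
Young's inequality bounds the term 2φ ∇φ · X in the interior. -/
theorem exists_trace_bound : ∃ C : ℝ, 0 ≤ C ∧ ∀ φ : Plane → ℝ, ContDiff ℝ ∞ φ →
    ∫ y, φ y ^ 2 ∂P.boundaryMeasure ≤ C * ((∫ y in P.Ω, φ y ^ 2) +
      ((∫ y in P.Ω, classicalPartial 0 φ y ^ 2) + ∫ y in P.Ω, classicalPartial 1 φ y ^ 2)) := by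
  obtain ⟨X, hX, hXn⟩ := P.exists_transversal
  choose A hA0 hA using fun i => P.compactlyCarried_volume.exists_bound (hX i).continuous
  choose B hB0 hB using fun i => P.compactlyCarried_volume.exists_bound
    (contDiff_classicalPartial (hX i) i).continuous
  refine ⟨A 0 + A 1 + B 0 + B 1, by linarith [hA0 0, hA0 1, hB0 0, hB0 1], fun φ hφ => ?_⟩
  have hφ2 : ContDiff ℝ ∞ fun y => φ y ^ 2 := hφ.pow 2
  have hdφ := fun i => contDiff_classicalPartial hφ i
  have hcE : ∀ {f : Plane → ℝ}, Continuous f → ∀ k, Integrable f (P.edgeMeasure k) := fun hf k =>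
    (P.compactlyCarried_edge k).integrable hf
  have hcV : ∀ {f : Plane → ℝ}, Continuous f → Integrable f (volume.restrict P.Ω) := fun hf =>
    P.compactlyCarried_volume.integrable hf
  have hibp := fun i => P.integral_by_parts hφ2 (hX i) i
  have hd2 : ∀ i y, classicalPartial i (fun y => φ y ^ 2) y = 2 * φ y * classicalPartial i φ y := by
    intro i y
    have := classicalPartial_mul hφ hφ i y
    simp only [pow_two]
    rw [this]; ring
  have step1 : ∫ y, φ y ^ 2 ∂P.boundaryMeasure ≤
      ∑ k, (P.normal k 0 * (∫ y, φ y ^ 2 * X 0 y ∂P.edgeMeasure k) +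
        P.normal k 1 * ∫ y, φ y ^ 2 * X 1 y ∂P.edgeMeasure k) := by
    rw [P.integral_boundary (hcE hφ2.continuous)]
    refine Finset.sum_le_sum fun k _ => ?_
    have hi : ∀ i, Integrable (fun y => P.normal k i * (φ y ^ 2 * X i y)) (P.edgeMeasure k) :=
      fun i => (hcE (hφ2.continuous.mul (hX i).continuous) k).const_mul _
    rw [← integral_const_mul, ← integral_const_mul, ← integral_add (hi 0) (hi 1)]
    refine integral_mono_ae (hcE hφ2.continuous k) ((hi 0).add (hi 1)) ?_
    filter_upwards [P.ae_edge_mem k] with y hy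
    have := hXn k y (P.edge_subset_seg k hy)
    nlinarith [sq_nonneg (φ y)]
  have step2 : ∀ i, ∑ k, P.normal k i * ∫ y, φ y ^ 2 * X i y ∂P.edgeMeasure k ≤
      (A i + B i) * (∫ y in P.Ω, φ y ^ 2) + A i * ∫ y in P.Ω, classicalPartial i φ y ^ 2 := by
    intro i
    have hi1 : Integrable (fun y => (A i + B i) * φ y ^ 2) (volume.restrict P.Ω) :=
      (hcV hφ2.continuous).const_mul _
    have hi2 : Integrable (fun y => A i * classicalPartial i φ y ^ 2) (volume.restrict P.Ω) :=
      (hcV ((hdφ i).continuous.pow 2)).const_mul _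
    rw [← hibp i, ← integral_const_mul, ← integral_const_mul, ← integral_add hi1 hi2]
    refine integral_mono_ae (hcV ?_) (hi1.add hi2) ?_
    · exact (hφ2.continuous.mul (contDiff_classicalPartial (hX i) i).continuous).add
        ((contDiff_classicalPartial hφ2 i).continuous.mul (hX i).continuous)
    filter_upwards [hA i, hB i] with y h1 h2
    rw [hd2]
    have h3 : φ y ^ 2 * classicalPartial i (X i) y ≤ B i * φ y ^ 2 := by
      nlinarith [sq_nonneg (φ y), le_abs_self (classicalPartial i (X i) y)]
    have h4 : 2 * φ y * classicalPartial i φ y * X i y ≤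
        (φ y ^ 2 + classicalPartial i φ y ^ 2) * |X i y| := by
      rcases abs_cases (X i y) with ⟨h, h'⟩ | ⟨h, h'⟩ <;> rw [h]
      · nlinarith [mul_nonneg h' (sq_nonneg (φ y - classicalPartial i φ y))]
      · nlinarith [mul_nonneg (neg_nonneg.2 h'.le) (sq_nonneg (φ y + classicalPartial i φ y))]
    have h5 : (φ y ^ 2 + classicalPartial i φ y ^ 2) * |X i y| ≤
        (φ y ^ 2 + classicalPartial i φ y ^ 2) * A i :=
      mul_le_mul_of_nonneg_left h1 (by positivity)
    linarith
  rw [Finset.sum_add_distrib] at step1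
  have n1 : 0 ≤ ∫ y in P.Ω, φ y ^ 2 := integral_nonneg fun y => sq_nonneg _
  have n2 : ∀ i, 0 ≤ ∫ y in P.Ω, classicalPartial i φ y ^ 2 := fun i =>
    integral_nonneg fun y => sq_nonneg _
  have s0 := step2 0
  have s1 := step2 1
  nlinarith [mul_nonneg (hA0 0) (n2 1), mul_nonneg (hA0 1) (n2 0), mul_nonneg (hB0 0) (n2 0),
    mul_nonneg (hB0 0) (n2 1), mul_nonneg (hB0 1) (n2 0), mul_nonneg (hB0 1) (n2 1)]

theorem exists_trace_bound_eLpNorm : ∃ C : ℝ, ∀ φ : Plane → ℝ, ContDiff ℝ ∞ φ →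
    eLpNorm φ 2 P.boundaryMeasure ≤ ENNReal.ofReal C * (eLpNorm φ 2 (volume.restrict P.Ω) +
      (eLpNorm (classicalPartial 0 φ) 2 (volume.restrict P.Ω) +
        eLpNorm (classicalPartial 1 φ) 2 (volume.restrict P.Ω))) := by
  obtain ⟨C, hC0, hC⟩ := P.exists_trace_bound
  refine ⟨√C, fun φ hφ => ?_⟩
  have hV : ∀ {f : Plane → ℝ}, Continuous f → MemLp f 2 (volume.restrict P.Ω) := fun hf =>
    P.compactlyCarried_volume.memLp hf
  rw [eLpNorm_two_eq_sqrt (P.compactlyCarried_boundary.memLp hφ.continuous),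
    eLpNorm_two_eq_sqrt (hV hφ.continuous),
    eLpNorm_two_eq_sqrt (hV (contDiff_classicalPartial hφ 0).continuous),
    eLpNorm_two_eq_sqrt (hV (contDiff_classicalPartial hφ 1).continuous),
    ← ENNReal.ofReal_add (by positivity) (by positivity),
    ← ENNReal.ofReal_add (by positivity) (by positivity), ← ENNReal.ofReal_mul (by positivity)]
  refine ENNReal.ofReal_le_ofReal ?_
  refine (Real.sqrt_le_sqrt (hC φ hφ)).trans ?_
  rw [Real.sqrt_mul hC0]
  refine mul_le_mul_of_nonneg_left ?_ (Real.sqrt_nonneg _)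
  have n1 : 0 ≤ ∫ y in P.Ω, φ y ^ 2 := integral_nonneg fun y => sq_nonneg _
  have n2 : ∀ i, 0 ≤ ∫ y in P.Ω, classicalPartial i φ y ^ 2 := fun i =>
    integral_nonneg fun y => sq_nonneg _
  have hsq : ∀ {a b : ℝ}, 0 ≤ a → 0 ≤ b → √(a + b) ≤ √a + √b := fun {a b} ha hb => by
    rw [Real.sqrt_le_left (by positivity)]
    nlinarith [Real.sq_sqrt ha, Real.sq_sqrt hb, mul_nonneg (Real.sqrt_nonneg a) (Real.sqrt_nonneg b)]
  exact (hsq n1 (add_nonneg (n2 0) (n2 1))).trans (by gcongr; exact hsq (n2 0) (n2 1))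

end Plate
-- Products and compositions under convergence in L².
section

variable {α : Type*} [MeasurableSpace α] {μ : Measure α}

theorem tendstoL2_zero_iff {a : ℕ → α → ℝ} (ha : ∀ m, MemLp (a m) 2 μ) :
    TendstoL2 μ a (fun _ => 0) ↔ Tendsto (fun m => eLpNorm (a m) 2 μ) atTop (𝓝 0) := by
  have e : ∀ m, a m - (fun _ => (0 : ℝ)) = a m := fun m => by ext; simp
  constructor
  · intro h
    simpa only [e] using h.tendsto
  · intro h
    exact ⟨ha, MemLp.zero', by simpa only [e] using h⟩

/-- The product is split as c(a - b) + cb. The first part is small by boundedness of c alone, the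
second converges by dominated convergence. -/
theorem TendstoL2.mul_of_tendsto_ae {a c : ℕ → α → ℝ} {b d : α → ℝ} {C : ℝ} (h : TendstoL2 μ a b)
    (hc : ∀ m, AEStronglyMeasurable (c m) μ) (hC : ∀ m, ∀ᵐ x ∂μ, |c m x| ≤ C)
    (hd : ∀ᵐ x ∂μ, Tendsto (fun m => c m x) atTop (𝓝 (d x))) :
    TendstoL2 μ (fun m x => c m x * a m x) (fun x => d x * b x) := by
  have h1 := tendstoL2_bdd_mul_of_tendsto_ae h.memLp_lim hc hC hd
  have h2 : TendstoL2 μ (fun m x => c m x * (a m x - b x)) (fun _ => 0) :=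
    (tendstoL2_zero_iff fun m => ((h.memLp m).sub h.memLp_lim).bdd_mul_of_le (hc m) (hC m)).2
      (h.bdd_mul_seq hC)
  refine ((h1.add h2).congr (.of_forall fun x => by ring)).congr_left fun m => .of_forall fun x => by
    ring

/-- Square integrability of the compositions is a hypothesis because F need not vanish at the origin
and the measure need not be finite. -/
theorem TendstoL2.lipschitz_comp {a a' : ℕ → α → ℝ} {b b' : α → ℝ} (h : TendstoL2 μ a b)
    (h' : TendstoL2 μ a' b') {F : ℝ × ℝ → ℝ} (hF : Continuous F) {C : ℝ}
    (hL : ∀ z z', |F z - F z'| ≤ C * (|z.1 - z'.1| + |z.2 - z'.2|))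
    (hm : ∀ m, MemLp (fun x => F (a m x, a' m x)) 2 μ) :
    TendstoL2 μ (fun m x => F (a m x, a' m x)) (fun x => F (b x, b' x)) := by
  have hmeas : AEStronglyMeasurable (fun x => F (b x, b' x)) μ :=
    hF.comp_aestronglyMeasurable (h.memLp_lim.1.prodMk h'.memLp_lim.1)
  have hbd : ∀ m, MemLp (fun x => C * (|a m x - b x| + |a' m x - b' x|)) 2 μ := fun m =>
    (((h.memLp m).sub h.memLp_lim).abs.add ((h'.memLp m).sub h'.memLp_lim).abs).const_mul C
  have hdiff : ∀ m, MemLp (fun x => F (a m x, a' m x) - F (b x, b' x)) 2 μ := fun m =>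
    (hbd m).of_le ((hm m).1.sub hmeas) (.of_forall fun x =>
      (hL (a m x, a' m x) (b x, b' x)).trans (le_abs_self _))
  refine ⟨hm, ?_, ?_⟩
  · refine ((hm 0).sub (hdiff 0)).ae_eq (.of_forall fun x => ?_)
    simp only [Pi.sub_apply]; ring
  · have h0 : Tendsto (fun m => ENNReal.ofReal C * (eLpNorm (a m - b) 2 μ + eLpNorm (a' m - b') 2 μ))
        atTop (𝓝 0) := tendsto_ofReal_mul_zero (by simpa using h.tendsto.add h'.tendsto)
    refine tendsto_of_tendsto_of_tendsto_of_le_of_le tendsto_const_nhds h0 (fun _ => zero_le)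
      fun m => ?_
    have h1 : eLpNorm (fun x => |a m x - b x| + |a' m x - b' x|) 2 μ ≤
        eLpNorm (a m - b) 2 μ + eLpNorm (a' m - b') 2 μ := by
      refine (eLpNorm_add_le ((h.memLp m).sub h.memLp_lim).abs.1
        ((h'.memLp m).sub h'.memLp_lim).abs.1 (by norm_num)).trans (le_of_eq ?_)
      congr 1
      · exact eLpNorm_norm (a m - b)
      · exact eLpNorm_norm (a' m - b')
    refine le_trans ?_ (mul_le_mul_right h1 _)
    refine eLpNorm_le_mul_eLpNorm_of_ae_le_mul (.of_forall fun x => ?_) 2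
    rw [Real.norm_of_nonneg (by positivity : 0 ≤ |a m x - b x| + |a' m x - b' x|)]
    exact hL (a m x, a' m x) (b x, b' x)

end

namespace Plate

variable (P : Plate)

/-! ### Functions with partial derivatives and trace obtained as limits of smooth functions -/

/-- `u` is the limit in `L²(Ω)` of smooth functions whose partial derivatives converge to `du`
in `L²(Ω)` and whose boundary values converge to `g` in `L²(Γ)`. -/
def HasTraceWith (u : Plane → ℝ) (du : Fin 2 → Plane → ℝ) (g : Plane → ℝ) : Prop :=
  ∃ φ : ℕ → Plane → ℝ, (∀ m, ContDiff ℝ ∞ (φ m)) ∧ TendstoL2 (volume.restrict P.Ω) φ u ∧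
    (∀ i, TendstoL2 (volume.restrict P.Ω) (fun m => classicalPartial i (φ m)) (du i)) ∧
    TendstoL2 P.boundaryMeasure φ g

theorem memLp_volume {f : Plane → ℝ} (hf : ContDiff ℝ ∞ f) : MemLp f 2 (volume.restrict P.Ω) :=
  P.compactlyCarried_volume.memLp hf.continuous

theorem memLp_boundary {f : Plane → ℝ} (hf : ContDiff ℝ ∞ f) : MemLp f 2 P.boundaryMeasure :=
  P.compactlyCarried_boundary.memLp hf.continuous

/-- By the trace inequality, the boundary values of smooth approximations form a Cauchy sequence in
L²(Γ); their limit is the trace. -/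
theorem exists_hasTraceWith {u : Plane → ℝ} (hu : MemH1 P.Ω u) :
    ∃ g, P.HasTraceWith u (fun i => weakPartial P.Ω i u) g := by
  obtain ⟨φ, hφ, h1, h2⟩ := P.exists_smooth_approx hu
  obtain ⟨C, hC⟩ := P.exists_trace_bound_eLpNorm
  have hb : ∀ m, MemLp (φ m) 2 P.boundaryMeasure := fun m => P.memLp_boundary (hφ m)
  set e : ℕ → ℝ≥0∞ := fun m => eLpNorm (φ m - u) 2 (volume.restrict P.Ω) +
    (eLpNorm (classicalPartial 0 (φ m) - weakPartial P.Ω 0 u) 2 (volume.restrict P.Ω) +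
      eLpNorm (classicalPartial 1 (φ m) - weakPartial P.Ω 1 u) 2 (volume.restrict P.Ω)) with he
  have he0 : Tendsto e atTop (𝓝 0) := by
    simpa using h1.tendsto.add ((h2 0).tendsto.add (h2 1).tendsto)
  have htri : ∀ {a : ℕ → Plane → ℝ} {b : Plane → ℝ}, TendstoL2 (volume.restrict P.Ω) a b →
      ∀ m n, eLpNorm (a m - a n) 2 (volume.restrict P.Ω) ≤
        eLpNorm (a m - b) 2 (volume.restrict P.Ω) + eLpNorm (a n - b) 2 (volume.restrict P.Ω) := by
    intro a b h m n
    have : a m - a n = (a m - b) - (a n - b) := by abel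
    rw [this]
    exact eLpNorm_sub_le ((h.memLp m).sub h.memLp_lim).1 ((h.memLp n).sub h.memLp_lim).1 (by norm_num)
  have hdist : ∀ m n, eLpNorm (φ m - φ n) 2 P.boundaryMeasure ≤ ENNReal.ofReal C * (e m + e n) := by
    intro m n
    refine (hC (φ m - φ n) ((hφ m).sub (hφ n))).trans (mul_le_mul_right ?_ _)
    have hd : ∀ i, classicalPartial i (φ m - φ n) = classicalPartial i (φ m) - classicalPartial i (φ n) := by
      intro i
      ext x
      simp only [classicalPartial, Pi.sub_apply]
      rw [fderiv_sub (differentiable_of_smooth (hφ m) x) (differentiable_of_smooth (hφ n) x)]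
      simp
    rw [hd, hd]
    refine (add_le_add (htri h1 m n) (add_le_add (htri (h2 0) m n) (htri (h2 1) m n))).trans
      (le_of_eq ?_)
    rw [he]; ring
  have hcau : CauchySeq fun m => (hb m).toLp (φ m) := by
    rw [EMetric.cauchySeq_iff]
    intro ε hε
    have h3 : Tendsto (fun m => ENNReal.ofReal C * e m) atTop (𝓝 0) := tendsto_ofReal_mul_zero he0
    obtain ⟨N, hN⟩ := eventually_atTop.1 (h3.eventually (gt_mem_nhds (ENNReal.half_pos hε.ne')))
    refine ⟨N, fun m hm n hn => ?_⟩
    rw [Lp.edist_toLp_toLp]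
    refine (hdist m n).trans_lt ?_
    rw [mul_add]
    calc _ < ε / 2 + ε / 2 := ENNReal.add_lt_add (hN m hm) (hN n hn)
      _ = ε := ENNReal.add_halves ε
  obtain ⟨G, hG⟩ := cauchySeq_tendsto_of_complete hcau
  refine ⟨G, φ, hφ, h1, h2, hb, Lp.memLp G, ?_⟩
  rw [tendsto_iff_edist_tendsto_0] at hG
  refine hG.congr fun m => ?_
  rw [Lp.edist_def]
  exact eLpNorm_congr_ae ((hb m).coeFn_toLp.sub (ae_eq_refl _))

variable {P}

theorem HasTraceWith.memLp {u g : Plane → ℝ} {du : Fin 2 → Plane → ℝ} (h : P.HasTraceWith u du g) :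
    MemLp u 2 (volume.restrict P.Ω) := by
  obtain ⟨φ, -, h1, -, -⟩ := h; exact h1.memLp_lim

theorem HasTraceWith.memLp_partial {u g : Plane → ℝ} {du : Fin 2 → Plane → ℝ}
    (h : P.HasTraceWith u du g) (i : Fin 2) : MemLp (du i) 2 (volume.restrict P.Ω) := by
  obtain ⟨φ, -, -, h1, -⟩ := h; exact (h1 i).memLp_lim

theorem HasTraceWith.memLp_trace {u g : Plane → ℝ} {du : Fin 2 → Plane → ℝ}
    (h : P.HasTraceWith u du g) : MemLp g 2 P.boundaryMeasure := by
  obtain ⟨φ, -, -, -, h1⟩ := h; exact h1.memLp_lim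

theorem HasTraceWith.congr {u g u' g' : Plane → ℝ} {du du' : Fin 2 → Plane → ℝ}
    (h : P.HasTraceWith u du g) (hu : u =ᵐ[volume.restrict P.Ω] u')
    (hdu : ∀ i, du i =ᵐ[volume.restrict P.Ω] du' i) (hg : g =ᵐ[P.boundaryMeasure] g') :
    P.HasTraceWith u' du' g' := by
  obtain ⟨φ, h1, h2, h3, h4⟩ := h
  exact ⟨φ, h1, h2.congr hu, fun i => (h3 i).congr (hdu i), h4.congr hg⟩

theorem HasTraceWith.hasTrace {u g : Plane → ℝ} (hu : MemH1 P.Ω u)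
    (h : P.HasTraceWith u (fun i => weakPartial P.Ω i u) g) : P.HasTrace u g := by
  obtain ⟨φ, h1, h2, h3, h4⟩ := h
  exact ⟨hu, h4.memLp_lim, φ, h1, h2.tendsto, fun i => (h3 i).tendsto, h4.tendsto⟩

theorem HasTrace.hasTraceWith {u g : Plane → ℝ} (h : P.HasTrace u g) :
    P.HasTraceWith u (fun i => weakPartial P.Ω i u) g := by
  obtain ⟨hu, hg, φ, h1, h2, h3, h4⟩ := h
  exact ⟨φ, h1, ⟨fun m => P.memLp_volume (h1 m), hu.1, h2⟩,
    fun i => ⟨fun m => P.memLp_volume (contDiff_classicalPartial (h1 m) i),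
      (hu.isWeakPartial i).1, h3 i⟩, ⟨fun m => P.memLp_boundary (h1 m), hg, h4⟩⟩

variable (P) in
theorem hasTraceWith_smooth {f : Plane → ℝ} (hf : ContDiff ℝ ∞ f) :
    P.HasTraceWith f (fun i => classicalPartial i f) f :=
  ⟨fun _ => f, fun _ => hf, tendstoL2_const (P.memLp_volume hf),
    fun i => tendstoL2_const (P.memLp_volume (contDiff_classicalPartial hf i)),
    tendstoL2_const (P.memLp_boundary hf)⟩

variable (P) in
theorem weakPartial_smooth {f : Plane → ℝ} (hf : ContDiff ℝ ∞ f) (i : Fin 2) :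
    weakPartial P.Ω i f =ᵐ[volume.restrict P.Ω] classicalPartial i f :=
  (isWeakPartial_of_smooth P.isBounded P.isOpen.measurableSet hf i).weakPartial_ae_eq P.isOpen
    P.isBounded

variable (P) in
theorem memH1_smooth {f : Plane → ℝ} (hf : ContDiff ℝ ∞ f) : MemH1 P.Ω f :=
  memH1_of_smooth P.isBounded P.isOpen.measurableSet hf

variable (P) in
theorem hasTrace_smooth {f : Plane → ℝ} (hf : ContDiff ℝ ∞ f) : P.HasTrace f f :=
  HasTraceWith.hasTrace (P.memH1_smooth hf) ((P.hasTraceWith_smooth hf).congr (ae_eq_refl _)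
    (fun i => (P.weakPartial_smooth hf i).symm) (ae_eq_refl _))

theorem HasTraceWith.add {u g u' g' : Plane → ℝ} {du du' : Fin 2 → Plane → ℝ}
    (h : P.HasTraceWith u du g) (h' : P.HasTraceWith u' du' g') :
    P.HasTraceWith (fun x => u x + u' x) (fun i x => du i x + du' i x) (fun x => g x + g' x) := by
  obtain ⟨φ, h1, h2, h3, h4⟩ := h
  obtain ⟨φ', h1', h2', h3', h4'⟩ := h'
  exact ⟨fun m x => φ m x + φ' m x, fun m => (h1 m).add (h1' m), h2.add h2',
    fun i => ((h3 i).add (h3' i)).congr_left fun m => .of_forall fun x =>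
      (classicalPartial_add (h1 m) (h1' m) i x).symm, h4.add h4'⟩

theorem HasTraceWith.smooth_mul {u g χ : Plane → ℝ} {du : Fin 2 → Plane → ℝ}
    (h : P.HasTraceWith u du g) (hχ : ContDiff ℝ ∞ χ) :
    P.HasTraceWith (fun x => χ x * u x) (fun i x => χ x * du i x + classicalPartial i χ x * u x)
      (fun x => χ x * g x) := by
  obtain ⟨φ, h1, h2, h3, h4⟩ := h
  exact ⟨fun m x => χ x * φ m x, fun m => hχ.mul (h1 m),
    h2.smooth_mul P.compactlyCarried_volume hχ.continuous,
    fun i => (((h3 i).smooth_mul P.compactlyCarried_volume hχ.continuous).add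
      (h2.smooth_mul P.compactlyCarried_volume (contDiff_classicalPartial hχ i).continuous)).congr_left
      fun m => .of_forall fun x => (classicalPartial_mul hχ (h1 m) i x).symm,
    h4.smooth_mul P.compactlyCarried_boundary hχ.continuous⟩

theorem HasTraceWith.const_mul {u g : Plane → ℝ} {du : Fin 2 → Plane → ℝ}
    (h : P.HasTraceWith u du g) (c : ℝ) :
    P.HasTraceWith (fun x => c * u x) (fun i x => c * du i x) (fun x => c * g x) := by
  refine (h.smooth_mul (χ := fun _ => c) contDiff_const).congr (ae_eq_refl _)
    (fun i => .of_forall fun x => ?_) (ae_eq_refl _)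
  simp [classicalPartial]

/-- The chain rule for smooth functions with bounded derivative. -/
theorem HasTraceWith.comp {u g u' g' : Plane → ℝ} {du du' : Fin 2 → Plane → ℝ}
    (h : P.HasTraceWith u du g) (h' : P.HasTraceWith u' du' g') {F : ℝ × ℝ → ℝ}
    (hF : ContDiff ℝ ∞ F) {C : ℝ} (hC : ∀ z, ‖fderiv ℝ F z‖ ≤ C) :
    P.HasTraceWith (fun x => F (u x, u' x))
      (fun i x => fderiv ℝ F (u x, u' x) (1, 0) * du i x + fderiv ℝ F (u x, u' x) (0, 1) * du' i x)
      (fun x => F (g x, g' x)) := by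
  obtain ⟨φ, h1, h2, h3, h4⟩ := h
  obtain ⟨φ', h1', h2', h3', h4'⟩ := h'
  -- The derivative of F is evaluated at the approximations, and convergence of this bounded factor
  -- is needed almost everywhere. Two successive subsequences provide it for both arguments.
  obtain ⟨s, hs, hae⟩ := h2.exists_seq_tendsto_ae
  obtain ⟨t, ht, hae'⟩ := (h2'.comp hs).exists_seq_tendsto_ae
  have hst := hs.comp ht
  have hdF : Differentiable ℝ F := hF.differentiable (by simp)
  have hC0 : 0 ≤ C := (norm_nonneg _).trans (hC 0)
  have hL : ∀ z z', |F z - F z'| ≤ C * (|z.1 - z'.1| + |z.2 - z'.2|) := by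
    intro z z'
    have := (convex_univ (𝕜 := ℝ) (E := ℝ × ℝ)).norm_image_sub_le_of_norm_fderiv_le
      (fun z _ => hdF z) (fun z _ => hC z) (mem_univ z') (mem_univ z)
    refine this.trans (mul_le_mul_of_nonneg_left ?_ hC0)
    rw [Prod.norm_def]
    exact max_le_add_of_nonneg (norm_nonneg _) (norm_nonneg _)
  have hFs : ∀ m, ContDiff ℝ ∞ fun x => F (φ (s (t m)) x, φ' (s (t m)) x) := fun m =>
    hF.comp ((h1 _).prodMk (h1' _))
  have hFc : Continuous (fderiv ℝ F) := hF.continuous_fderiv (by simp)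
  have hD : ∀ w : ℝ × ℝ, ‖w‖ ≤ 1 → ∀ z, |fderiv ℝ F z w| ≤ C := fun w hw z =>
    ((fderiv ℝ F z).le_opNorm w).trans ((mul_le_of_le_one_right (norm_nonneg _) hw).trans (hC z))
  refine ⟨fun m x => F (φ (s (t m)) x, φ' (s (t m)) x), hFs, ?_, fun i => ?_, ?_⟩
  · exact (h2.comp hst).lipschitz_comp (h2'.comp hst) hF.continuous hL
      fun m => P.memLp_volume (hFs m)
  · have key : ∀ w : ℝ × ℝ, ‖w‖ ≤ 1 → ∀ {a : ℕ → Plane → ℝ} {b : Plane → ℝ},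
        TendstoL2 (volume.restrict P.Ω) a b → TendstoL2 (volume.restrict P.Ω)
        (fun m x => fderiv ℝ F (φ (s (t m)) x, φ' (s (t m)) x) w * a m x)
        (fun x => fderiv ℝ F (u x, u' x) w * b x) := by
      intro w hw a b hab
      have hcw : Continuous fun z => fderiv ℝ F z w := hFc.clm_apply continuous_const
      refine hab.mul_of_tendsto_ae (C := C) (fun m => ?_) (fun m => .of_forall fun x => hD w hw _) ?_
      · exact (hcw.comp ((h1 _).continuous.prodMk (h1' _).continuous)).aestronglyMeasurable
      · filter_upwards [hae, hae'] with x hx hx'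
        exact (hcw.tendsto _).comp ((hx.comp ht.tendsto_atTop).prodMk_nhds hx')
    refine ((key (1, 0) (by simp [Prod.norm_def]) ((h3 i).comp hst)).add
      (key (0, 1) (by simp [Prod.norm_def]) ((h3' i).comp hst))).congr_left fun m => ?_
    refine .of_forall fun x => ?_
    have hd : HasFDerivAt (fun x => (φ (s (t m)) x, φ' (s (t m)) x))
        ((fderiv ℝ (φ (s (t m))) x).prod (fderiv ℝ (φ' (s (t m))) x)) x :=
      (differentiable_of_smooth (h1 _) x).hasFDerivAt.prodMk
        (differentiable_of_smooth (h1' _) x).hasFDerivAt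
    have hc := ((hdF _).hasFDerivAt.comp x hd).fderiv
    have hc' : fderiv ℝ (fun x => F (φ (s (t m)) x, φ' (s (t m)) x)) x = _ := hc
    simp only [classicalPartial]
    rw [hc']
    simp only [ContinuousLinearMap.comp_apply, ContinuousLinearMap.prod_apply]
    generalize fderiv ℝ F (φ (s (t m)) x, φ' (s (t m)) x) = A
    have e : ∀ a b : ℝ, A (a, b) = A (1, 0) * a + A (0, 1) * b := fun a b => by
      have : ((a, b) : ℝ × ℝ) = a • (1, 0) + b • (0, 1) := by simp
      rw [this, map_add, map_smul, map_smul, smul_eq_mul, smul_eq_mul]; ring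
    exact (e _ _).symm
  · exact (h4.comp hst).lipschitz_comp (h4'.comp hst) hF.continuous hL
      fun m => P.memLp_boundary (hFs m)

/-! ### Green's formulas -/

theorem HasTraceWith.green {u g : Plane → ℝ} {du : Fin 2 → Plane → ℝ} (h : P.HasTraceWith u du g)
    {f : Plane → ℝ} (hf : ContDiff ℝ ∞ f) (i : Fin 2) :
    (∫ y in P.Ω, f y * du i y) + ∫ y in P.Ω, classicalPartial i f y * u y =
      ∑ k, P.normal k i * ∫ y, f y * g y ∂P.edgeMeasure k := by
  obtain ⟨φ, h1, h2, h3, h4⟩ := h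
  have hdf := contDiff_classicalPartial hf i
  have t1 := ((h3 i).mul_integral (P.memLp_volume hf)).add (h2.mul_integral (P.memLp_volume hdf))
  have t2 : Tendsto (fun m => ∑ k, P.normal k i * ∫ y, f y * φ m y ∂P.edgeMeasure k) atTop
      (𝓝 (∑ k, P.normal k i * ∫ y, f y * g y ∂P.edgeMeasure k)) :=
    tendsto_finsetSum _ fun k _ => ((P.tendstoL2_edge h4 k).mul_integral
      (P.memLp_edge (P.memLp_boundary hf) k)).const_mul _
  refine tendsto_nhds_unique t1 (t2.congr fun m => ?_)
  rw [← P.integral_by_parts hf (h1 m) i, integral_add]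
  · exact (P.memLp_volume hf).integrable_fun_mul
      (P.memLp_volume (contDiff_classicalPartial (h1 m) i))
  · exact (P.memLp_volume hdf).integrable_fun_mul (P.memLp_volume (h1 m))

variable (P) in
/-- The bilinear form `∫ (∂₂u ∂₁v - ∂₁u ∂₂v)` in terms of the partial derivatives. -/
def jac (a b : Fin 2 → Plane → ℝ) : ℝ := ∫ y in P.Ω, (a 1 y * b 0 y - a 0 y * b 1 y)

theorem jac_swap (a b : Fin 2 → Plane → ℝ) : P.jac b a = -P.jac a b := by
  rw [jac, jac, ← integral_neg]; congr 1; ext y; ring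

theorem tendsto_jac {a : ℕ → Fin 2 → Plane → ℝ} {b c : Fin 2 → Plane → ℝ}
    (h : ∀ i, TendstoL2 (volume.restrict P.Ω) (fun m => a m i) (b i))
    (hc : ∀ i, MemLp (c i) 2 (volume.restrict P.Ω)) :
    Tendsto (fun m => P.jac (a m) c) atTop (𝓝 (P.jac b c)) := by
  have t := ((h 1).integral_mul (hc 0)).sub ((h 0).integral_mul (hc 1))
  rw [jac, integral_sub ((h 1).memLp_lim.integrable_fun_mul (hc 0))
    ((h 0).memLp_lim.integrable_fun_mul (hc 1))]
  refine t.congr fun m => ?_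
  rw [jac, integral_sub (((h 1).memLp m).integrable_fun_mul (hc 0))
    (((h 0).memLp m).integrable_fun_mul (hc 1))]

/-- Green's formula is applied to both terms. The mixed second derivatives of f cancel, and n₀ ∂₁f -
n₁ ∂₀f is the tangential derivative. No regularity of the trace beyond L² is required. -/
theorem HasTraceWith.jac_smooth {u g : Plane → ℝ} {du : Fin 2 → Plane → ℝ}
    (h : P.HasTraceWith u du g) {f : Plane → ℝ} (hf : ContDiff ℝ ∞ f) :
    P.jac (fun i => classicalPartial i f) du =
      ∑ k, ∫ y, fderiv ℝ f y (P.tangent k) * g y ∂P.edgeMeasure k := by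
  have hd := fun i => contDiff_classicalPartial hf i
  have g0 := h.green (hd 1) 0
  have g1 := h.green (hd 0) 1
  simp only [classicalPartial_comm hf 0 1] at g0
  rw [jac, integral_sub ((P.memLp_volume (hd 1)).integrable_fun_mul (h.memLp_partial 0))
    ((P.memLp_volume (hd 0)).integrable_fun_mul (h.memLp_partial 1))]
  have e : ∑ k, ∫ y, fderiv ℝ f y (P.tangent k) * g y ∂P.edgeMeasure k =
      ∑ k, (P.normal k 0 * (∫ y, classicalPartial 1 f y * g y ∂P.edgeMeasure k) -
        P.normal k 1 * ∫ y, classicalPartial 0 f y * g y ∂P.edgeMeasure k) := by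
    refine Finset.sum_congr rfl fun k _ => ?_
    have hi : ∀ i, Integrable (fun y => classicalPartial i f y * g y) (P.edgeMeasure k) := fun i =>
      (P.memLp_edge (P.memLp_boundary (hd i)) k).integrable_fun_mul (P.memLp_edge h.memLp_trace k)
    rw [← integral_const_mul, ← integral_const_mul, ← integral_sub ((hi 1).const_mul _)
      ((hi 0).const_mul _)]
    congr 1
    ext y
    rw [fderiv_apply_eq, normal_zero, normal_one]; ring
  rw [e, Finset.sum_sub_distrib, ← g0, ← g1]
  ring

/-- The form is antisymmetric, so w may be replaced by its smooth approximations. For those the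
value is a boundary integral against the vanishing trace. -/
theorem HasTraceWith.jac_eq_zero {u g w h : Plane → ℝ} {du dw : Fin 2 → Plane → ℝ}
    (hu : P.HasTraceWith u du g) (hw : P.HasTraceWith w dw h)
    (hg : ∀ᵐ x ∂P.boundaryMeasure, g x = 0) : P.jac du dw = 0 := by
  obtain ⟨φ, h1, h2, h3, h4⟩ := hw
  have t : Tendsto (fun m => P.jac (fun i => classicalPartial i (φ m)) du) atTop (𝓝 (P.jac dw du)) :=
    tendsto_jac (fun i => h3 i) hu.memLp_partial
  have hz : ∀ m, P.jac (fun i => classicalPartial i (φ m)) du = 0 := by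
    intro m
    rw [hu.jac_smooth (h1 m)]
    refine Finset.sum_eq_zero fun k _ => integral_eq_zero_of_ae ?_
    filter_upwards [P.ae_boundary_iff.1 hg k] with x hx
    simp [hx]
  simp only [hz] at t
  rw [jac_swap, ← tendsto_nhds_unique tendsto_const_nhds t, neg_zero]

/-- Localized version, where the trace of the second function vanishes on the support of the
cutoff function. -/
theorem HasTraceWith.jac_smooth_mul_eq_zero {u g w h χ : Plane → ℝ} {du dw : Fin 2 → Plane → ℝ}
    (hu : P.HasTraceWith u du g) (hw : P.HasTraceWith w dw h) (hχ : ContDiff ℝ ∞ χ)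
    (hh : ∀ᵐ x ∂P.boundaryMeasure, x ∈ tsupport χ → h x = 0) :
    P.jac (fun i x => χ x * du i x + classicalPartial i χ x * u x) dw = 0 := by
  obtain ⟨φ, h1, h2, h3, h4⟩ := hu
  have hs : ∀ m, ContDiff ℝ ∞ fun x => χ x * φ m x := fun m => hχ.mul (h1 m)
  have t : Tendsto (fun m => P.jac (fun i => classicalPartial i (fun x => χ x * φ m x)) dw) atTop
      (𝓝 (P.jac (fun i x => χ x * du i x + classicalPartial i χ x * u x) dw)) := by
    refine tendsto_jac (fun i => ?_) hw.memLp_partial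
    exact (((h3 i).smooth_mul P.compactlyCarried_volume hχ.continuous).add
      (h2.smooth_mul P.compactlyCarried_volume (contDiff_classicalPartial hχ i).continuous)).congr_left
      fun m => .of_forall fun x => (classicalPartial_mul hχ (h1 m) i x).symm
  refine (tendsto_nhds_unique tendsto_const_nhds (t.congr fun m => ?_)).symm
  rw [hw.jac_smooth (hs m)]
  refine Finset.sum_eq_zero fun k _ => integral_eq_zero_of_ae ?_
  filter_upwards [P.ae_boundary_iff.1 hh k] with x hx
  by_cases hxs : x ∈ tsupport χ
  · simp [hx hxs]
  · have : x ∉ tsupport fun y => fderiv ℝ (fun x => χ x * φ m x) y (P.tangent k) := fun h' =>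
      hxs (tsupport_mul_subset_left (f := χ)
        (KirchhoffPlate.tsupport_fderiv_apply_subset (fun x => χ x * φ m x) _ h'))
    simp [image_eq_zero_of_notMem_tsupport this]

end Plate
/-! ### The lemma of du Bois-Reymond -/

theorem exists_test_primitive {L : ℝ} (hL : 0 < L) {ψ : ℝ → ℝ} (hψ : ContDiff ℝ ∞ ψ)
    (hc : HasCompactSupport ψ) (hs : tsupport ψ ⊆ Ioo 0 L) (h0 : ∫ t, ψ t = 0) :
    ∃ ζ : ℝ → ℝ, ContDiff ℝ ∞ ζ ∧ HasCompactSupport ζ ∧ tsupport ζ ⊆ Ioo 0 L ∧ deriv ζ = ψ := by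
  -- The midpoint is inserted to make the set nonempty, since ψ may vanish identically.
  have hK : IsCompact (insert (L / 2) (tsupport ψ)) := hc.isCompact.insert _
  have hKs : insert (L / 2) (tsupport ψ) ⊆ Ioo 0 L := insert_subset ⟨by linarith, by linarith⟩ hs
  obtain ⟨a, haK, ha⟩ := hK.exists_isLeast ⟨_, mem_insert _ _⟩
  obtain ⟨b, hbK, hb⟩ := hK.exists_isGreatest ⟨_, mem_insert _ _⟩
  have ha0 : 0 < a := (hKs haK).1
  have hbL : b < L := (hKs hbK).2
  have hz : ∀ t, t ∉ Icc a b → ψ t = 0 := fun t ht =>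
    image_eq_zero_of_notMem_tsupport fun h => ht ⟨ha (mem_insert_of_mem _ h), hb (mem_insert_of_mem _ h)⟩
  -- The base point a/2 lies to the left of the support. The primitive thus vanishes before a, and
  -- also after b because ψ has mean zero.
  have hd : ∀ t, HasDerivAt (fun t => ∫ x in (a / 2)..t, ψ x) (ψ t) t := fun t =>
    intervalIntegral.integral_hasDerivAt_right (hψ.continuous.intervalIntegrable _ _)
      hψ.continuous.stronglyMeasurable.stronglyMeasurableAtFilter hψ.continuous.continuousAt
  have hderiv : deriv (fun t => ∫ x in (a / 2)..t, ψ x) = ψ := funext fun t => (hd t).deriv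
  have hsupp : Function.support (fun t => ∫ x in (a / 2)..t, ψ x) ⊆ Icc a b := by
    intro t ht
    by_contra h
    refine ht ?_
    rcases lt_or_ge t a with hta | hta
    · refine intervalIntegral.integral_zero_ae (.of_forall fun x hx => hz x fun hx' => ?_)
      rw [mem_uIoc] at hx
      rcases hx with hx | hx <;> linarith [hx.1, hx.2, hx'.1]
    · have htb : b < t := not_le.1 fun h' => h ⟨hta, h'⟩
      change ∫ x in (a / 2)..t, ψ x = 0
      rw [intervalIntegral.integral_eq_integral_of_support_subset, h0]
      intro x hx
      by_contra h'
      refine hx (hz x fun hx' => h' ⟨by linarith [hx'.1], by linarith [hx'.2]⟩)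
  have hts : tsupport (fun t => ∫ x in (a / 2)..t, ψ x) ⊆ Icc a b :=
    closure_minimal hsupp isClosed_Icc
  refine ⟨fun t => ∫ x in (a / 2)..t, ψ x, ?_, ?_, hts.trans fun t ht =>
    ⟨ha0.trans_le ht.1, ht.2.trans_lt hbL⟩, hderiv⟩
  · rw [contDiff_infty_iff_deriv, hderiv]
    exact ⟨fun t => (hd t).differentiableAt, hψ⟩
  · exact HasCompactSupport.intro isCompact_Icc fun t ht => by
      by_contra h; exact ht (hsupp h)

theorem exists_unit_test {L : ℝ} (hL : 0 < L) : ∃ w : ℝ → ℝ, ContDiff ℝ ∞ w ∧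
    HasCompactSupport w ∧ tsupport w ⊆ Ioo 0 L ∧ ∫ t, w t = 1 := by
  let f : ContDiffBump (L / 2) := ⟨L / 8, L / 4, by positivity, by linarith⟩
  refine ⟨f.normed volume, f.contDiff_normed, f.hasCompactSupport_normed, ?_, f.integral_normed⟩
  rw [f.tsupport_normed_eq, Real.closedBall_eq_Icc]
  intro t ht
  have h1 : L / 2 - L / 4 ≤ t := ht.1
  have h2 : t ≤ L / 2 + L / 4 := ht.2
  exact ⟨by linarith, by linarith⟩

theorem integral_test_eq {L : ℝ} {φ : ℝ → ℝ} (hs : tsupport φ ⊆ Ioo 0 L) (f : ℝ → ℝ) :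
    ∫ t in Ioo 0 L, f t * φ t = ∫ t, f t * φ t :=
  setIntegral_eq_integral_of_forall_compl_eq_zero fun t ht => by
    rw [image_eq_zero_of_notMem_tsupport fun h => ht (hs h), mul_zero]

theorem integrableOn_mul_test {L : ℝ} {f φ : ℝ → ℝ} (hf : IntegrableOn f (Ioo 0 L))
    (hφ : Continuous φ) : IntegrableOn (fun t => f t * φ t) (Ioo 0 L) := by
  obtain ⟨C, hC⟩ := (isCompact_Icc (a := (0 : ℝ)) (b := L)).exists_bound_of_continuousOn
    hφ.continuousOn
  have := hf.bdd_mul (c := C) hφ.aestronglyMeasurable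
    ((ae_restrict_iff' measurableSet_Ioo).2 (.of_forall fun t ht => hC t (Ioo_subset_Icc_self ht)))
  exact this.congr (.of_forall fun t => mul_comm _ _)

/-- Every test function is the sum of a multiple of a fixed one and of a derivative. -/
theorem exists_test_decomposition {L : ℝ} (hL : 0 < L) {w : ℝ → ℝ} (hw : ContDiff ℝ ∞ w)
    (hwc : HasCompactSupport w) (hws : tsupport w ⊆ Ioo 0 L) (hw1 : ∫ t, w t = 1) {φ : ℝ → ℝ}
    (hφ : ContDiff ℝ ∞ φ) (hc : HasCompactSupport φ) (hs : tsupport φ ⊆ Ioo 0 L) :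
    ∃ ζ : ℝ → ℝ, ContDiff ℝ ∞ ζ ∧ HasCompactSupport ζ ∧ tsupport ζ ⊆ Ioo 0 L ∧
      φ = fun t => (∫ t, φ t) * w t + deriv ζ t := by
  obtain ⟨ζ, h1, h2, h3, h4⟩ := exists_test_primitive hL
    (ψ := fun t => φ t - (∫ t, φ t) * w t) (hφ.sub (contDiff_const.mul hw))
    (hc.sub hwc.mul_left)
    ((tsupport_sub φ fun t => (∫ t, φ t) * w t).trans
      (union_subset hs ((tsupport_mul_subset_right (f := fun _ => ∫ t, φ t)).trans hws)))
    (by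
      rw [integral_sub (hφ.continuous.integrable_of_hasCompactSupport hc)
        ((hw.continuous.integrable_of_hasCompactSupport hwc).const_mul _), integral_const_mul, hw1]
      ring)
  exact ⟨ζ, h1, h2, h3, funext fun t => by rw [h4]; ring⟩

/-- Modulo derivatives of test functions, a test function is (∫φ) w. Hence f acts on test functions
like the constant ∫ f w. -/
theorem ae_eq_const_of_integral_deriv_eq_zero {L : ℝ} (hL : 0 < L) {f : ℝ → ℝ}
    (hf : IntegrableOn f (Ioo 0 L))
    (h : ∀ χ : ℝ → ℝ, ContDiff ℝ ∞ χ → HasCompactSupport χ → tsupport χ ⊆ Ioo 0 L →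
      ∫ t in Ioo 0 L, f t * deriv χ t = 0) :
    ∃ c, ∀ᵐ t ∂volume.restrict (Ioo 0 L), f t = c := by
  obtain ⟨w, hw, hwc, hws, hw1⟩ := exists_unit_test hL
  refine ⟨∫ t in Ioo 0 L, f t * w t, ?_⟩
  set c := ∫ t in Ioo 0 L, f t * w t
  have hfc : IntegrableOn (fun t => f t - c) (Ioo 0 L) :=
    hf.sub (integrableOn_const (by simp))
  have h0 := isOpen_Ioo.ae_eq_zero_of_integral_contDiff_smul_eq_zero (U := Ioo 0 L)
    (f := fun t => f t - c) (μ := volume) hfc.locallyIntegrableOn ?_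
  · rw [ae_restrict_iff' measurableSet_Ioo]
    filter_upwards [h0] with t ht hm
    exact sub_eq_zero.1 (ht hm)
  · intro φ hφ hc hs
    have e : ∫ t, φ t • (f t - c) = ∫ t in Ioo 0 L, (f t - c) * φ t := by
      rw [integral_test_eq hs]; simp [mul_comm]
    rw [e]
    obtain ⟨ζ, hζ, hζc, hζs, hζe⟩ := exists_test_decomposition hL hw hwc hws hw1 hφ hc hs
    have hζ' : Continuous (deriv ζ) := hζ.continuous_deriv (by simp)
    have e1 : ∫ t in Ioo 0 L, f t * φ t = (∫ t, φ t) * c := by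
      have : ∀ t, f t * φ t = (∫ t, φ t) * (f t * w t) + f t * deriv ζ t := fun t => by
        conv_lhs => rw [hζe]
        ring
      simp only [this]
      rw [integral_add ((integrableOn_mul_test hf hw.continuous).const_mul _)
        (integrableOn_mul_test hf hζ'), integral_const_mul, h ζ hζ hζc hζs, add_zero]
    have e2 : ∫ t in Ioo 0 L, c * φ t = c * ∫ t, φ t := by
      rw [integral_test_eq hs fun _ => c, integral_const_mul]
    simp only [sub_mul]
    rw [integral_sub (integrableOn_mul_test hf hφ.continuous)
      (integrableOn_mul_test (integrableOn_const (by simp)) hφ.continuous), e1, e2]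
    ring

theorem integral_id_mul_deriv {χ : ℝ → ℝ} (hχ : ContDiff ℝ ∞ χ) (hc : HasCompactSupport χ) :
    ∫ t, t * deriv χ t = -∫ t, χ t := by
  have hd : Continuous (deriv χ) := hχ.continuous_deriv (by simp)
  have := integral_mul_deriv_eq_deriv_mul_of_integrable (u := fun t : ℝ => t) (v := χ)
    (u' := fun _ => 1) (v' := deriv χ) (fun t _ => hasDerivAt_id t)
    (fun t _ => (hχ.differentiable (by simp) t).hasDerivAt)
    ((continuous_id.mul hd).integrable_of_hasCompactSupport hc.deriv.mul_left)
    ((continuous_const.mul hχ.continuous).integrable_of_hasCompactSupport hc.mul_left)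
    ((continuous_id.mul hχ.continuous).integrable_of_hasCompactSupport hc.mul_left)
  simpa using this

/-- Reduction to the case of first derivatives. Decomposing φ as (∫φ) w + ζ' and differentiating
shows that f acts on φ' as -(∫φ) a with a = -∫ f w', which is also how t ↦ a t acts; so f - a t
annihilates derivatives. -/
theorem ae_eq_affine_of_integral_deriv_deriv_eq_zero {L : ℝ} (hL : 0 < L) {f : ℝ → ℝ}
    (hf : IntegrableOn f (Ioo 0 L))
    (h : ∀ χ : ℝ → ℝ, ContDiff ℝ ∞ χ → HasCompactSupport χ → tsupport χ ⊆ Ioo 0 L →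
      ∫ t in Ioo 0 L, f t * deriv (deriv χ) t = 0) :
    ∃ a c, ∀ᵐ t ∂volume.restrict (Ioo 0 L), f t = a * t + c := by
  obtain ⟨w, hw, hwc, hws, hw1⟩ := exists_unit_test hL
  have hd : ∀ {χ : ℝ → ℝ}, ContDiff ℝ ∞ χ → ContDiff ℝ ∞ (deriv χ) := fun hχ =>
    (contDiff_infty_iff_deriv.1 hχ).2
  set a := -∫ t in Ioo 0 L, f t * deriv w t with ha
  have hid : IntegrableOn (fun t : ℝ => a * t) (Ioo 0 L) :=
    (by fun_prop : Continuous fun t : ℝ => a * t).integrableOn_Icc.mono_set Ioo_subset_Icc_self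
  obtain ⟨c, hc⟩ := ae_eq_const_of_integral_deriv_eq_zero hL (f := fun t => f t - a * t)
    (hf.sub hid) (by
    intro φ hφ hφc hφs
    obtain ⟨ζ, hζ, hζc, hζs, hζe⟩ := exists_test_decomposition hL hw hwc hws hw1 hφ hφc hφs
    have e1 : ∫ t in Ioo 0 L, f t * deriv φ t = -(∫ t, φ t) * a := by
      have : ∀ t, f t * deriv φ t =
          (∫ t, φ t) * (f t * deriv w t) + f t * deriv (deriv ζ) t := fun t => by
        have : deriv φ t = (∫ t, φ t) * deriv w t + deriv (deriv ζ) t := by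
          conv_lhs => rw [hζe]
          rw [deriv_fun_add ((hw.differentiable (by simp) t).const_mul _)
            ((hd hζ).differentiable (by simp) t), deriv_const_mul _ (hw.differentiable (by simp) t)]
        rw [this]; ring
      simp only [this]
      rw [integral_add ((integrableOn_mul_test hf (hd hw).continuous).const_mul _)
        (integrableOn_mul_test hf (hd (hd hζ)).continuous), integral_const_mul, h ζ hζ hζc hζs, ha]
      ring
    have e2 : ∫ t in Ioo 0 L, a * t * deriv φ t = a * -∫ t, φ t := by
      rw [integral_test_eq (tsupport_deriv_subset.trans hφs) fun t => a * t,
        ← integral_id_mul_deriv hφ hφc, ← integral_const_mul]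
      simp only [mul_assoc]
    simp only [sub_mul]
    rw [integral_sub (integrableOn_mul_test hf (hd hφ).continuous)
      (integrableOn_mul_test hid (hd hφ).continuous), e1, e2]
    ring)
  exact ⟨a, c, hc.mono fun t ht => by linarith⟩

theorem classicalPartial_congr {f g : Plane → ℝ} {x : Plane} (h : f =ᶠ[𝓝 x] g) (i : Fin 2) :
    classicalPartial i f =ᶠ[𝓝 x] classicalPartial i g :=
  (h.fderiv (𝕜 := ℝ)).mono fun y hy => by simp only [classicalPartial, hy]

theorem classicalPartial_zero (i : Fin 2) (x : Plane) : classicalPartial i (fun _ => 0) x = 0 := by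
  simp [classicalPartial]

/-- A smooth function that is `1` near one closed set and `0` near another. -/
theorem exists_smooth_separation {A B : Set Plane} (hA : IsClosed A) (hB : IsClosed B)
    (h : Disjoint A B) : ∃ β : Plane → ℝ, ContDiff ℝ ∞ β ∧ (∀ x ∈ A, β =ᶠ[𝓝 x] fun _ => 0) ∧
      ∀ x ∈ B, β =ᶠ[𝓝 x] fun _ => 1 := by
  obtain ⟨f, hf0, hf1, -⟩ := exists_contMDiffMap_zero_one_nhds_of_isClosed
    (n := ⊤) (modelWithCornersSelf ℝ Plane) hA hB h
  exact ⟨f, f.contMDiff.contDiff, fun x hx => hf0.filter_mono (nhds_le_nhdsSet hx),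
    fun x hx => hf1.filter_mono (nhds_le_nhdsSet hx)⟩

namespace Plate

variable (P : Plate)

theorem isClosed_biUnion_seg (p : Fin P.K → Prop) : IsClosed (⋃ l, ⋃ _ : p l, P.seg l) :=
  isClosed_iUnion_of_finite fun l => isClosed_iUnion_of_finite fun _ => (P.isCompact_seg l).isClosed

/-! ### The pairing for smooth functions -/

variable {P} in
theorem _root_.KirchhoffPlate.tangentialPairing_eq {ψ ξ : Plane → Plane} (hψ : MemH1Vec P.Ω ψ)
    (hξ : MemH1Vec P.Ω ξ) : tangentialPairing P.Ω ψ ξ =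
      ∑ i, P.jac (fun j => weakPartial P.Ω j fun x => ψ x i)
        (fun j => weakPartial P.Ω j fun x => ξ x i) := by
  have hi : ∀ i j k, Integrable (fun x => weakPartial P.Ω j (fun y => ψ y i) x *
      weakPartial P.Ω k (fun y => ξ y i) x) (volume.restrict P.Ω) := fun i j k =>
    ((hψ i).isWeakPartial j).1.integrable_fun_mul ((hξ i).isWeakPartial k).1
  simp only [jac]
  rw [tangentialPairing]
  refine Eq.trans ?_ (integral_finsetSum Finset.univ fun i _ => (hi i 1 0).sub (hi i 0 1))
  congr 1
  ext x
  simp [frobenius, Curl, weakJacobian, Fin.sum_univ_two, sub_eq_add_neg]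

variable {P} in
theorem jac_congr {a a' b b' : Fin 2 → Plane → ℝ} (ha : ∀ i, a i =ᵐ[volume.restrict P.Ω] a' i)
    (hb : ∀ i, b i =ᵐ[volume.restrict P.Ω] b' i) : P.jac a b = P.jac a' b' := by
  refine integral_congr_ae ?_
  filter_upwards [ha 0, ha 1, hb 0, hb 1] with x h1 h2 h3 h4
  rw [h1, h2, h3, h4]

theorem weakGrad_smooth {v : Plane → ℝ} (hv : ContDiff ℝ ∞ v) (i : Fin 2) :
    (fun x => weakGrad P.Ω v x i) =ᵐ[volume.restrict P.Ω] classicalPartial i v :=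
  P.weakPartial_smooth hv i

theorem hasTraceWith_weakGrad_smooth {v : Plane → ℝ} (hv : ContDiff ℝ ∞ v) (i : Fin 2) :
    MemH1 P.Ω (fun x => weakGrad P.Ω v x i) ∧ P.HasTraceWith (fun x => weakGrad P.Ω v x i)
      (fun j => weakPartial P.Ω j fun x => weakGrad P.Ω v x i) (classicalPartial i v) := by
  have hd := contDiff_classicalPartial hv i
  have hm : MemH1 P.Ω (fun x => weakGrad P.Ω v x i) :=
    (P.memH1_smooth hd).congr (P.weakGrad_smooth hv i).symm
  refine ⟨hm, (P.hasTraceWith_smooth hd).congr (P.weakGrad_smooth hv i).symm (fun j => ?_)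
    (ae_eq_refl _)⟩
  exact (((isWeakPartial_of_smooth P.isBounded P.isOpen.measurableSet hd j).congr
    (P.weakGrad_smooth hv i).symm).weakPartial_ae_eq P.isOpen P.isBounded).symm

theorem smooth_mem_W {v : Plane → ℝ} (hv : ContDiff ℝ ∞ v)
    (h0 : ∀ k, P.bc k = BC.clamped ∨ P.bc k = BC.simplySupported → ∀ x ∈ P.edge k, v x = 0)
    (h1 : ∀ k, P.bc k = BC.clamped → ∀ x ∈ P.edge k, fderiv ℝ v x (P.normal k) = 0) :
    v ∈ P.W := by
  have hg := P.hasTraceWith_weakGrad_smooth hv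
  refine ⟨⟨P.memH1_smooth hv, fun i => (hg i).1⟩, ⟨v, P.hasTrace_smooth hv, fun k hk => ?_⟩,
    fun x => WithLp.toLp 2 fun i => classicalPartial i v x, fun i => ?_, fun k hk => ?_⟩
  · filter_upwards [P.ae_edge_mem k] with x hx using h0 k hk x hx
  · exact (hg i).2.hasTrace (hg i).1
  · filter_upwards [P.ae_edge_mem k] with x hx
    rw [← h1 k hk x hx, fderiv_apply_eq, inner_plane]
    simp only [mul_comm]

/-- The contribution of edge `k` to the pairing of a trace with the gradient of a smooth
function. -/
def edgePairing (g : Plane → Plane) (v : Plane → ℝ) (k : Fin P.K) : ℝ :=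
  ∫ y, ∑ i, fderiv ℝ (classicalPartial i v) y (P.tangent k) * g y i ∂P.edgeMeasure k

variable {P} in
-- The antisymmetric form is evaluated with the smooth function ∂ᵢv in the first slot. This puts the
-- tangential derivative on ∇v and the trace on ψ, so the orthogonality defining Ψ₀ becomes a
-- condition on the trace.
theorem sum_edgePairing_eq_zero {ψ g : Plane → Plane} (hψ : ψ ∈ P.Psi0) (hg : P.HasTraceVec ψ g)
    {v : Plane → ℝ} (hv : ContDiff ℝ ∞ v) (hvW : v ∈ P.W) : ∑ k, P.edgePairing g v k = 0 := by
  have h := hψ.2 v hvW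
  rw [tangentialPairing_eq hψ.1 fun i => (P.hasTraceWith_weakGrad_smooth hv i).1] at h
  have e : ∀ i, P.jac (fun j => weakPartial P.Ω j fun x => ψ x i)
      (fun j => weakPartial P.Ω j fun x => weakGrad P.Ω v x i) =
      -∑ k, ∫ y, fderiv ℝ (classicalPartial i v) y (P.tangent k) * g y i ∂P.edgeMeasure k := by
    intro i
    have hd := contDiff_classicalPartial hv i
    rw [← (hg i).hasTraceWith.jac_smooth hd, ← jac_swap]
    refine jac_congr (fun _ => ae_eq_refl _) fun j => ?_
    exact ((isWeakPartial_of_smooth P.isBounded P.isOpen.measurableSet hd j).congr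
      (P.weakGrad_smooth hv i).symm).weakPartial_ae_eq P.isOpen P.isBounded
  simp only [e] at h
  rw [Finset.sum_neg_distrib, neg_eq_zero, Finset.sum_comm] at h
  rw [← h]
  refine Finset.sum_congr rfl fun k _ => ?_
  rw [edgePairing, integral_finsetSum]
  intro i _
  exact (P.memLp_edge (P.memLp_boundary (contDiff_fderiv_apply (contDiff_classicalPartial hv i)
    _)) k).integrable_fun_mul (P.memLp_edge (hg i).2.1 k)

theorem edgePairing_congr_trace {g g' : Plane → Plane} {k : Fin P.K} (v : Plane → ℝ)
    (h : ∀ᵐ y ∂P.edgeMeasure k, g y = g' y) : P.edgePairing g v k = P.edgePairing g' v k := by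
  refine integral_congr_ae (h.mono fun y hy => ?_)
  simp only [hy]

theorem edgePairing_congr (g : Plane → Plane) {v u : Plane → ℝ} {k : Fin P.K}
    (h : ∀ y ∈ P.edge k, v =ᶠ[𝓝 y] u) : P.edgePairing g v k = P.edgePairing g u k := by
  refine integral_congr_ae ?_
  filter_upwards [P.ae_edge_mem k] with y hy
  refine Finset.sum_congr rfl fun i _ => ?_
  rw [(classicalPartial_congr (h y hy) i).fderiv_eq]

theorem edgePairing_eq_zero (g : Plane → Plane) {v : Plane → ℝ} {k : Fin P.K}
    (h : ∀ y ∈ P.edge k, v =ᶠ[𝓝 y] fun _ => 0) : P.edgePairing g v k = 0 := by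
  rw [P.edgePairing_congr g h]
  have e : ∀ i, classicalPartial i (fun _ : Plane => (0 : ℝ)) = fun _ => 0 := fun i =>
    funext (classicalPartial_zero i)
  simp [edgePairing, e]

theorem arc_mem_edge {k : Fin P.K} {s : ℝ} (hs : s ∈ Ioo 0 (P.len k)) : P.arc k s ∈ P.edge k :=
  P.mem_edge_iff.2 ⟨s, hs, rfl⟩

theorem hasDerivAt_comp_arc (k : Fin P.K) {f : Plane → ℝ} (hf : ContDiff ℝ ∞ f) (s : ℝ) :
    HasDerivAt (fun s => f (P.arc k s)) (fderiv ℝ f (P.arc k s) (P.tangent k)) s :=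
  (differentiable_of_smooth hf _).hasFDerivAt.comp_hasDerivAt s (P.hasDerivAt_arc k s)

/-- The pairing if the gradient has a constant direction on the edge. -/
theorem edgePairing_eq_integral_deriv (g : Plane → Plane) {v : Plane → ℝ} (hv : ContDiff ℝ ∞ v)
    {k : Fin P.K} {G : ℝ → ℝ} (hG : Differentiable ℝ G) {w : Plane}
    (h : ∀ s ∈ Ioo 0 (P.len k), ∀ i, classicalPartial i v (P.arc k s) = G s * w i) :
    P.edgePairing g v k = ∫ s in Ioo 0 (P.len k), inner ℝ (g (P.arc k s)) w * deriv G s := by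
  rw [edgePairing, P.integral_edge]
  refine setIntegral_congr_fun measurableSet_Ioo fun s hs => ?_
  have e : ∀ i, fderiv ℝ (classicalPartial i v) (P.arc k s) (P.tangent k) = deriv G s * w i := by
    intro i
    have h1 := P.hasDerivAt_comp_arc k (contDiff_classicalPartial hv i) s
    refine h1.unique ?_
    refine ((hG s).hasDerivAt.mul_const (w i)).congr_of_eventuallyEq ?_
    filter_upwards [isOpen_Ioo.mem_nhds hs] with t ht using h t ht i
  simp only [e, Fin.sum_univ_two, inner_plane]
  ring

/-! ### Test functions supported near the interior of an edge -/

/-- The function u is multiplied by a cutoff that is one near the part of the edge above the support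
of χ and zero near all other edges. Elsewhere on edge k the cutoff does not matter, because u
already vanishes nearby. Hence v agrees with u to all orders along the edge. -/
theorem exists_edge_test (k : Fin P.K) {χ : ℝ → ℝ} (hc : HasCompactSupport χ)
    (hs : tsupport χ ⊆ Ioo 0 (P.len k)) {u : Plane → ℝ} (hu : ContDiff ℝ ∞ u)
    (h : ∀ y, inner ℝ (y - P.p k) (P.tangent k) ∉ tsupport χ → u y = 0) :
    ∃ v : Plane → ℝ, ContDiff ℝ ∞ v ∧ (∀ y ∈ P.edge k, v =ᶠ[𝓝 y] u) ∧
      ∀ l, l ≠ k → ∀ y ∈ P.edge l, v =ᶠ[𝓝 y] fun _ => 0 := by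
  have hZ : IsClosed (P.arc k '' tsupport χ) :=
    (hc.isCompact.image (P.isometry_arc k).continuous).isClosed
  obtain ⟨β, hβ, h0, h1⟩ := exists_smooth_separation (P.isClosed_biUnion_seg fun l => l ≠ k) hZ (by
    rw [disjoint_left]
    rintro _ hy ⟨s, hs', rfl⟩
    simp only [mem_iUnion] at hy
    obtain ⟨l, hl, hy⟩ := hy
    exact P.notMem_seg_of_mem_edge hl.symm (P.arc_mem_edge (hs hs')) hy)
  refine ⟨fun y => β y * u y, hβ.mul hu, fun y hy => ?_, fun l hl y hy => ?_⟩
  · obtain ⟨s, -, rfl⟩ := P.mem_edge_iff.1 hy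
    by_cases hst : s ∈ tsupport χ
    · filter_upwards [h1 _ (mem_image_of_mem _ hst)] with z hz
      rw [hz, one_mul]
    · have hcont : Continuous fun y => inner ℝ (y - P.p k) (P.tangent k) := by fun_prop
      have hU := (hcont.isOpen_preimage _ (isClosed_tsupport χ).isOpen_compl).mem_nhds
        (x := P.p k + s • P.tangent k) (by
          rw [mem_preimage, add_sub_cancel_left, real_inner_smul_left, P.inner_tangent_tangent,
            mul_one]
          exact hst)
      filter_upwards [hU] with z hz
      rw [h z hz, mul_zero]
  · filter_upwards [h0 y (mem_iUnion₂.2 ⟨l, hl, P.edge_subset_seg l hy⟩)] with z hz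
    rw [hz, zero_mul]

theorem inner_arc_sub_tangent (k : Fin P.K) (s : ℝ) :
    inner ℝ (P.arc k s - P.p k) (P.tangent k) = s := by
  rw [arc, add_sub_cancel_left, real_inner_smul_left, P.inner_tangent_tangent, mul_one]

theorem inner_arc_sub_normal (k : Fin P.K) (s : ℝ) :
    inner ℝ (P.arc k s - P.p k) (P.normal k) = 0 := by
  rw [arc, add_sub_cancel_left, real_inner_smul_left, P.inner_tangent_normal, mul_zero]

theorem contDiff_inner_sub (p w : Plane) : ContDiff ℝ ∞ fun y : Plane => inner ℝ (y - p) w :=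
  (contDiff_id.sub contDiff_const).inner ℝ contDiff_const

theorem classicalPartial_comp_inner {χ : ℝ → ℝ} (hχ : Differentiable ℝ χ) (p w : Plane)
    (i : Fin 2) (y : Plane) : classicalPartial i (fun y => χ (inner ℝ (y - p) w)) y =
      deriv χ (inner ℝ (y - p) w) * w i := by
  have h1 : HasFDerivAt (fun y : Plane => inner ℝ (y - p) w) (innerSL ℝ w) y := by
    have := ((innerSL ℝ w).hasFDerivAt (x := y)).sub_const (innerSL ℝ w p)
    refine this.congr_of_eventuallyEq (.of_forall fun z => ?_)
    simp only [innerSL_apply_apply, ← inner_sub_right]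
    exact real_inner_comm _ _
  have h2 := ((hχ _).hasDerivAt (x := inner ℝ (y - p) w)).comp_hasFDerivAt y h1
  rw [classicalPartial]
  have h3 := h2.fderiv
  simp only [Function.comp_def] at h3
  rw [h3]
  fin_cases i <;> simp [inner_plane]

variable {P}

/-- The test function is χ(arc length) times the signed distance to the line of the edge. It
vanishes on the edge, hence is allowed on simply supported edges too, and its gradient there is χ n.
-/
theorem integral_inner_normal_mul_deriv_eq_zero {ψ g : Plane → Plane} (hψ : ψ ∈ P.Psi0)
    (hg : P.HasTraceVec ψ g) {k : Fin P.K} (hk : P.bc k ≠ BC.clamped) {χ : ℝ → ℝ}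
    (hχ : ContDiff ℝ ∞ χ) (hc : HasCompactSupport χ) (hs : tsupport χ ⊆ Ioo 0 (P.len k)) :
    ∫ s in Ioo 0 (P.len k), inner ℝ (g (P.arc k s)) (P.normal k) * deriv χ s = 0 := by
  have hχc : ContDiff ℝ ∞ fun y : Plane => χ (inner ℝ (y - P.p k) (P.tangent k)) :=
    hχ.comp (contDiff_inner_sub _ _)
  obtain ⟨v, hv, hvk, hvl⟩ := P.exists_edge_test k hc hs
    (u := fun y => χ (inner ℝ (y - P.p k) (P.tangent k)) * inner ℝ (y - P.p k) (P.normal k))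
    (hχc.mul (contDiff_inner_sub _ _))
    (fun y hy => by rw [image_eq_zero_of_notMem_tsupport hy, zero_mul])
  have hW : v ∈ P.W := by
    refine P.smooth_mem_W hv (fun l hl y hy => ?_) fun l hl y hy => ?_
    · by_cases hlk : l = k
      · subst hlk
        rw [(hvk y hy).eq_of_nhds]
        obtain ⟨s, -, rfl⟩ := P.mem_edge_iff.1 hy
        rw [← arc, P.inner_arc_sub_normal, mul_zero]
      · exact (hvl l hlk y hy).eq_of_nhds
    · rw [(hvl l (by rintro rfl; exact hk hl) y hy).fderiv_eq]
      simp
  have h := sum_edgePairing_eq_zero hψ hg hv hW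
  rw [Finset.sum_eq_single k (fun l _ hl => P.edgePairing_eq_zero g (hvl l hl)) (by simp)] at h
  refine Eq.trans ?_ h
  rw [P.edgePairing_eq_integral_deriv g hv (hχ.differentiable (by simp)) (w := P.normal k)]
  intro s hs' i
  rw [(classicalPartial_congr (hvk _ (P.arc_mem_edge hs')) i).eq_of_nhds,
    classicalPartial_mul hχc (contDiff_inner_sub _ _), P.inner_arc_sub_tangent,
    P.inner_arc_sub_normal, mul_zero, add_zero,
    classicalPartial_comp_inner (χ := fun t => t) differentiable_id]
  simp

/-- The test function is χ(arc length), with gradient χ' t on the edge. It does not vanish there,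
which only a free edge permits. -/
theorem integral_inner_tangent_mul_deriv_deriv_eq_zero {ψ g : Plane → Plane} (hψ : ψ ∈ P.Psi0)
    (hg : P.HasTraceVec ψ g) {k : Fin P.K} (hk : P.bc k = BC.free) {χ : ℝ → ℝ}
    (hχ : ContDiff ℝ ∞ χ) (hc : HasCompactSupport χ) (hs : tsupport χ ⊆ Ioo 0 (P.len k)) :
    ∫ s in Ioo 0 (P.len k), inner ℝ (g (P.arc k s)) (P.tangent k) * deriv (deriv χ) s = 0 := by
  have hχc : ContDiff ℝ ∞ fun y : Plane => χ (inner ℝ (y - P.p k) (P.tangent k)) :=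
    hχ.comp (contDiff_inner_sub _ _)
  obtain ⟨v, hv, hvk, hvl⟩ := P.exists_edge_test k hc hs hχc
    (fun y hy => by rw [image_eq_zero_of_notMem_tsupport hy])
  have hW : v ∈ P.W := by
    refine P.smooth_mem_W hv (fun l hl y hy => ?_) fun l hl y hy => ?_
    · exact (hvl l (by rintro rfl; simp [hk] at hl) y hy).eq_of_nhds
    · rw [(hvl l (by rintro rfl; simp [hk] at hl) y hy).fderiv_eq]
      simp
  have h := sum_edgePairing_eq_zero hψ hg hv hW
  rw [Finset.sum_eq_single k (fun l _ hl => P.edgePairing_eq_zero g (hvl l hl)) (by simp)] at h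
  refine Eq.trans ?_ h
  rw [P.edgePairing_eq_integral_deriv g hv
    ((contDiff_infty_iff_deriv.1 hχ).2.differentiable (by simp)) (w := P.tangent k)]
  intro s hs' i
  rw [(classicalPartial_congr (hvk _ (P.arc_mem_edge hs')) i).eq_of_nhds,
    classicalPartial_comp_inner (hχ.differentiable (by simp)), P.inner_arc_sub_tangent]

end Plate
namespace Plate

variable (P : Plate)

theorem plane_decomposition (k : Fin P.K) (z : Plane) :
    z = (inner ℝ z (P.tangent k) : ℝ) • P.tangent k + (inner ℝ z (P.normal k) : ℝ) • P.normal k := by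
  have h := P.tangent_sq k
  ext i
  fin_cases i
  · simp [inner_plane, normal_zero, normal_one]
    linear_combination (-z 0) * h
  · simp [inner_plane, normal_zero, normal_one]
    linear_combination (-z 1) * h

theorem integrableOn_inner_arc {g : Plane → Plane}
    (hg : ∀ i, MemLp (fun x => g x i) 2 P.boundaryMeasure) (k : Fin P.K) (w : Plane) :
    IntegrableOn (fun s => inner ℝ (g (P.arc k s)) w) (Ioo 0 (P.len k)) := by
  have h : ∀ i, IntegrableOn (fun s => g (P.arc k s) i) (Ioo 0 (P.len k)) := by
    intro i
    have := P.memLp_edge (hg i) k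
    rw [edgeMeasure_eq, (P.measurableEmbedding_arc k).memLp_map_measure_iff] at this
    exact this.integrable (by norm_num)
  simp only [inner_plane]
  exact ((h 0).mul_const _).add ((h 1).mul_const _)

variable {P}

theorem exists_normal_trace_eq_const {ψ g : Plane → Plane} (hψ : ψ ∈ P.Psi0)
    (hg : P.HasTraceVec ψ g) {k : Fin P.K} (hk : P.bc k ≠ BC.clamped) :
    ∃ c, ∀ᵐ y ∂P.edgeMeasure k, inner ℝ (g y) (P.normal k) = c := by
  obtain ⟨c, hc⟩ := ae_eq_const_of_integral_deriv_eq_zero (P.len_pos k)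
    (P.integrableOn_inner_arc (fun i => (hg i).2.1) k (P.normal k))
    fun χ h1 h2 h3 => integral_inner_normal_mul_deriv_eq_zero hψ hg hk h1 h2 h3
  exact ⟨c, (P.ae_edge_iff k).2 hc⟩

/-- The tangential part is a s + d at arc length s and the normal part is a constant c. Since y = p
+ s t on the edge, this is a y + b with b = -a p + d t + c n; the slope a occurs only in the
tangential direction, which is why Raviart–Thomas functions appear. -/
theorem exists_trace_eq_affine {ψ g : Plane → Plane} (hψ : ψ ∈ P.Psi0)
    (hg : P.HasTraceVec ψ g) {k : Fin P.K} (hk : P.bc k = BC.free) :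
    ∃ (a : ℝ) (b : Plane), ∀ᵐ y ∂P.edgeMeasure k, g y = a • y + b := by
  obtain ⟨a, d, had⟩ := ae_eq_affine_of_integral_deriv_deriv_eq_zero (P.len_pos k)
    (P.integrableOn_inner_arc (fun i => (hg i).2.1) k (P.tangent k))
    fun χ h1 h2 h3 => integral_inner_tangent_mul_deriv_deriv_eq_zero hψ hg hk h1 h2 h3
  obtain ⟨c, hc⟩ := exists_normal_trace_eq_const hψ hg (k := k) (by simp [hk])
  refine ⟨a, -(a • P.p k) + d • P.tangent k + c • P.normal k, (P.ae_edge_iff k).2 ?_⟩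
  filter_upwards [had, (P.ae_edge_iff k).1 hc] with s h1 h2
  rw [P.plane_decomposition k (g (P.arc k s)), h1, h2, arc]
  module

variable (P)

/-! ### The pairing on free and simply supported edges -/

theorem arc_zero (k : Fin P.K) : P.arc k 0 = P.p k := by simp [arc]

theorem arc_len (k : Fin P.K) : P.arc k (P.len k) = P.q k := by
  rw [arc, len_smul_tangent, add_sub_cancel]

theorem integral_edge_of_hasDerivAt (k : Fin P.K) {f : Plane → ℝ} {F F' : ℝ → ℝ}
    (h : ∀ s ∈ Ioo 0 (P.len k), f (P.arc k s) = F' s) (hF : ∀ s, HasDerivAt F (F' s) s)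
    (hF' : Continuous F') : ∫ y, f y ∂P.edgeMeasure k = F (P.len k) - F 0 := by
  rw [P.integral_edge, setIntegral_congr_fun measurableSet_Ioo h, ← integral_Ioc_eq_integral_Ioo,
    ← intervalIntegral.integral_of_le (P.len_pos k).le]
  exact intervalIntegral.integral_eq_sub_of_hasDerivAt (fun s _ => hF s)
    (hF'.intervalIntegrable _ _)

/-- The boundary term at `x` for a trace `y ↦ a y + b`. -/
def _root_.KirchhoffPlate.cornerTerm (a : ℝ) (b : Plane) (v : Plane → ℝ) (x : Plane) : ℝ :=
  classicalPartial 0 v x * (a * x 0 + b 0) + classicalPartial 1 v x * (a * x 1 + b 1) - a * v x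

/-- The integrand is the arc length derivative of ∇v · (a y + b) - a v: differentiating a y + b
gives a t, and the resulting a ∂v/∂t is cancelled by the last term. -/
theorem edgePairing_free {g : Plane → Plane} {k : Fin P.K} {a : ℝ} {b : Plane}
    (hg : ∀ᵐ y ∂P.edgeMeasure k, g y = a • y + b) {v : Plane → ℝ} (hv : ContDiff ℝ ∞ v) :
    P.edgePairing g v k = cornerTerm a b v (P.q k) - cornerTerm a b v (P.p k) := by
  rw [P.edgePairing_congr_trace v hg, ← P.arc_zero, ← P.arc_len]
  have hd := contDiff_classicalPartial hv
  have hc : ∀ {f : Plane → ℝ}, ContDiff ℝ ∞ f → Continuous fun s => f (P.arc k s) := fun hf =>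
    hf.continuous.comp (P.isometry_arc k).continuous
  refine P.integral_edge_of_hasDerivAt k (F := fun s => cornerTerm a b v (P.arc k s))
    (F' := fun s => ∑ i, fderiv ℝ (classicalPartial i v) (P.arc k s) (P.tangent k) *
      (a • P.arc k s + b) i) (fun s _ => rfl) (fun s => ?_) ?_
  · have hi : ∀ i, HasDerivAt (fun s => a * P.arc k s i + b i) (a * P.tangent k i) s := by
      intro i
      have h1 : HasDerivAt (fun s => P.arc k s i) (P.tangent k i) s := by
        have := ((hasDerivAt_id s).mul_const (P.tangent k i)).const_add (P.p k i)
        simpa [arc] using this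
      exact (h1.const_mul a).add_const _
    have h := (((P.hasDerivAt_comp_arc k (hd 0) s).mul (hi 0)).add
      ((P.hasDerivAt_comp_arc k (hd 1) s).mul (hi 1))).sub ((P.hasDerivAt_comp_arc k hv s).const_mul a)
    refine h.congr_deriv ?_
    rw [fderiv_apply_eq v, Fin.sum_univ_two]
    simp only [PiLp.add_apply, PiLp.smul_apply, smul_eq_mul]
    ring
  · refine continuous_finsetSum _ fun i _ => (hc (contDiff_fderiv_apply (hd i) _)).mul ?_
    exact (hc (f := fun y => (a • y + b) i) (by
      simp only [PiLp.add_apply, PiLp.smul_apply]; fun_prop))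

/-- Since v vanishes on the edge, so does its second tangential derivative. The unknown tangential
part of the trace drops out, and the constant c multiplies the derivative of ∂v/∂n. -/
theorem edgePairing_simplySupported {g : Plane → Plane} {k : Fin P.K} {c : ℝ}
    (hg : ∀ᵐ y ∂P.edgeMeasure k, inner ℝ (g y) (P.normal k) = c) {v : Plane → ℝ}
    (hv : ContDiff ℝ ∞ v) (h0 : ∀ y ∈ P.edge k, v y = 0) :
    P.edgePairing g v k =
      c * fderiv ℝ v (P.q k) (P.normal k) - c * fderiv ℝ v (P.p k) (P.normal k) := by
  have hd := contDiff_classicalPartial hv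
  have hdir : ∀ w s, HasDerivAt (fun s => fderiv ℝ v (P.arc k s) w)
      (w 0 * fderiv ℝ (classicalPartial 0 v) (P.arc k s) (P.tangent k) +
        w 1 * fderiv ℝ (classicalPartial 1 v) (P.arc k s) (P.tangent k)) s := by
    intro w s
    simp only [fderiv_apply_eq v _ w]
    exact ((P.hasDerivAt_comp_arc k (hd 0) s).const_mul _).add
      ((P.hasDerivAt_comp_arc k (hd 1) s).const_mul _)
  have h1 : ∀ s ∈ Ioo 0 (P.len k), fderiv ℝ v (P.arc k s) (P.tangent k) = 0 := by
    intro s hs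
    refine (P.hasDerivAt_comp_arc k hv s).unique ((hasDerivAt_const s (0 : ℝ)).congr_of_eventuallyEq ?_)
    filter_upwards [isOpen_Ioo.mem_nhds hs] with t ht using h0 _ (P.arc_mem_edge ht)
  have h2 : ∀ s ∈ Ioo 0 (P.len k),
      P.tangent k 0 * fderiv ℝ (classicalPartial 0 v) (P.arc k s) (P.tangent k) +
        P.tangent k 1 * fderiv ℝ (classicalPartial 1 v) (P.arc k s) (P.tangent k) = 0 := by
    intro s hs
    refine (hdir (P.tangent k) s).unique ((hasDerivAt_const s (0 : ℝ)).congr_of_eventuallyEq ?_)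
    filter_upwards [isOpen_Ioo.mem_nhds hs] with t ht using h1 _ ht
  have hcc : ∀ i, Continuous fun s =>
      fderiv ℝ (classicalPartial i v) (P.arc k s) (P.tangent k) := fun i =>
    (contDiff_fderiv_apply (hd i) _).continuous.comp (P.isometry_arc k).continuous
  have hae : ∀ᵐ y ∂P.edgeMeasure k,
      ∑ i, fderiv ℝ (classicalPartial i v) y (P.tangent k) * g y i =
      c * (P.normal k 0 * fderiv ℝ (classicalPartial 0 v) y (P.tangent k) +
        P.normal k 1 * fderiv ℝ (classicalPartial 1 v) y (P.tangent k)) := by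
    filter_upwards [hg, P.ae_edge_mem k] with y hy hye
    obtain ⟨s, hs, rfl⟩ := P.mem_edge_iff.1 hye
    have h3 := h2 s hs
    rw [arc] at h3
    rw [← hy, Fin.sum_univ_two, inner_plane]
    simp only [normal_zero, normal_one] at h3 ⊢
    generalize fderiv ℝ (classicalPartial 0 v) _ _ = A at *
    generalize fderiv ℝ (classicalPartial 1 v) _ _ = B at *
    set G := g (P.p k + s • P.tangent k)
    linear_combination (-(A * G 0 + B * G 1)) * P.tangent_sq k +
      (G 0 * P.tangent k 0 + G 1 * P.tangent k 1) * h3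
  rw [edgePairing, integral_congr_ae hae, ← P.arc_zero, ← P.arc_len]
  exact P.integral_edge_of_hasDerivAt k (F := fun s => c * fderiv ℝ v (P.arc k s) (P.normal k))
    (fun s _ => rfl) (fun s => (hdir (P.normal k) s).const_mul c)
    (continuous_const.mul ((continuous_const.mul (hcc 0)).add (continuous_const.mul (hcc 1))))

/-! ### Corners -/

variable {P}

/-- Two different closed edges meet at most in the end point of one and the starting point of the
other. -/
theorem corner_of_mem_seg {k l : Fin P.K} (h : k ≠ l) {x : Plane} (hk : x ∈ P.seg k)
    (hl : x ∈ P.seg l) : (P.q k = x ∧ P.p l = x) ∨ (P.q l = x ∧ P.p k = x) := by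
  rcases P.seg_eq k hk with hk | hk | hk <;> rcases P.seg_eq l hl with hl' | hl' | hl'
  · exact absurd (P.p_injective (hk.symm.trans hl')) h
  · exact .inr ⟨hl'.symm, hk.symm⟩
  · exact absurd (hk ▸ hl') (P.p_notMem_edge k l)
  · exact .inl ⟨hk.symm, hl'.symm⟩
  · exact absurd (P.q_injective (hk.symm.trans hl')) h
  · exact absurd (hk ▸ hl') (P.q_notMem_edge k l)
  all_goals exact absurd hl (P.notMem_seg_of_mem_edge h hk)

theorem eq_or_eq_of_mem_seg {k l j : Fin P.K} {x : Plane} (hk : P.q k = x) (hl : P.p l = x)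
    (hj : x ∈ P.seg j) : j = k ∨ j = l := by
  rcases P.seg_eq j hj with h | h | h
  · exact .inr (P.p_injective (h.symm.trans hl.symm))
  · exact .inl (P.q_injective (h.symm.trans hk.symm))
  · exact absurd (hk ▸ h) (P.q_notMem_edge k j)

/-- A cutoff isolates the corner x from the far ends of its two edges and from all other edges.
Multiplication preserves the zeros of u, so v still vanishes on a simply supported edge where u
does. -/
theorem exists_corner_test {k l : Fin P.K} {x : Plane} (hk : P.q k = x) (hl : P.p l = x)
    {u : Plane → ℝ} (hu : ContDiff ℝ ∞ u) :
    ∃ v : Plane → ℝ, ContDiff ℝ ∞ v ∧ v =ᶠ[𝓝 x] u ∧ (∀ y, u y = 0 → v y = 0) ∧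
      v =ᶠ[𝓝 (P.p k)] (fun _ => 0) ∧ v =ᶠ[𝓝 (P.q l)] (fun _ => 0) ∧
      ∀ j, j ≠ k → j ≠ l → ∀ y ∈ P.seg j, v =ᶠ[𝓝 y] fun _ => 0 := by
  obtain ⟨β, hβ, h0, h1⟩ := exists_smooth_separation
    (A := (⋃ j, ⋃ _ : j ≠ k ∧ j ≠ l, P.seg j) ∪ {P.p k, P.q l}) (B := {x})
    ((P.isClosed_biUnion_seg _).union (toFinite _).isClosed) isClosed_singleton (by
      rw [disjoint_singleton_right]
      rintro (hx | hx | hx)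
      · simp only [mem_iUnion] at hx
        obtain ⟨j, hj, hx⟩ := hx
        rcases eq_or_eq_of_mem_seg hk hl hx with h | h
        exacts [hj.1 h, hj.2 h]
      · exact P.p_ne_q k (hx.symm.trans hk.symm)
      · exact P.p_ne_q l (hl.trans hx))
  have hz : ∀ y ∈ (⋃ j, ⋃ _ : j ≠ k ∧ j ≠ l, P.seg j) ∪ {P.p k, P.q l},
      (fun y => β y * u y) =ᶠ[𝓝 y] fun _ => 0 := fun y hy => by
    filter_upwards [h0 y hy] with z h
    rw [h, zero_mul]
  refine ⟨fun y => β y * u y, hβ.mul hu, ?_, fun y hy => by simp [hy], hz _ (by simp),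
    hz _ (by simp), fun j h1 h2 y hy => hz y (.inl (mem_iUnion₂.2 ⟨j, ⟨h1, h2⟩, hy⟩))⟩
  filter_upwards [h1 x rfl] with z h
  rw [h, one_mul]

theorem classicalPartial_inner_sub (p w : Plane) (i : Fin 2) (y : Plane) :
    classicalPartial i (fun y => inner ℝ (y - p) w) y = w i := by
  rw [classicalPartial_comp_inner (χ := fun t => t) differentiable_id]
  simp

theorem cornerTerm_congr {a : ℝ} {b : Plane} {v u : Plane → ℝ} {x : Plane} (h : v =ᶠ[𝓝 x] u) :
    cornerTerm a b v x = cornerTerm a b u x := by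
  simp only [cornerTerm, (classicalPartial_congr h _).eq_of_nhds, h.eq_of_nhds]

theorem cornerTerm_zero (a : ℝ) (b x : Plane) : cornerTerm a b (fun _ => 0) x = 0 := by
  simp [cornerTerm, classicalPartial_zero]

theorem edgePairing_add_edgePairing_eq_zero {ψ g : Plane → Plane} (hψ : ψ ∈ P.Psi0)
    (hg : P.HasTraceVec ψ g) {k l : Fin P.K} (hkl : P.q k = P.p l) {v : Plane → ℝ}
    (hv : ContDiff ℝ ∞ v) (hk : P.bc k ≠ BC.clamped) (hl : P.bc l ≠ BC.clamped)
    (hk0 : P.bc k = BC.simplySupported → ∀ y ∈ P.edge k, v y = 0)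
    (hl0 : P.bc l = BC.simplySupported → ∀ y ∈ P.edge l, v y = 0)
    (h0 : ∀ j, j ≠ k → j ≠ l → ∀ y ∈ P.seg j, v =ᶠ[𝓝 y] fun _ => 0) :
    P.edgePairing g v k + P.edgePairing g v l = 0 := by
  have hne : k ≠ l := by rintro rfl; exact P.p_ne_q k hkl.symm
  have hW : v ∈ P.W := by
    refine P.smooth_mem_W hv (fun j hj y hy => ?_) fun j hj y hy => ?_
    · by_cases hjk : j = k
      · subst hjk
        exact hk0 (hj.resolve_left hk) y hy
      by_cases hjl : j = l
      · subst hjl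
        exact hl0 (hj.resolve_left hl) y hy
      exact (h0 j hjk hjl y (P.edge_subset_seg j hy)).eq_of_nhds
    · rw [(h0 j (by rintro rfl; exact hk hj) (by rintro rfl; exact hl hj) y
        (P.edge_subset_seg j hy)).fderiv_eq]
      simp
  rw [← sum_edgePairing_eq_zero hψ hg hv hW, ← Finset.sum_pair hne]
  refine Finset.sum_subset (Finset.subset_univ _) fun j _ hj => ?_
  simp only [Finset.mem_insert, Finset.mem_singleton, not_or] at hj
  exact P.edgePairing_eq_zero g fun y hy => h0 j hj.1 hj.2 y (P.edge_subset_seg j hy)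

/-- The test function is affine near the corner, with arbitrary value α and gradient m. The
difference of the two corner terms must vanish for all α and m: the coefficient of α gives a = a',
and then that of m gives b = b'. -/
theorem free_free_corner {ψ g : Plane → Plane} (hψ : ψ ∈ P.Psi0) (hg : P.HasTraceVec ψ g)
    {k l : Fin P.K} (hkl : P.q k = P.p l) (hk : P.bc k = BC.free) (hl : P.bc l = BC.free)
    {a a' : ℝ} {b b' : Plane} (hgk : ∀ᵐ y ∂P.edgeMeasure k, g y = a • y + b)
    (hgl : ∀ᵐ y ∂P.edgeMeasure l, g y = a' • y + b') : a = a' ∧ b = b' := by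
  have key : ∀ (α : ℝ) (m : Plane),
      m 0 * (a * P.q k 0 + b 0) + m 1 * (a * P.q k 1 + b 1) - a * α =
      m 0 * (a' * P.q k 0 + b' 0) + m 1 * (a' * P.q k 1 + b' 1) - a' * α := by
    intro α m
    have hi := contDiff_inner_sub (P.q k) m
    obtain ⟨v, hv, hvx, -, hv1, hv2, hvj⟩ := exists_corner_test (P := P) rfl hkl.symm
      (u := fun y => α + inner ℝ (y - P.q k) m) (contDiff_const.add hi)
    have h := edgePairing_add_edgePairing_eq_zero hψ hg hkl hv (by simp [hk]) (by simp [hl])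
      (by simp [hk]) (by simp [hl]) hvj
    rw [P.edgePairing_free hgk hv, P.edgePairing_free hgl hv, cornerTerm_congr hv1,
      cornerTerm_congr hv2, cornerTerm_zero, cornerTerm_zero, ← hkl, cornerTerm_congr hvx,
      cornerTerm_congr hvx] at h
    have hp : ∀ i, classicalPartial i (fun y => α + inner ℝ (y - P.q k) m) (P.q k) = m i := by
      intro i
      rw [classicalPartial_add (f := fun _ => α) contDiff_const hi, classicalPartial_inner_sub]
      simp [classicalPartial]
    simp only [cornerTerm, hp] at h
    simp only [sub_self, inner_zero_left, add_zero] at h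
    linarith
  have ha : a = a' := by simpa using key 1 0
  subst ha
  refine ⟨rfl, ?_⟩
  ext i
  fin_cases i
  · simpa [basisVec] using key 0 (basisVec 0)
  · simpa [basisVec] using key 0 (basisVec 1)

/-- Near x the test function is ⟨y - x, n⟩ with the normal of the simply supported edge. It vanishes
on that edge, its normal derivative is one, and at x the corner term of the free edge is (a x +
b)·n. The two orders of the edges at x are treated alike. -/
theorem simplySupported_free_corner {ψ g : Plane → Plane} (hψ : ψ ∈ P.Psi0)
    (hg : P.HasTraceVec ψ g) {k l : Fin P.K} {x : Plane} (hk : P.bc k = BC.simplySupported)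
    (hl : P.bc l = BC.free) (hxk : x ∈ P.seg k) (hxl : x ∈ P.seg l)
    {c a : ℝ} {b : Plane} (hgk : ∀ᵐ y ∂P.edgeMeasure k, inner ℝ (g y) (P.normal k) = c)
    (hgl : ∀ᵐ y ∂P.edgeMeasure l, g y = a • y + b) : c = inner ℝ (a • x + b) (P.normal k) := by
  have hi := contDiff_inner_sub x (P.normal k)
  have hu0 : ∀ y ∈ P.edge k, inner ℝ (y - x) (P.normal k) = 0 := fun y hy =>
    P.inner_normal_of_mem_seg hxk (P.edge_subset_seg k hy)
  have hn : fderiv ℝ (fun y => inner ℝ (y - x) (P.normal k)) x (P.normal k) = 1 := by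
    rw [fderiv_apply_eq]
    simp only [classicalPartial_inner_sub]
    rw [← inner_plane, P.inner_normal_normal]
  have ht : cornerTerm a b (fun y => inner ℝ (y - x) (P.normal k)) x =
      inner ℝ (a • x + b) (P.normal k) := by
    simp only [cornerTerm, classicalPartial_inner_sub]
    simp [inner_plane]
    ring
  have hne : k ≠ l := by rintro rfl; simp [hk] at hl
  rcases corner_of_mem_seg hne hxk hxl with ⟨h1, h2⟩ | ⟨h1, h2⟩
  · obtain ⟨v, hv, hvx, hv0, hv1, hv2, hvj⟩ := exists_corner_test h1 h2 hi
    have h := edgePairing_add_edgePairing_eq_zero hψ hg (h1.trans h2.symm) hv (by simp [hk])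
      (by simp [hl]) (fun _ y hy => hv0 y (hu0 y hy)) (by simp [hl]) hvj
    rw [P.edgePairing_simplySupported hgk hv fun y hy => hv0 y (hu0 y hy),
      P.edgePairing_free hgl hv, h1, h2, hvx.fderiv_eq, hv1.fderiv_eq, cornerTerm_congr hv2,
      cornerTerm_congr hvx, cornerTerm_zero, hn, ht] at h
    simp at h
    linarith
  · obtain ⟨v, hv, hvx, hv0, hv1, hv2, hvj⟩ := exists_corner_test h1 h2 hi
    have h := edgePairing_add_edgePairing_eq_zero hψ hg (h1.trans h2.symm) hv (by simp [hl])
      (by simp [hk]) (by simp [hl]) (fun _ y hy => hv0 y (hu0 y hy)) hvj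
    rw [P.edgePairing_simplySupported hgk hv fun y hy => hv0 y (hu0 y hy),
      P.edgePairing_free hgl hv, h1, h2, hvx.fderiv_eq, hv2.fderiv_eq, cornerTerm_congr hv1,
      cornerTerm_congr hvx, cornerTerm_zero, hn, ht] at h
    simp at h
    linarith

/-! ### Components of the free boundary -/

theorem mem_freeBoundary_iff {x : Plane} :
    x ∈ P.freeBoundary ↔ ∃ k, P.bc k = BC.free ∧ x ∈ P.seg k := by
  simp [freeBoundary, seg]

theorem seg_subset_freeBoundary {k : Fin P.K} (hk : P.bc k = BC.free) :
    P.seg k ⊆ P.freeBoundary := fun _ hx => mem_freeBoundary_iff.2 ⟨k, hk, hx⟩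

theorem isPreconnected_seg (k : Fin P.K) : IsPreconnected (P.seg k) :=
  (convex_segment _ _).isPreconnected

theorem subset_freeBoundary {C : Set Plane} (hC : C ∈ P.freeComponents) : C ⊆ P.freeBoundary := by
  obtain ⟨x, -, rfl⟩ := hC
  exact connectedComponentIn_subset _ _

theorem seg_subset_component {C : Set Plane} (hC : C ∈ P.freeComponents) {k : Fin P.K}
    (hk : P.bc k = BC.free) {y : Plane} (hy : y ∈ P.seg k) (hyC : y ∈ C) : P.seg k ⊆ C := by
  obtain ⟨x, -, rfl⟩ := hC
  rw [connectedComponentIn_eq hyC]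
  exact (isPreconnected_seg k).subset_connectedComponentIn hy (seg_subset_freeBoundary hk)

theorem component_eq_iUnion {C : Set Plane} (hC : C ∈ P.freeComponents) :
    C = ⋃ k, ⋃ _ : P.bc k = BC.free ∧ P.seg k ⊆ C, P.seg k := by
  refine Subset.antisymm (fun x hx => ?_) (iUnion₂_subset fun k hk => hk.2)
  obtain ⟨k, hk, hxk⟩ := mem_freeBoundary_iff.1 (subset_freeBoundary hC hx)
  exact mem_iUnion₂.2 ⟨k, ⟨hk, seg_subset_component hC hk hxk hx⟩, hxk⟩

theorem isClosed_component {C : Set Plane} (hC : C ∈ P.freeComponents) : IsClosed C := by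
  rw [component_eq_iUnion hC]
  exact P.isClosed_biUnion_seg _

theorem free_of_mem_component {C : Set Plane} (hC : C ∈ P.freeComponents) {k : Fin P.K}
    {x : Plane} (hx : x ∈ P.edge k) (hxC : x ∈ C) : P.bc k = BC.free := by
  obtain ⟨l, hl, hxl⟩ := mem_freeBoundary_iff.1 (subset_freeBoundary hC hxC)
  by_cases h : k = l
  · rw [h, hl]
  · exact absurd hxl (P.notMem_seg_of_mem_edge h hx)

/-- Data on the free edges that agree for consecutive edges are constant on the components of the
free boundary. -/
theorem eq_on_component {X : Type*} {F : Fin P.K → X}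
    (hF : ∀ k l, P.bc k = BC.free → P.bc l = BC.free → P.q k = P.p l → F k = F l) {C : Set Plane}
    (hC : C ∈ P.freeComponents) {k l : Fin P.K} (hk : P.bc k = BC.free) (hl : P.bc l = BC.free)
    (hkC : P.seg k ⊆ C) (hlC : P.seg l ⊆ C) : F k = F l := by
  by_contra hne
  have hCp : IsPreconnected C := by
    obtain ⟨x, -, rfl⟩ := hC
    exact isPreconnected_connectedComponentIn
  -- The edges with the same datum as k and those with a different one form two closed sets covering
  -- C. By connectedness they share a point, necessarily a corner of two consecutive free edges.
  obtain ⟨x, -, h1, h2⟩ := isPreconnected_closed_iff.1 hCp _ _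
    (P.isClosed_biUnion_seg fun j => P.bc j = BC.free ∧ F j = F k)
    (P.isClosed_biUnion_seg fun j => P.bc j = BC.free ∧ F j ≠ F k) (fun x hx => by
      obtain ⟨j, hj, hxj⟩ := mem_freeBoundary_iff.1 (subset_freeBoundary hC hx)
      by_cases h : F j = F k
      · exact .inl (mem_iUnion₂.2 ⟨j, ⟨hj, h⟩, hxj⟩)
      · exact .inr (mem_iUnion₂.2 ⟨j, ⟨hj, h⟩, hxj⟩))
    ⟨P.p k, hkC (P.p_mem_seg k), mem_iUnion₂.2 ⟨k, ⟨hk, rfl⟩, P.p_mem_seg k⟩⟩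
    ⟨P.p l, hlC (P.p_mem_seg l), mem_iUnion₂.2 ⟨l, ⟨hl, fun h => hne h.symm⟩, P.p_mem_seg l⟩⟩
  obtain ⟨i, ⟨hi, hFi⟩, hxi⟩ := mem_iUnion₂.1 h1
  obtain ⟨j, ⟨hj, hFj⟩, hxj⟩ := mem_iUnion₂.1 h2
  have hij : i ≠ j := by rintro rfl; exact hFj hFi
  rcases corner_of_mem_seg hij hxi hxj with ⟨h3, h4⟩ | ⟨h3, h4⟩
  · exact hFj ((hF i j hi hj (h3.trans h4.symm)).symm.trans hFi)
  · exact hFj ((hF j i hj hi (h3.trans h4.symm)).trans hFi)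

/-- A function in `Ψ₀` satisfies the boundary conditions. -/
theorem exists_compatible_of_mem_Psi0 {ψ : Plane → Plane} (hψ : ψ ∈ P.Psi0) :
    ∃ c r, P.IsCompatible c r ∧ P.SatisfiesBC ψ c r := by
  choose g' hg' using fun i => P.exists_hasTraceWith (hψ.1 i)
  set g : Plane → Plane := fun x => WithLp.toLp 2 fun i => g' i x with hgdef
  have hg : P.HasTraceVec ψ g := fun i => (hg' i).hasTrace (hψ.1 i)
  have hc : ∀ k, ∃ c, P.bc k ≠ BC.clamped →
      ∀ᵐ y ∂P.edgeMeasure k, inner ℝ (g y) (P.normal k) = c := fun k => by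
    by_cases hk : P.bc k = BC.clamped
    · exact ⟨0, fun h => absurd hk h⟩
    · obtain ⟨c, hc⟩ := exists_normal_trace_eq_const hψ hg hk
      exact ⟨c, fun _ => hc⟩
  have hr : ∀ k, ∃ ab : ℝ × Plane, P.bc k = BC.free →
      ∀ᵐ y ∂P.edgeMeasure k, g y = ab.1 • y + ab.2 := fun k => by
    by_cases hk : P.bc k = BC.free
    · obtain ⟨a, b, hab⟩ := exists_trace_eq_affine hψ hg hk
      exact ⟨(a, b), fun _ => hab⟩
    · exact ⟨0, fun h => absurd h hk⟩
  choose c hc using hc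
  choose ab hab using hr
  have hF : ∀ k l, P.bc k = BC.free → P.bc l = BC.free → P.q k = P.p l → ab k = ab l := by
    intro k l hk hl hkl
    obtain ⟨h1, h2⟩ := free_free_corner hψ hg hkl hk hl (hab k hk) (hab l hl)
    exact Prod.ext h1 h2
  have hab' : ∀ C, ∃ d : ℝ × Plane, C ∈ P.freeComponents →
      ∀ k, P.bc k = BC.free → P.seg k ⊆ C → ab k = d := by
    intro C
    by_cases h : C ∈ P.freeComponents ∧ ∃ k, P.bc k = BC.free ∧ P.seg k ⊆ C
    · obtain ⟨hC, k, hk, hkC⟩ := h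
      exact ⟨ab k, fun _ l hl hlC => eq_on_component hF hC hl hk hlC hkC⟩
    · exact ⟨0, fun hC k hk hkC => absurd ⟨hC, k, hk, hkC⟩ h⟩
  choose d hd using hab'
  refine ⟨c, fun C x => (d C).1 • x + (d C).2, ⟨fun C _ => ⟨_, _, rfl⟩, ?_⟩, g, hg,
    fun k hk => hc k (by simp [hk]), fun C hC => ?_⟩
  · intro k hk C hC x hx hxk
    obtain ⟨l, hl, hxl⟩ := mem_freeBoundary_iff.1 (subset_freeBoundary hC hx)
    have hxk' : x ∈ P.seg k := by
      rcases hxk with rfl | rfl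
      exacts [P.p_mem_seg k, P.q_mem_seg k]
    change c k = inner ℝ ((d C).1 • x + (d C).2) (P.normal k)
    rw [← hd C hC l hl (seg_subset_component hC hl hxl hx)]
    exact simplySupported_free_corner hψ hg hk hl hxk' hxl (hc k (by simp [hk])) (hab l hl)
  · rw [ae_restrict_iff' (isClosed_component hC).measurableSet, P.ae_boundary_iff]
    intro k
    by_cases hk : P.bc k = BC.free
    · filter_upwards [hab k hk, P.ae_edge_mem k] with y hy hyk hyC
      rw [hy, hd C hC k hk (seg_subset_component hC hk (P.edge_subset_seg k hyk) hyC)]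
    · filter_upwards [P.ae_edge_mem k] with y hyk hyC
      exact absurd (free_of_mem_component hC hyk hyC) hk

end Plate
-- Smooth extension of compatible boundary data.
namespace Plate

variable {P : Plate}

/-- Parallel tangents would be equal or opposite. Opposite ones are impossible because the cone
direction has positive product with both normals (no cusps), and equal ones are excluded by
maximality of the edges. -/
theorem normal_det_ne_zero {k l : Fin P.K} (hkl : P.q k = P.p l) (hbc : P.bc k = P.bc l) :
    P.normal k 0 * P.normal l 1 - P.normal k 1 * P.normal l 0 ≠ 0 := by
  intro hD
  have hne : P.tangent k ≠ P.tangent l := P.maximal k l hkl hbc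
  obtain ⟨d, δ, ρ, hc⟩ := P.exists_isCone (P.q k)
  have h1 := hc.inner_normal_pos (P.q_mem_seg k)
  have h2 := hc.inner_normal_pos (k := l) (hkl ▸ P.p_mem_seg l)
  have hk := P.tangent_sq k
  have hl := P.tangent_sq l
  rw [inner_plane] at h1 h2
  simp only [normal_zero, normal_one] at h1 h2 hD
  generalize P.tangent k = s at *
  generalize P.tangent l = t at *
  have e0 : s 0 = (s 0 * t 0 + s 1 * t 1) * t 0 := by
    linear_combination (-s 0) * hl + t 1 * hD
  have e1 : s 1 = (s 0 * t 0 + s 1 * t 1) * t 1 := by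
    linear_combination (-s 1) * hl - t 0 * hD
  set m := s 0 * t 0 + s 1 * t 1 with hm
  have hm2 : m * m = 1 := by
    have : s 0 ^ 2 + s 1 ^ 2 = m * m * (t 0 ^ 2 + t 1 ^ 2) := by
      conv_lhs => rw [e0, e1]
      ring
    rw [hk, hl, mul_one] at this
    exact this.symm
  have hmp : 0 < m := by
    have h3 : d 0 * s 1 + d 1 * -s 0 = m * (d 0 * t 1 + d 1 * -t 0) := by
      conv_lhs => rw [e0, e1]
      ring
    rw [h3] at h1
    by_contra hm0
    exact absurd h1 (not_lt.2 (mul_nonpos_of_nonpos_of_nonneg (not_lt.1 hm0) h2.le))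
  have hm1 : m = 1 := by nlinarith
  rw [hm1, one_mul] at e0 e1
  refine hne ?_
  ext i
  fin_cases i
  exacts [e0, e1]

theorem exists_inner_normal_eq (c : Fin P.K → ℝ) {k l : Fin P.K} (hkl : P.q k = P.p l)
    (hbc : P.bc k = P.bc l) :
    ∃ z : Plane, inner ℝ z (P.normal k) = c k ∧ inner ℝ z (P.normal l) = c l := by
  have hD := normal_det_ne_zero hkl hbc
  set D := P.normal k 0 * P.normal l 1 - P.normal k 1 * P.normal l 0
  refine ⟨!₂[(c k * P.normal l 1 - c l * P.normal k 1) / D,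
    (P.normal k 0 * c l - P.normal l 0 * c k) / D], ?_, ?_⟩
  · simp only [inner_plane, Matrix.cons_val_zero, Matrix.cons_val_one]
    field_simp
    ring
  · simp only [inner_plane, Matrix.cons_val_zero, Matrix.cons_val_one]
    field_simp
    ring

/-- At most two edges pass through x. Two simply supported ones give a regular linear system, and
for a single one z = c n does. -/
theorem exists_inner_normal_eq_at (c : Fin P.K → ℝ) (x : Plane) : ∃ z : Plane, ∀ k,
    P.bc k = BC.simplySupported → x ∈ P.seg k → inner ℝ z (P.normal k) = c k := by
  by_cases h : ∃ k, P.bc k = BC.simplySupported ∧ x ∈ P.seg k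
  · obtain ⟨k, hk, hxk⟩ := h
    by_cases h' : ∃ l, l ≠ k ∧ P.bc l = BC.simplySupported ∧ x ∈ P.seg l
    · obtain ⟨l, hlk, hl, hxl⟩ := h'
      have key : ∀ {i j : Fin P.K}, P.q i = x → P.p j = x → P.bc i = BC.simplySupported →
          P.bc j = BC.simplySupported → ∃ z : Plane, ∀ k, P.bc k = BC.simplySupported →
          x ∈ P.seg k → inner ℝ z (P.normal k) = c k := by
        intro i j hi hj hbi hbj
        obtain ⟨z, hz1, hz2⟩ := exists_inner_normal_eq c (hi.trans hj.symm) (hbi.trans hbj.symm)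
        refine ⟨z, fun m _ hxm => ?_⟩
        rcases eq_or_eq_of_mem_seg hi hj hxm with rfl | rfl
        exacts [hz1, hz2]
      rcases corner_of_mem_seg hlk hxl hxk with ⟨h1, h2⟩ | ⟨h1, h2⟩
      exacts [key h1 h2 hl hk, key h1 h2 hk hl]
    · refine ⟨c k • P.normal k, fun l hl hxl => ?_⟩
      obtain rfl : l = k := by
        by_contra hlk
        exact h' ⟨l, hlk, hl, hxl⟩
      rw [real_inner_smul_left, P.inner_normal_normal, mul_one]
  · exact ⟨0, fun k hk hxk => absurd ⟨k, hk, hxk⟩ h⟩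

/-- Compatible boundary data are attained by a smooth function. -/
theorem exists_smooth_of_compatible {c : Fin P.K → ℝ} {r : Set Plane → Plane → Plane}
    (h : P.IsCompatible c r) : ∃ ψ : Plane → Plane, ContDiff ℝ ∞ ψ ∧
      (∀ k, P.bc k = BC.simplySupported → ∀ y ∈ P.edge k, inner ℝ (ψ y) (P.normal k) = c k) ∧
      ∀ C ∈ P.freeComponents, ∀ y ∈ C, ψ y = r C y := by
  -- The admissible values at y are given by affine equations, so local smooth selections can be
  -- averaged. Only open simply supported edges are constrained; their end points are covered by the
  -- compatibility conditions.
  set t : Plane → Set Plane := fun y => {z | (∀ k, P.bc k = BC.simplySupported → y ∈ P.edge k →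
    inner ℝ z (P.normal k) = c k) ∧ ∀ C ∈ P.freeComponents, y ∈ C → z = r C y} with htdef
  have ht : ∀ y, Convex ℝ (t y) := by
    rintro y z ⟨h1, h2⟩ z' ⟨h1', h2'⟩ a b - - hab
    refine ⟨fun k hk hy => ?_, fun C hC hy => ?_⟩
    · rw [inner_add_left, real_inner_smul_left, real_inner_smul_left, h1 k hk hy, h1' k hk hy,
        ← add_mul, hab, one_mul]
    · rw [h2 C hC hy, h2' C hC hy, ← add_smul, hab, one_smul]
  have hloc : ∀ x, ∃ U ∈ 𝓝 x, ∃ g : Plane → Plane,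
      ContMDiffOn (modelWithCornersSelf ℝ Plane) (modelWithCornersSelf ℝ Plane) ∞ g U ∧
      ∀ y ∈ U, g y ∈ t y := by
    intro x
    obtain ⟨ρ, hρ, hb⟩ := P.exists_ball_disjoint_segs x
    refine ⟨Metric.ball x ρ, Metric.ball_mem_nhds x hρ, ?_⟩
    have hseg : ∀ y ∈ Metric.ball x ρ, ∀ l, y ∈ P.seg l → x ∈ P.seg l := fun y hy l hl => by
      by_contra hx
      exact hb l hx y hy hl
    by_cases hx : x ∈ P.freeBoundary
    · set C₀ := connectedComponentIn P.freeBoundary x with hC₀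
      have hC₀m : C₀ ∈ P.freeComponents := ⟨x, hx, rfl⟩
      have hxC₀ : x ∈ C₀ := mem_connectedComponentIn hx
      obtain ⟨a, b, hr⟩ := h.1 C₀ hC₀m
      -- Near a free component its own function is taken. On a simply supported edge ending at x it
      -- has the right normal component: (a y + b)·n is constant along the edge, and at x it equals
      -- c by compatibility.
      refine ⟨r C₀, ?_, fun y hy => ⟨fun k hk hyk => ?_, fun C hC hyC => ?_⟩⟩
      · rw [hr]
        have : ContDiff ℝ ∞ fun y : Plane => a • y + b := by fun_prop
        exact this.contMDiff.contMDiffOn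
      · have hxk := hseg y hy k (P.edge_subset_seg k hyk)
        have hxe : x = P.p k ∨ x = P.q k := by
          rcases P.seg_eq k hxk with h' | h' | h'
          · exact .inl h'
          · exact .inr h'
          · have := free_of_mem_component hC₀m h' hxC₀
            simp [hk] at this
        rw [h.2 k hk C₀ hC₀m x hxC₀ hxe, hr]
        have h0 := P.inner_normal_of_mem_seg hxk (P.edge_subset_seg k hyk)
        have e : a • y + b = a • (y - x) + (a • x + b) := by module
        change inner ℝ (a • y + b) (P.normal k) = inner ℝ (a • x + b) (P.normal k)
        rw [e, inner_add_left, real_inner_smul_left, h0, mul_zero, zero_add]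
      · obtain ⟨j, hj, hyj⟩ := mem_freeBoundary_iff.1 (subset_freeBoundary hC hyC)
        have hxC := seg_subset_component hC hj hyj hyC (hseg y hy j hyj)
        obtain ⟨z, hz, rfl⟩ := hC
        rw [hC₀, connectedComponentIn_eq hxC]
    · obtain ⟨z, hz⟩ := exists_inner_normal_eq_at c x
      refine ⟨fun _ => z, contMDiffOn_const, fun y hy => ⟨fun k hk hyk =>
        hz k hk (hseg y hy k (P.edge_subset_seg k hyk)), fun C hC hyC => ?_⟩⟩
      obtain ⟨j, hj, hyj⟩ := mem_freeBoundary_iff.1 (subset_freeBoundary hC hyC)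
      exact absurd (seg_subset_freeBoundary hj (hseg y hy j hyj)) hx
  obtain ⟨ψ, hψ⟩ := exists_contMDiffMap_forall_mem_convex_of_local (n := ⊤)
    (modelWithCornersSelf ℝ Plane) ht hloc
  exact ⟨ψ, ψ.contMDiff.contDiff, fun k hk y hy => (hψ y).1 k hk hy, fun C hC y hy =>
    (hψ y).2 C hC hy⟩

/-- Constants on the free edges that agree for consecutive edges are attained by a smooth
function. -/
theorem exists_smooth_eq_on_free {a : Fin P.K → ℝ}
    (ha : ∀ k l, P.bc k = BC.free → P.bc l = BC.free → P.q k = P.p l → a k = a l) :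
    ∃ η : Plane → ℝ, ContDiff ℝ ∞ η ∧ ∀ k, P.bc k = BC.free → ∀ y ∈ P.seg k, η y = a k := by
  set t : Plane → Set ℝ := fun y => {z | ∀ k, P.bc k = BC.free → y ∈ P.seg k → z = a k} with htdef
  have ht : ∀ y, Convex ℝ (t y) := by
    intro y z h1 z' h1' α β _ _ hαβ k hk hy
    rw [h1 k hk hy, h1' k hk hy, ← add_smul, hαβ, one_smul]
  have hloc : ∀ x, ∃ c : ℝ, ∀ᶠ y in 𝓝 x, c ∈ t y := by
    intro x
    obtain ⟨ρ, hρ, hb⟩ := P.exists_ball_disjoint_segs x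
    have hseg : ∀ y ∈ Metric.ball x ρ, ∀ l, y ∈ P.seg l → x ∈ P.seg l := fun y hy l hl => by
      by_contra hx
      exact hb l hx y hy hl
    by_cases h : ∃ k, P.bc k = BC.free ∧ x ∈ P.seg k
    · obtain ⟨k, hk, hxk⟩ := h
      refine ⟨a k, ?_⟩
      filter_upwards [Metric.ball_mem_nhds x hρ] with y hy l hl hyl
      by_cases hkl : k = l
      · rw [hkl]
      rcases corner_of_mem_seg hkl hxk (hseg y hy l hyl) with ⟨h1, h2⟩ | ⟨h1, h2⟩
      · exact ha k l hk hl (h1.trans h2.symm)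
      · exact (ha l k hl hk (h1.trans h2.symm)).symm
    · refine ⟨0, ?_⟩
      filter_upwards [Metric.ball_mem_nhds x hρ] with y hy l hl hyl
      exact absurd ⟨l, hl, hseg y hy l hyl⟩ h
  obtain ⟨η, hη⟩ := exists_contMDiffMap_forall_mem_convex_of_local_const (n := ⊤)
    (modelWithCornersSelf ℝ Plane) ht hloc
  exact ⟨η, η.contMDiff.contDiff, fun k hk y hy => hη y k hk hy⟩

theorem contDiff_coord {ψ : Plane → Plane} (hψ : ContDiff ℝ ∞ ψ) (i : Fin 2) :
    ContDiff ℝ ∞ fun x => ψ x i :=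
  (EuclideanSpace.proj i : Plane →L[ℝ] ℝ).contDiff.comp hψ

theorem exists_satisfiesBC {c : Fin P.K → ℝ} {r : Set Plane → Plane → Plane}
    (h : P.IsCompatible c r) : ∃ ψ, MemH1Vec P.Ω ψ ∧ P.SatisfiesBC ψ c r := by
  obtain ⟨ψ, hψ, h1, h2⟩ := exists_smooth_of_compatible h
  refine ⟨ψ, fun i => P.memH1_smooth (contDiff_coord hψ i), ψ,
    fun i => P.hasTrace_smooth (contDiff_coord hψ i), fun k hk => ?_, fun C hC => ?_⟩
  · filter_upwards [P.ae_edge_mem k] with y hy using h1 k hk y hy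
  · rw [ae_restrict_iff' (isClosed_component hC).measurableSet]
    exact .of_forall fun y hy => h2 C hC y hy

end Plate
namespace Plate

variable {P : Plate}

/-! ### Linear combinations of the components of a vector field -/

theorem HasTraceWith.dir {u g : Fin 2 → Plane → ℝ} {du : Fin 2 → Fin 2 → Plane → ℝ}
    (h : ∀ i, P.HasTraceWith (u i) (du i) (g i)) (e : Plane) :
    P.HasTraceWith (fun x => e 0 * u 0 x + e 1 * u 1 x)
      (fun j x => e 0 * du 0 j x + e 1 * du 1 j x) (fun x => e 0 * g 0 x + e 1 * g 1 x) :=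
  ((h 0).const_mul (e 0)).add ((h 1).const_mul (e 1))

theorem integrable_jac {a b : Fin 2 → Plane → ℝ} (ha : ∀ j, MemLp (a j) 2 (volume.restrict P.Ω))
    (hb : ∀ j, MemLp (b j) 2 (volume.restrict P.Ω)) :
    Integrable (fun y => a 1 y * b 0 y - a 0 y * b 1 y) (volume.restrict P.Ω) :=
  ((ha 1).integrable_fun_mul (hb 0)).sub ((ha 0).integrable_fun_mul (hb 1))

theorem jac_add {a a' b : Fin 2 → Plane → ℝ} (ha : ∀ j, MemLp (a j) 2 (volume.restrict P.Ω))
    (ha' : ∀ j, MemLp (a' j) 2 (volume.restrict P.Ω))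
    (hb : ∀ j, MemLp (b j) 2 (volume.restrict P.Ω)) :
    P.jac (fun j x => a j x + a' j x) b = P.jac a b + P.jac a' b := by
  rw [jac, jac, jac, ← integral_add (integrable_jac ha hb) (integrable_jac ha' hb)]
  congr 1
  ext x
  ring

theorem jac_const_mul (c : ℝ) (a b : Fin 2 → Plane → ℝ) :
    P.jac (fun j x => c * a j x) b = c * P.jac a b := by
  rw [jac, jac, ← integral_const_mul]
  congr 1
  ext x
  ring

/-- The sum over components is invariant under rotation of the frame in which the values are
expressed, so the normal and tangential components on an edge can be treated separately. -/
theorem sum_jac_eq {A B : Fin 2 → Fin 2 → Plane → ℝ}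
    (hA : ∀ i j, MemLp (A i j) 2 (volume.restrict P.Ω))
    (hB : ∀ i j, MemLp (B i j) 2 (volume.restrict P.Ω)) (k : Fin P.K) :
    ∑ i, P.jac (A i) (B i) =
      P.jac (fun j x => P.normal k 0 * A 0 j x + P.normal k 1 * A 1 j x)
        (fun j x => P.normal k 0 * B 0 j x + P.normal k 1 * B 1 j x) +
      P.jac (fun j x => P.tangent k 0 * A 0 j x + P.tangent k 1 * A 1 j x)
        (fun j x => P.tangent k 0 * B 0 j x + P.tangent k 1 * B 1 j x) := by
  have hc : ∀ {F : Fin 2 → Fin 2 → Plane → ℝ}, (∀ i j, MemLp (F i j) 2 (volume.restrict P.Ω)) →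
      ∀ (e : Plane) (j : Fin 2),
        MemLp (fun x => e 0 * F 0 j x + e 1 * F 1 j x) 2 (volume.restrict P.Ω) :=
    fun hF e j => ((hF 0 j).const_mul _).add ((hF 1 j).const_mul _)
  rw [Fin.sum_univ_two]
  simp only [jac]
  rw [← integral_add (integrable_jac (hA 0) (hB 0)) (integrable_jac (hA 1) (hB 1))]
  refine Eq.trans ?_ (integral_add (integrable_jac (hc hA (P.normal k)) (hc hB (P.normal k)))
    (integrable_jac (hc hA (P.tangent k)) (hc hB (P.tangent k))))
  congr 1
  ext x
  rw [normal_zero, normal_one]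
  linear_combination (-(A 0 1 x * B 0 0 x - A 0 0 x * B 0 1 x + (A 1 1 x * B 1 0 x -
    A 1 0 x * B 1 1 x))) * P.tangent_sq k

/-- The support of f meets no closed edge other than k. Hence either the product of f and u has zero
trace on all of Γ, or w has zero trace wherever f matters. -/
theorem jac_localized_eq_zero {u g w h : Plane → ℝ} {du dw : Fin 2 → Plane → ℝ}
    (hu : P.HasTraceWith u du g) (hw : P.HasTraceWith w dw h) {k : Fin P.K}
    (hgh : (∀ᵐ y ∂P.edgeMeasure k, g y = 0) ∨ ∀ᵐ y ∂P.edgeMeasure k, h y = 0) {f : Plane → ℝ}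
    (hf : ContDiff ℝ ∞ f) (hs : ∀ l, l ≠ k → ∀ y ∈ tsupport f, y ∉ P.seg l) :
    P.jac (fun j x => f x * du j x + classicalPartial j f x * u x) dw = 0 := by
  rcases hgh with hg | hh
  · refine (hu.smooth_mul hf).jac_eq_zero hw (P.ae_boundary_iff.2 fun l => ?_)
    by_cases hl : l = k
    · subst hl
      filter_upwards [hg] with y hy
      rw [hy, mul_zero]
    · filter_upwards [P.ae_edge_mem l] with y hy
      rw [image_eq_zero_of_notMem_tsupport fun h' => hs l hl y h' (P.edge_subset_seg l hy), zero_mul]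
  · refine hu.jac_smooth_mul_eq_zero hw hf (P.ae_boundary_iff.2 fun l => ?_)
    by_cases hl : l = k
    · subst hl
      exact hh.mono fun y hy _ => hy
    · filter_upwards [P.ae_edge_mem l] with y hy h'
      exact absurd (P.edge_subset_seg l hy) (hs l hl y h')

/-- The critical term is the gradient of the cutoff times u b. Boundedness of u makes u b square
integrable, so the zero capacity of points applies; for u merely in L² this argument is not
available. -/
theorem tendsto_jac_pointCutoff {u : Plane → ℝ} {du b : Fin 2 → Plane → ℝ} {M : ℝ}
    (hu : AEStronglyMeasurable u (volume.restrict P.Ω))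
    (hM : ∀ᵐ x ∂volume.restrict P.Ω, |u x| ≤ M)
    (hdu : ∀ j, MemLp (du j) 2 (volume.restrict P.Ω))
    (hb : ∀ j, MemLp (b j) 2 (volume.restrict P.Ω)) (x : Plane) {f : Plane → ℝ}
    (hf : ContDiff ℝ ∞ f) :
    Tendsto (fun m => P.jac (fun j y => (pointCutoff x m y * f y) * du j y +
      classicalPartial j (fun y => pointCutoff x m y * f y) y * u y) b) atTop (𝓝 0) := by
  have hdf := fun j => contDiff_classicalPartial hf j
  have hub : ∀ {e : Plane → ℝ}, MemLp e 2 (volume.restrict P.Ω) →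
      MemLp (fun y => u y * e y) 2 (volume.restrict P.Ω) := fun he => he.bdd_mul_of_le hu hM
  have hsm : ∀ {φ e : Plane → ℝ}, ContDiff ℝ ∞ φ → MemLp e 2 (volume.restrict P.Ω) →
      MemLp (fun y => φ y * e y) 2 (volume.restrict P.Ω) := fun hφ he =>
    (tendstoL2_const he |>.smooth_mul P.compactlyCarried_volume hφ.continuous).memLp_lim
  have hV : ∀ j, MemLp (fun y => f y * (u y * b j y)) 2 (volume.restrict P.Ω) := fun j =>
    hsm hf (hub (hb j))
  set U : Plane → ℝ := fun y => f y * (du 1 y * b 0 y - du 0 y * b 1 y) +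
    (classicalPartial 1 f y * (u y * b 0 y) - classicalPartial 0 f y * (u y * b 1 y)) with hU
  have hUi : Integrable U (volume.restrict P.Ω) := by
    have h1 : Integrable (fun y => (f y * du 1 y) * b 0 y - (f y * du 0 y) * b 1 y)
        (volume.restrict P.Ω) :=
      ((hsm hf (hdu 1)).integrable_fun_mul (hb 0)).sub ((hsm hf (hdu 0)).integrable_fun_mul (hb 1))
    have h2 := ((P.memLp_volume (hdf 1)).integrable_fun_mul (hub (hb 0))).sub
      ((P.memLp_volume (hdf 0)).integrable_fun_mul (hub (hb 1)))
    refine (h1.add h2).congr (.of_forall fun y => ?_)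
    simp only [hU, Pi.add_apply, Pi.sub_apply]
    ring
  have hx : ∀ᵐ y ∂volume.restrict P.Ω, y ≠ x :=
    ae_restrict_of_ae (by simp [ae_iff])
  have t := (tendsto_integral_pointCutoff_mul hx hUi).add
    ((tendsto_integral_classicalPartial_pointCutoff_mul x 1 (hV 0)).sub
      (tendsto_integral_classicalPartial_pointCutoff_mul x 0 (hV 1)))
  rw [sub_zero, add_zero] at t
  refine t.congr fun m => ?_
  have hp := contDiff_pointCutoff x m
  have i1 : Integrable (fun y => pointCutoff x m y * U y) (volume.restrict P.Ω) :=
    hUi.bdd_mul (c := 1) hp.continuous.aestronglyMeasurable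
      (.of_forall fun y => abs_pointCutoff_le x m y)
  have i2 : ∀ i j, Integrable (fun y => classicalPartial i (pointCutoff x m) y *
      (f y * (u y * b j y))) (volume.restrict P.Ω) := fun i j =>
    (P.memLp_volume (contDiff_classicalPartial hp i)).integrable_fun_mul (hV j)
  rw [← integral_sub (i2 1 0) (i2 0 1)]
  refine (integral_add i1 ((i2 1 0).sub (i2 0 1))).symm.trans ?_
  rw [jac]
  congr 1
  ext y
  simp only [classicalPartial_mul hp hf, hU, Pi.sub_apply]
  ring

/-- The boundary pairing of two vector fields vanishes if in the normal and in the tangential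
direction of each edge one of the traces vanishes, and if the first field is bounded. -/
theorem sum_jac_eq_zero_of_bounded {u g w h : Fin 2 → Plane → ℝ} {du dw : Fin 2 → Fin 2 → Plane → ℝ}
    (hu : ∀ i, P.HasTraceWith (u i) (du i) (g i)) (hw : ∀ i, P.HasTraceWith (w i) (dw i) (h i))
    (hn : ∀ k, (∀ᵐ y ∂P.edgeMeasure k, P.normal k 0 * g 0 y + P.normal k 1 * g 1 y = 0) ∨
      ∀ᵐ y ∂P.edgeMeasure k, P.normal k 0 * h 0 y + P.normal k 1 * h 1 y = 0)
    (ht : ∀ k, (∀ᵐ y ∂P.edgeMeasure k, P.tangent k 0 * g 0 y + P.tangent k 1 * g 1 y = 0) ∨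
      ∀ᵐ y ∂P.edgeMeasure k, P.tangent k 0 * h 0 y + P.tangent k 1 * h 1 y = 0)
    {M : ℝ} (hM : ∀ i x, |u i x| ≤ M) : ∑ i, P.jac (du i) (dw i) = 0 := by
  have hsmul : ∀ {f : Plane → ℝ}, ContDiff ℝ ∞ f → ∀ i j,
      MemLp (fun x => f x * du i j x + classicalPartial j f x * u i x) 2 (volume.restrict P.Ω) :=
    fun hf i => ((hu i).smooth_mul hf).memLp_partial
  obtain ⟨η, hη, hηc, hη1⟩ := P.exists_cutoff
  have key := smooth_removable (L := fun f => ∑ i,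
    P.jac (fun j x => f x * du i j x + classicalPartial j f x * u i x) (dw i)) P.finite_corners
    (fun f f' hf hf' _ _ => by
      rw [← Finset.sum_add_distrib]
      refine Finset.sum_congr rfl fun i _ => ?_
      rw [← jac_add (hsmul hf i) (hsmul hf' i) (hw i).memLp_partial]
      congr 1
      ext j x
      rw [classicalPartial_add hf hf']
      ring)
    (fun x hx => by
      obtain ⟨ρ, hρ, hb⟩ := P.exists_ball_disjoint_segs x
      refine ⟨Metric.ball x ρ, Metric.ball_mem_nhds x hρ, fun f hf _ hs => ?_⟩
      by_cases hxk : ∃ k, x ∈ P.seg k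
      · obtain ⟨k, hxk⟩ := hxk
        have hxe : x ∈ P.edge k := by
          rcases P.seg_eq k hxk with h' | h' | h'
          · exact absurd (.inl ⟨k, h'.symm⟩) hx
          · exact absurd (.inr ⟨k, h'.symm⟩) hx
          · exact h'
        have hsl : ∀ l, l ≠ k → ∀ y ∈ tsupport f, y ∉ P.seg l := fun l hl y hy =>
          hb l (P.notMem_seg_of_mem_edge hl.symm hxe) y (hs hy)
        -- Only edge k is near x, so its frame serves on the whole support of f, and in each of its
        -- two directions one of the traces vanishes.
        rw [sum_jac_eq (hsmul hf) (fun i => (hw i).memLp_partial) k]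
        have e : ∀ d : Plane, (fun j x =>
            d 0 * (f x * du 0 j x + classicalPartial j f x * u 0 x) +
              d 1 * (f x * du 1 j x + classicalPartial j f x * u 1 x)) =
            fun j x => f x * (d 0 * du 0 j x + d 1 * du 1 j x) +
              classicalPartial j f x * (d 0 * u 0 x + d 1 * u 1 x) := fun d => by
          ext j x; ring
        rw [e, e, jac_localized_eq_zero (HasTraceWith.dir hu _) (HasTraceWith.dir hw _) (hn k) hf hsl,
          jac_localized_eq_zero (HasTraceWith.dir hu _) (HasTraceWith.dir hw _) (ht k) hf hsl,
          add_zero]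
      · refine Finset.sum_eq_zero fun i _ => (hu i).jac_smooth_mul_eq_zero (hw i) hf ?_
        refine P.ae_boundary_iff.2 fun l => ?_
        filter_upwards [P.ae_edge_mem l] with y hy h'
        exact absurd (P.edge_subset_seg l hy) (hb l (fun h'' => hxk ⟨l, h''⟩) y (hs h')))
    (fun x _ f hf _ => by
      have := tendsto_finsetSum Finset.univ fun i _ => tendsto_jac_pointCutoff (P := P)
        (hu i).memLp.1 (.of_forall (hM i)) (hu i).memLp_partial (hw i).memLp_partial x hf
      simpa using this)
    η hη hηc
  rw [← key]
  refine Finset.sum_congr rfl fun i _ => jac_congr (fun j => ?_) fun _ => ae_eq_refl _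
  filter_upwards [ae_restrict_mem P.isOpen.measurableSet] with x hx
  have h1 := hη1 x (subset_closure hx)
  have h2 := (classicalPartial_congr h1 j).eq_of_nhds
  rw [h1.eq_of_nhds, h2]
  simp [classicalPartial]

/-! ### Truncation -/

/-- A smooth cutoff function on the space of values. -/
def valueCutoff : ContDiffBump (0 : ℝ × ℝ) := ⟨1, 2, one_pos, one_lt_two⟩

/-- The component `π z` of `z`, truncated by a scalar factor for large values of `z`. -/
def trunc (π : ℝ × ℝ →L[ℝ] ℝ) (z : ℝ × ℝ) : ℝ := valueCutoff z * π z

theorem contDiff_trunc (π : ℝ × ℝ →L[ℝ] ℝ) : ContDiff ℝ ∞ (trunc π) :=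
  valueCutoff.contDiff.mul π.contDiff

theorem hasCompactSupport_trunc (π : ℝ × ℝ →L[ℝ] ℝ) : HasCompactSupport (trunc π) :=
  valueCutoff.hasCompactSupport.mul_right

theorem fderiv_trunc_zero (π : ℝ × ℝ →L[ℝ] ℝ) : fderiv ℝ (trunc π) 0 = π := by
  have h : trunc π =ᶠ[𝓝 0] π := by
    filter_upwards [valueCutoff.eventuallyEq_one] with z hz
    rw [trunc, hz, Pi.one_apply, one_mul]
  rw [h.fderiv_eq, π.fderiv]

/-- The rescaled truncation. -/
def truncAt (π : ℝ × ℝ →L[ℝ] ℝ) (m : ℕ) (z : ℝ × ℝ) : ℝ :=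
  ((m : ℝ) + 1) * trunc π (((m : ℝ) + 1)⁻¹ • z)

theorem truncAt_eq (π : ℝ × ℝ →L[ℝ] ℝ) (m : ℕ) (z : ℝ × ℝ) :
    truncAt π m z = valueCutoff (((m : ℝ) + 1)⁻¹ • z) * π z := by
  have : ((m : ℝ) + 1) ≠ 0 := by positivity
  rw [truncAt, trunc, map_smul, smul_eq_mul]
  field_simp

theorem contDiff_truncAt (π : ℝ × ℝ →L[ℝ] ℝ) (m : ℕ) : ContDiff ℝ ∞ (truncAt π m) :=
  contDiff_const.mul ((contDiff_trunc π).comp (contDiff_const_smul _))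

theorem fderiv_truncAt (π : ℝ × ℝ →L[ℝ] ℝ) (m : ℕ) (z : ℝ × ℝ) :
    fderiv ℝ (truncAt π m) z = fderiv ℝ (trunc π) (((m : ℝ) + 1)⁻¹ • z) := by
  have hm : ((m : ℝ) + 1) ≠ 0 := by positivity
  have h1 : HasFDerivAt (fun z : ℝ × ℝ => ((m : ℝ) + 1)⁻¹ • z)
      (((m : ℝ) + 1)⁻¹ • ContinuousLinearMap.id ℝ (ℝ × ℝ)) z :=
    (((m : ℝ) + 1)⁻¹ • ContinuousLinearMap.id ℝ (ℝ × ℝ)).hasFDerivAt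
  have h2 := ((((contDiff_trunc π).differentiable (by simp) _).hasFDerivAt.comp z h1).const_mul
    ((m : ℝ) + 1)).fderiv
  refine Eq.trans h2 ?_
  ext <;> simp [hm]

theorem exists_bound_fderiv_truncAt (π : ℝ × ℝ →L[ℝ] ℝ) :
    ∃ C, ∀ m z, ‖fderiv ℝ (truncAt π m) z‖ ≤ C := by
  obtain ⟨C, hC⟩ := ((contDiff_trunc π).continuous_fderiv (by simp)).bounded_above_of_compact_support
    ((hasCompactSupport_trunc π).fderiv (𝕜 := ℝ))
  exact ⟨C, fun m z => by rw [fderiv_truncAt]; exact hC _⟩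

theorem exists_bound_truncAt (π : ℝ × ℝ →L[ℝ] ℝ) (m : ℕ) : ∃ M, ∀ z, |truncAt π m z| ≤ M := by
  obtain ⟨C, hC⟩ := (contDiff_trunc π).continuous.bounded_above_of_compact_support
    (hasCompactSupport_trunc π)
  refine ⟨((m : ℝ) + 1) * C, fun z => ?_⟩
  rw [truncAt, abs_mul, abs_of_nonneg (by positivity : (0 : ℝ) ≤ (m : ℝ) + 1)]
  exact mul_le_mul_of_nonneg_left (hC _) (by positivity)

theorem tendsto_fderiv_truncAt (π : ℝ × ℝ →L[ℝ] ℝ) (z v : ℝ × ℝ) :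
    Tendsto (fun m => fderiv ℝ (truncAt π m) z v) atTop (𝓝 (π v)) := by
  have h1 : Tendsto (fun m : ℕ => ((m : ℝ) + 1)⁻¹ • z) atTop (𝓝 0) := by
    simpa using (tendsto_one_div_add_atTop_nhds_zero_nat (𝕜 := ℝ)).smul_const z
  have hc : Continuous fun y => fderiv ℝ (trunc π) y v :=
    ((contDiff_trunc π).continuous_fderiv (by simp)).clm_apply continuous_const
  have h2 := (hc.tendsto 0).comp h1
  rw [fderiv_trunc_zero] at h2
  exact h2.congr fun m => by rw [fderiv_truncAt]; rfl

/-- Reduction to bounded fields. Both components are truncated by the same scalar factor, so e·g = 0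
persists for every direction e. The derivatives of the truncations are uniformly bounded and
converge pointwise to the coordinate projections, which lets the form pass to the limit. -/
theorem sum_jac_eq_zero {u g w h : Fin 2 → Plane → ℝ} {du dw : Fin 2 → Fin 2 → Plane → ℝ}
    (hu : ∀ i, P.HasTraceWith (u i) (du i) (g i)) (hw : ∀ i, P.HasTraceWith (w i) (dw i) (h i))
    (hn : ∀ k, (∀ᵐ y ∂P.edgeMeasure k, P.normal k 0 * g 0 y + P.normal k 1 * g 1 y = 0) ∨
      ∀ᵐ y ∂P.edgeMeasure k, P.normal k 0 * h 0 y + P.normal k 1 * h 1 y = 0)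
    (ht : ∀ k, (∀ᵐ y ∂P.edgeMeasure k, P.tangent k 0 * g 0 y + P.tangent k 1 * g 1 y = 0) ∨
      ∀ᵐ y ∂P.edgeMeasure k, P.tangent k 0 * h 0 y + P.tangent k 1 * h 1 y = 0) :
    ∑ i, P.jac (du i) (dw i) = 0 := by
  let π : Fin 2 → (ℝ × ℝ →L[ℝ] ℝ) := ![ContinuousLinearMap.fst ℝ ℝ ℝ, ContinuousLinearMap.snd ℝ ℝ ℝ]
  choose C hC using fun i => exists_bound_fderiv_truncAt (π i)
  have htr : ∀ m i, P.HasTraceWith (fun x => truncAt (π i) m (u 0 x, u 1 x))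
      (fun j x => fderiv ℝ (truncAt (π i) m) (u 0 x, u 1 x) (1, 0) * du 0 j x +
        fderiv ℝ (truncAt (π i) m) (u 0 x, u 1 x) (0, 1) * du 1 j x)
      (fun x => truncAt (π i) m (g 0 x, g 1 x)) := fun m i =>
    (hu 0).comp (hu 1) (contDiff_truncAt _ m) (hC i m)
  have hdir : ∀ m (e : Plane) (a b : ℝ), e 0 * a + e 1 * b = 0 →
      e 0 * truncAt (π 0) m (a, b) + e 1 * truncAt (π 1) m (a, b) = 0 := by
    intro m e a b hab
    rw [truncAt_eq, truncAt_eq]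
    change e 0 * (_ * a) + e 1 * (_ * b) = 0
    linear_combination valueCutoff (((m : ℝ) + 1)⁻¹ • (a, b)) * hab
  have hz : ∀ m, ∑ i, P.jac (fun j x =>
      fderiv ℝ (truncAt (π i) m) (u 0 x, u 1 x) (1, 0) * du 0 j x +
        fderiv ℝ (truncAt (π i) m) (u 0 x, u 1 x) (0, 1) * du 1 j x) (dw i) = 0 := by
    intro m
    choose M hM using fun i => exists_bound_truncAt (π i) m
    refine sum_jac_eq_zero_of_bounded (htr m) hw
      (fun k => (hn k).imp_left fun hk => hk.mono fun y hy => hdir m _ _ _ hy)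
      (fun k => (ht k).imp_left fun hk => hk.mono fun y hy => hdir m _ _ _ hy)
      (M := max (M 0) (M 1)) fun i x => ?_
    refine (hM i _).trans ?_
    fin_cases i
    exacts [le_max_left _ _, le_max_right _ _]
  have hlim : ∀ i, Tendsto (fun m => P.jac (fun j x =>
      fderiv ℝ (truncAt (π i) m) (u 0 x, u 1 x) (1, 0) * du 0 j x +
        fderiv ℝ (truncAt (π i) m) (u 0 x, u 1 x) (0, 1) * du 1 j x) (dw i)) atTop
      (𝓝 (P.jac (du i) (dw i))) := by
    intro i
    have hmul : ∀ v : ℝ × ℝ, ‖v‖ ≤ 1 → ∀ l j, TendstoL2 (volume.restrict P.Ω)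
        (fun m x => fderiv ℝ (truncAt (π i) m) (u 0 x, u 1 x) v * du l j x)
        (fun x => π i v * du l j x) := by
      intro v hv l j
      refine tendstoL2_bdd_mul_of_tendsto_ae ((hu l).memLp_partial j) (C := C i) (fun m => ?_)
        (fun m => .of_forall fun x => ?_) (.of_forall fun x => tendsto_fderiv_truncAt _ _ _)
      · exact (((contDiff_truncAt (π i) m).continuous_fderiv (by simp)).clm_apply
          continuous_const).comp_aestronglyMeasurable ((hu 0).memLp.1.prodMk (hu 1).memLp.1)
      · exact ((fderiv ℝ (truncAt (π i) m) _).le_opNorm v).trans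
          ((mul_le_of_le_one_right (norm_nonneg _) hv).trans (hC i m _))
    refine tendsto_jac (fun j => ?_) (hw i).memLp_partial
    refine ((hmul (1, 0) (by simp [Prod.norm_def]) 0 j).add
      (hmul (0, 1) (by simp [Prod.norm_def]) 1 j)).congr (.of_forall fun x => ?_)
    fin_cases i <;> simp [π]
  have := tendsto_finsetSum Finset.univ fun i _ => hlim i
  simp only [hz] at this
  exact (tendsto_nhds_unique tendsto_const_nhds this).symm

end Plate
-- Traces of functions in W and sufficiency of the boundary conditions.
-- Mixed weak derivatives commute because those of test functions do.
theorem isWeakPartial_swap {Ω : Set Plane} {v : Plane → ℝ} (hv : MemH1 Ω v) {i j : Fin 2}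
    (h : MemH1 Ω (weakPartial Ω j v)) :
    IsWeakPartial Ω j (weakPartial Ω i v) (weakPartial Ω i (weakPartial Ω j v)) := by
  refine ⟨(h.isWeakPartial i).1, fun φ hφ hc hs => ?_⟩
  have hd := fun l => contDiff_classicalPartial hφ l
  have hcd : ∀ l, HasCompactSupport (classicalPartial l φ) := fun l => hc.fderiv_apply (𝕜 := ℝ) _
  have hsd : ∀ l, tsupport (classicalPartial l φ) ⊆ Ω := fun l =>
    (tsupport_fderiv_apply_subset φ _).trans hs
  have h1 := (h.isWeakPartial i).2 φ hφ hc hs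
  have h2 := (hv.isWeakPartial j).2 _ (hd i) (hcd i) (hsd i)
  have h3 := (hv.isWeakPartial i).2 _ (hd j) (hcd j) (hsd j)
  simp only [classicalPartial_comm hφ i j] at h3
  rw [h2] at h3
  rw [← h1]
  exact (neg_injective h3).symm

namespace Plate

variable {P : Plate}

/-- Integration by parts along the boundary for the tangential derivative of a function in
`H²(Ω)`. -/
theorem sum_integral_mul_tangential {v gv : Plane → ℝ} {h : Plane → Plane} (hv : MemH2 P.Ω v)
    (hgv : P.HasTrace v gv) (hh : P.HasTraceVec (weakGrad P.Ω v) h) {η : Plane → ℝ}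
    (hη : ContDiff ℝ ∞ η) :
    ∑ k, ∫ y, η y * inner ℝ (h y) (P.tangent k) ∂P.edgeMeasure k =
      -∑ k, ∫ y, fderiv ℝ η y (P.tangent k) * gv y ∂P.edgeMeasure k := by
  have hd := fun i => contDiff_classicalPartial hη i
  have hw : ∀ i, P.HasTraceWith (weakPartial P.Ω i v)
      (fun j => weakPartial P.Ω j (weakPartial P.Ω i v)) (fun x => h x i) := fun i =>
    (hh i).hasTraceWith
  have hsym : weakPartial P.Ω 1 (weakPartial P.Ω 0 v) =ᵐ[volume.restrict P.Ω]
      weakPartial P.Ω 0 (weakPartial P.Ω 1 v) :=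
    (isWeakPartial_swap hv.1 (hv.2 1)).weakPartial_ae_eq P.isOpen P.isBounded
  -- In the difference of the two Green formulas the second derivatives of v cancel. The first-order
  -- terms that remain are the antisymmetric form of η and v, which is again a boundary integral.
  have g0 := (hw 0).green hη 1
  have g1 := (hw 1).green hη 0
  have es : ∫ y in P.Ω, η y * weakPartial P.Ω 1 (weakPartial P.Ω 0 v) y =
      ∫ y in P.Ω, η y * weakPartial P.Ω 0 (weakPartial P.Ω 1 v) y :=
    integral_congr_ae (hsym.mono fun y hy => by simp only [hy])
  have hj := hgv.hasTraceWith.jac_smooth hη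
  rw [jac, integral_sub ((P.memLp_volume (hd 1)).integrable_fun_mul (hw 0).memLp)
    ((P.memLp_volume (hd 0)).integrable_fun_mul (hw 1).memLp)] at hj
  have e : ∑ k, ∫ y, η y * inner ℝ (h y) (P.tangent k) ∂P.edgeMeasure k =
      ∑ k, (P.normal k 0 * (∫ y, η y * h y 1 ∂P.edgeMeasure k) -
        P.normal k 1 * ∫ y, η y * h y 0 ∂P.edgeMeasure k) := by
    refine Finset.sum_congr rfl fun k _ => ?_
    have hi : ∀ i, Integrable (fun y => η y * h y i) (P.edgeMeasure k) := fun i =>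
      (P.memLp_edge (P.memLp_boundary hη) k).integrable_fun_mul (P.memLp_edge (hh i).2.1 k)
    rw [← integral_const_mul, ← integral_const_mul, ← integral_sub ((hi 1).const_mul _)
      ((hi 0).const_mul _)]
    congr 1
    ext y
    rw [inner_plane, normal_zero, normal_one]; ring
  rw [e, Finset.sum_sub_distrib, ← g0, ← g1, ← hj, es]
  ring

/-- The tangential derivative vanishes on an edge where the function vanishes. -/
theorem inner_tangent_eq_zero {v gv : Plane → ℝ} {h : Plane → Plane} (hv : MemH2 P.Ω v)
    (hgv : P.HasTrace v gv) (hh : P.HasTraceVec (weakGrad P.Ω v) h) {k : Fin P.K}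
    (hk : ∀ᵐ y ∂P.edgeMeasure k, gv y = 0) :
    ∀ᵐ y ∂P.edgeMeasure k, inner ℝ (h y) (P.tangent k) = 0 := by
  rw [P.ae_edge_iff, ae_restrict_iff' measurableSet_Ioo]
  refine isOpen_Ioo.ae_eq_zero_of_integral_contDiff_smul_eq_zero
    (P.integrableOn_inner_arc (fun i => (hh i).2.1) k (P.tangent k)).locallyIntegrableOn ?_
  intro χ hχ hc hs
  have hu : ContDiff ℝ ∞ fun y : Plane => χ (inner ℝ (y - P.p k) (P.tangent k)) :=
    hχ.comp (contDiff_inner_sub _ _)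
  -- With η supported near edge k, integration by parts along Γ leaves only the trace of v on that
  -- edge, which is zero.
  obtain ⟨η, hη, hηk, hηl⟩ := P.exists_edge_test k hc hs hu
    (fun y hy => image_eq_zero_of_notMem_tsupport hy)
  have e1 : ∀ l, l ≠ k → ∫ y, η y * inner ℝ (h y) (P.tangent l) ∂P.edgeMeasure l = 0 := by
    intro l hl
    refine integral_eq_zero_of_ae ?_
    filter_upwards [P.ae_edge_mem l] with y hy
    simp [(hηl l hl y hy).eq_of_nhds]
  have e2 : ∀ l, ∫ y, fderiv ℝ η y (P.tangent l) * gv y ∂P.edgeMeasure l = 0 := by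
    intro l
    refine integral_eq_zero_of_ae ?_
    by_cases hl : l = k
    · subst hl
      filter_upwards [hk] with y hy
      simp [hy]
    · filter_upwards [P.ae_edge_mem l] with y hy
      simp [(hηl l hl y hy).fderiv_eq]
  have key := sum_integral_mul_tangential hv hgv hh hη
  rw [Finset.sum_eq_single k (fun l _ hl => e1 l hl) (by simp),
    Finset.sum_eq_zero (fun l _ => e2 l), neg_zero, P.integral_edge] at key
  rw [← key, ← setIntegral_eq_integral_of_forall_compl_eq_zero (s := Ioo 0 (P.len k))]
  · refine setIntegral_congr_fun measurableSet_Ioo fun s hs' => ?_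
    simp only [(hηk _ (P.arc_mem_edge hs')).eq_of_nhds, P.inner_arc_sub_tangent, smul_eq_mul]
  · intro s hs'
    rw [image_eq_zero_of_notMem_tsupport fun h' => hs' (hs h'), zero_smul]

theorem fderiv_tangent_eq {f : Plane → ℝ} (hf : ContDiff ℝ ∞ f) {k : Fin P.K} {F : ℝ → ℝ} {F' s : ℝ}
    (hs : s ∈ Ioo 0 (P.len k)) (hF : HasDerivAt F F' s)
    (h : ∀ t ∈ Ioo 0 (P.len k), f (P.arc k t) = F t) :
    fderiv ℝ f (P.arc k s) (P.tangent k) = F' := by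
  refine (P.hasDerivAt_comp_arc k hf s).unique (hF.congr_of_eventuallyEq ?_)
  filter_upwards [isOpen_Ioo.mem_nhds hs] with t ht using h t ht

/-- The traces of a function in `W` and of its gradient. -/
theorem exists_traces_of_mem_W {v : Plane → ℝ} (hv : v ∈ P.W) : ∃ gv h, P.HasTrace v gv ∧
    P.HasTraceVec (weakGrad P.Ω v) h ∧ (∀ k, P.bc k ≠ BC.free → ∀ᵐ y ∂P.edgeMeasure k, gv y = 0) ∧
    (∀ k, P.bc k ≠ BC.free → ∀ᵐ y ∂P.edgeMeasure k, inner ℝ (h y) (P.tangent k) = 0) ∧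
    ∀ k, P.bc k = BC.clamped → ∀ᵐ y ∂P.edgeMeasure k, inner ℝ (h y) (P.normal k) = 0 := by
  obtain ⟨hv2, ⟨gv, hgv, h0⟩, h, hh, h1⟩ := hv
  have h0' : ∀ k, P.bc k ≠ BC.free → ∀ᵐ y ∂P.edgeMeasure k, gv y = 0 := fun k hk => by
    refine h0 k ?_
    cases hb : P.bc k
    · exact .inl rfl
    · exact .inr rfl
    · exact absurd hb hk
  exact ⟨gv, h, hgv, hh, h0', fun k hk => inner_tangent_eq_zero hv2 hgv hh (h0' k hk), h1⟩

theorem component_eq_of_consecutive {k l : Fin P.K} (hk : P.bc k = BC.free) (hkl : P.q k = P.p l) :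
    connectedComponentIn P.freeBoundary (P.p k) = connectedComponentIn P.freeBoundary (P.p l) := by
  rw [← hkl]
  exact connectedComponentIn_eq ((isPreconnected_seg k).subset_connectedComponentIn (P.p_mem_seg k)
    (seg_subset_freeBoundary hk) (P.q_mem_seg k))

/-- The pairing vanishes for smooth functions satisfying the boundary conditions. -/
theorem sum_jac_smooth_eq_zero {c : Fin P.K → ℝ} {r : Set Plane → Plane → Plane}
    (hcr : P.IsCompatible c r) {ψ : Plane → Plane} (hψ : ContDiff ℝ ∞ ψ)
    (h1 : ∀ k, P.bc k = BC.simplySupported → ∀ y ∈ P.edge k, inner ℝ (ψ y) (P.normal k) = c k)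
    (h2 : ∀ C ∈ P.freeComponents, ∀ y ∈ C, ψ y = r C y) {v : Plane → ℝ} (hv : MemH2 P.Ω v)
    {gv : Plane → ℝ} {h : Plane → Plane} (hgv : P.HasTrace v gv)
    (hh : P.HasTraceVec (weakGrad P.Ω v) h)
    (hg0 : ∀ k, P.bc k ≠ BC.free → ∀ᵐ y ∂P.edgeMeasure k, gv y = 0)
    (ht : ∀ k, P.bc k ≠ BC.free → ∀ᵐ y ∂P.edgeMeasure k, inner ℝ (h y) (P.tangent k) = 0)
    (hn : ∀ k, P.bc k = BC.clamped → ∀ᵐ y ∂P.edgeMeasure k, inner ℝ (h y) (P.normal k) = 0) :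
    ∑ i, P.jac (fun j => classicalPartial j fun x => ψ x i)
      (fun j => weakPartial P.Ω j fun x => weakGrad P.Ω v x i) = 0 := by
  have hψi := fun i => contDiff_coord hψ i
  have hr : ∀ C, ∃ ab : ℝ × Plane, C ∈ P.freeComponents → r C = fun x => ab.1 • x + ab.2 := by
    intro C
    by_cases hC : C ∈ P.freeComponents
    · obtain ⟨a, b, hab⟩ := hcr.1 C hC
      exact ⟨(a, b), fun _ => hab⟩
    · exact ⟨0, fun h => absurd h hC⟩
  choose ab hab using hr
  set comp : Fin P.K → Set Plane := fun k => connectedComponentIn P.freeBoundary (P.p k) with hcomp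
  have hcm : ∀ k, P.bc k = BC.free → comp k ∈ P.freeComponents := fun k hk =>
    ⟨P.p k, seg_subset_freeBoundary hk (P.p_mem_seg k), rfl⟩
  have hsc : ∀ k, P.bc k = BC.free → P.seg k ⊆ comp k := fun k hk =>
    (isPreconnected_seg k).subset_connectedComponentIn (P.p_mem_seg k) (seg_subset_freeBoundary hk)
  -- The slope of r on each component is extended to a smooth η. On every edge the integrand is then
  -- η ∂v/∂t: on a free edge ∂ψ/∂t = a t, on a simply supported edge ∇v is normal while ∂ψ/∂t · n =
  -- 0, and on a clamped edge ∇v = 0.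
  obtain ⟨η, hη, hηk⟩ := exists_smooth_eq_on_free (P := P) (a := fun k => (ab (comp k)).1)
    (fun k l hk _ hkl => by
      change (ab (connectedComponentIn _ _)).1 = (ab (connectedComponentIn _ _)).1
      rw [component_eq_of_consecutive hk hkl])
  have hint : ∀ k i, Integrable (fun y => fderiv ℝ (fun x => ψ x i) y (P.tangent k) * h y i)
      (P.edgeMeasure k) := fun k i =>
    (P.memLp_edge (P.memLp_boundary (contDiff_fderiv_apply (hψi i) _)) k).integrable_fun_mul
      (P.memLp_edge (hh i).2.1 k)
  have e1 : ∑ i, P.jac (fun j => classicalPartial j fun x => ψ x i)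
      (fun j => weakPartial P.Ω j fun x => weakGrad P.Ω v x i) =
      ∑ k, ∫ y, η y * inner ℝ (h y) (P.tangent k) ∂P.edgeMeasure k := by
    rw [Finset.sum_congr rfl fun i _ => (hh i).hasTraceWith.jac_smooth (hψi i), Finset.sum_comm]
    refine Finset.sum_congr rfl fun k _ => ?_
    rw [← integral_finsetSum _ fun i _ => hint k i]
    refine integral_congr_ae ?_
    simp only [Fin.sum_univ_two]
    cases hb : P.bc k
    · filter_upwards [hn k hb, ht k (by simp [hb])] with y hy1 hy2
      have hz : h y = 0 := by
        rw [P.plane_decomposition k (h y), hy1, hy2, zero_smul, zero_smul, add_zero]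
      simp [hz]
    · filter_upwards [ht k (by simp [hb]), P.ae_edge_mem k] with y hy hye
      obtain ⟨s, hs, rfl⟩ := P.mem_edge_iff.1 hye
      have hd : fderiv ℝ (fun x => P.normal k 0 * ψ x 0 + P.normal k 1 * ψ x 1) (P.arc k s)
          (P.tangent k) = 0 :=
        fderiv_tangent_eq ((contDiff_const.mul (hψi 0)).add (contDiff_const.mul (hψi 1))) hs
          (hasDerivAt_const s (c k)) fun t ht' => by
            rw [← h1 k hb _ (P.arc_mem_edge ht'), inner_plane]; ring
      have hd' : P.normal k 0 * fderiv ℝ (fun x => ψ x 0) (P.arc k s) (P.tangent k) +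
          P.normal k 1 * fderiv ℝ (fun x => ψ x 1) (P.arc k s) (P.tangent k) = 0 := by
        rw [← hd]
        exact (((P.hasDerivAt_comp_arc k (hψi 0) s).const_mul _).add
          ((P.hasDerivAt_comp_arc k (hψi 1) s).const_mul _)).unique
          (P.hasDerivAt_comp_arc k
            ((contDiff_const.mul (hψi 0)).add (contDiff_const.mul (hψi 1))) s)
      change _ * h (P.arc k s) 0 + _ * h (P.arc k s) 1 = _ * inner ℝ (h (P.arc k s)) (P.tangent k)
      change inner ℝ (h (P.arc k s)) (P.tangent k) = 0 at hy
      have hdec := P.plane_decomposition k (h (P.arc k s))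
      rw [hy, zero_smul, zero_add] at hdec
      rw [hy, mul_zero, hdec]
      simp only [PiLp.smul_apply, smul_eq_mul]
      change fderiv ℝ (fun x => ψ x 0) (P.arc k s) (P.tangent k) * _ +
        fderiv ℝ (fun x => ψ x 1) (P.arc k s) (P.tangent k) * _ = 0
      linear_combination (inner ℝ (h (P.arc k s)) (P.normal k)) * hd'
    · filter_upwards [P.ae_edge_mem k] with y hye
      obtain ⟨s, hs, rfl⟩ := P.mem_edge_iff.1 hye
      have hd : ∀ i, fderiv ℝ (fun x => ψ x i) (P.arc k s) (P.tangent k) =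
          (ab (comp k)).1 * P.tangent k i := by
        intro i
        refine fderiv_tangent_eq (hψi i) hs (F := fun t => (ab (comp k)).1 * P.p k i +
          (ab (comp k)).1 * P.tangent k i * t + (ab (comp k)).2 i) ?_ fun t ht' => ?_
        · simpa using (((hasDerivAt_id s).const_mul ((ab (comp k)).1 * P.tangent k i)).const_add
            ((ab (comp k)).1 * P.p k i)).add_const ((ab (comp k)).2 i)
        · rw [h2 _ (hcm k hb) _ (hsc k hb (P.edge_subset_seg k (P.arc_mem_edge ht'))),
            hab _ (hcm k hb)]
          simp only [PiLp.add_apply, PiLp.smul_apply, smul_eq_mul, arc]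
          ring
      rw [hηk k hb _ (P.edge_subset_seg k hye), inner_plane]
      have hd0 := hd 0
      have hd1 := hd 1
      rw [arc] at hd0 hd1
      rw [hd0, hd1]
      ring
  rw [e1, sum_integral_mul_tangential hv hgv hh hη, neg_eq_zero]
  refine Finset.sum_eq_zero fun k _ => integral_eq_zero_of_ae ?_
  by_cases hb : P.bc k = BC.free
  · filter_upwards [P.ae_edge_mem k] with y hye
    obtain ⟨s, hs, rfl⟩ := P.mem_edge_iff.1 hye
    have := fderiv_tangent_eq hη hs (hasDerivAt_const s (ab (comp k)).1) fun t ht' =>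
      hηk k hb _ (P.edge_subset_seg k (P.arc_mem_edge ht'))
    rw [arc] at this
    rw [this, zero_mul]
    rfl
  · filter_upwards [hg0 k hb] with y hy
    rw [hy, mul_zero]
    rfl

/-- The smooth extension ψ₀ of the same data is subtracted. The difference has zero trace on free
edges and zero normal trace on simply supported ones, which complements ∇v: zero on clamped edges,
with zero tangential part on simply supported ones. -/
theorem mem_Psi0_of_satisfiesBC {ψ : Plane → Plane} (hψ : MemH1Vec P.Ω ψ) {c : Fin P.K → ℝ}
    {r : Set Plane → Plane → Plane} (hcr : P.IsCompatible c r) (h : P.SatisfiesBC ψ c r) :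
    ψ ∈ P.Psi0 := by
  refine ⟨hψ, fun v hvW => ?_⟩
  obtain ⟨g, hg, hgs, hgf⟩ := h
  obtain ⟨ψ₀, hψ₀, h1, h2⟩ := exists_smooth_of_compatible hcr
  obtain ⟨gv, t, hgv, ht, ht0, htt, htn⟩ := exists_traces_of_mem_W hvW
  have hs := sum_jac_smooth_eq_zero hcr hψ₀ h1 h2 hvW.1 hgv ht ht0 htt htn
  rw [tangentialPairing_eq hψ hvW.1.2]
  have hu : ∀ i, P.HasTraceWith (fun x => ψ x i + -1 * ψ₀ x i)
      (fun j x => weakPartial P.Ω j (fun x => ψ x i) x +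
        -1 * classicalPartial j (fun x => ψ₀ x i) x) (fun x => g x i + -1 * ψ₀ x i) := fun i =>
    (hg i).hasTraceWith.add ((P.hasTraceWith_smooth (contDiff_coord hψ₀ i)).const_mul (-1))
  have hfree : ∀ k, P.bc k = BC.free → ∀ᵐ y ∂P.edgeMeasure k, g y = ψ₀ y := by
    intro k hk
    have hC : connectedComponentIn P.freeBoundary (P.p k) ∈ P.freeComponents :=
      ⟨P.p k, seg_subset_freeBoundary hk (P.p_mem_seg k), rfl⟩
    have hk' := hgf _ hC
    rw [ae_restrict_iff' (isClosed_component hC).measurableSet, P.ae_boundary_iff] at hk'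
    filter_upwards [hk' k, P.ae_edge_mem k] with y hy hyk
    have hyC := (isPreconnected_seg k).subset_connectedComponentIn (P.p_mem_seg k)
      (seg_subset_freeBoundary hk) (P.edge_subset_seg k hyk)
    rw [hy hyC, h2 _ hC y hyC]
  have hdir : ∀ k (e : Plane), (∀ᵐ y ∂P.edgeMeasure k, inner ℝ (t y) e = 0) →
      ∀ᵐ y ∂P.edgeMeasure k, e 0 * t y 0 + e 1 * t y 1 = 0 := fun k e he =>
    he.mono fun y hy => by rw [← hy, inner_plane]; ring
  have hdirf : ∀ k (e : Plane), P.bc k = BC.free → ∀ᵐ y ∂P.edgeMeasure k,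
      e 0 * (g y 0 + -1 * ψ₀ y 0) + e 1 * (g y 1 + -1 * ψ₀ y 1) = 0 := fun k e hk =>
    (hfree k hk).mono fun y hy => by rw [hy]; ring
  have key := sum_jac_eq_zero hu (fun i => (ht i).hasTraceWith) (fun k => by
      cases hb : P.bc k
      · exact .inr (hdir k _ (htn k hb))
      · refine .inl ?_
        filter_upwards [hgs k hb, P.ae_edge_mem k] with y hy hyk
        have h3 := h1 k hb y hyk
        rw [← hy, inner_plane, inner_plane] at h3
        linear_combination -h3
      · exact .inl (hdirf k _ hb))
    (fun k => by
      by_cases hb : P.bc k = BC.free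
      · exact .inl (hdirf k _ hb)
      · exact .inr (hdir k _ (htt k hb)))
  have hsplit : ∀ i, P.jac (fun j x => weakPartial P.Ω j (fun x => ψ x i) x +
        -1 * classicalPartial j (fun x => ψ₀ x i) x)
      (fun j => weakPartial P.Ω j fun x => weakGrad P.Ω v x i) =
      P.jac (fun j => weakPartial P.Ω j fun x => ψ x i)
        (fun j => weakPartial P.Ω j fun x => weakGrad P.Ω v x i) +
      -1 * P.jac (fun j => classicalPartial j fun x => ψ₀ x i)
        (fun j => weakPartial P.Ω j fun x => weakGrad P.Ω v x i) := by
    intro i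
    rw [jac_add (hg i).hasTraceWith.memLp_partial (fun j => (P.memLp_volume
      (contDiff_classicalPartial (contDiff_coord hψ₀ i) j)).const_mul _)
      (ht i).hasTraceWith.memLp_partial, jac_const_mul]
  rw [Finset.sum_congr rfl fun i _ => hsplit i, Finset.sum_add_distrib, ← Finset.mul_sum, hs,
    mul_zero, add_zero] at key
  exact key

end Plate
end KirchhoffPlate

end

theorem mainTheorem7 (P : KirchhoffPlate.Plate)
    (hclamped : ∃ k, P.bc k = KirchhoffPlate.BC.clamped) :
    P.Psi0 = {ψ | KirchhoffPlate.MemH1Vec P.Ω ψ ∧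
      ∃ c r, P.IsCompatible c r ∧ P.SatisfiesBC ψ c r} ∧
    ∀ c r, P.IsCompatible c r →
      ∃ ψ, KirchhoffPlate.MemH1Vec P.Ω ψ ∧ P.SatisfiesBC ψ c r := by
  refine ⟨Set.Subset.antisymm (fun ψ hψ => ⟨hψ.1, ?_⟩) ?_, fun c r hcr => ?_⟩
  · exact KirchhoffPlate.Plate.exists_compatible_of_mem_Psi0 hψ
  · rintro ψ ⟨hψ, c, r, hcr, h⟩
    exact KirchhoffPlate.Plate.mem_Psi0_of_satisfiesBC hψ hcr h
  · exact KirchhoffPlate.Plate.exists_satisfiesBC hcr
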